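/- **Conventions.** For a conformal minimal immersion $X$ of a Riemann surface into $\mathbb R^3$ let $N$ be its oriented unit normal, $g=\sigma\circ N$ with $\sigma(x)=(x_1+ix_2)/(1-x_3)$ the stereographic projection from the north pole (so $g=0$ iff $N=(0,0,-1)$, and $g=\infty$ iff $N=(0,0,1)$), and $dh$ the holomorphic one-form with $\operatorname{Re}dh=dx_3$; $(g,dh)$ are the Weierstrass data of $X$. For $\lambda>0$ the López–Ros deformation $X_\lambda$ is the (possibly multivalued) map, unique up to translations, $$X_\lambda=\operatorname{Re}\int\Big(\tfrac12\big(\lambda^{-1}g^{-1}-\lambda g\big),\ \tfrac i2\big(\lambda^{-1}g^{-1}+\lambda g\big),\ 1\Big)\,dh .$$ The $k$-Enneper surface is $E_k:\mathbb C\to\mathbb R^3$, $E_k(\zeta)=\operatorname{Re}\int_0^\zeta\big(\tfrac12(1-z^{2k}),\tfrac i2(1+z^{2k}),z^k\big)\,dz$, with Weierstrass data $g=z^k$, $dh=z^k\,dz$. **Proposition 3.4.** (i) Let $M$ be a connected Riemann surface and $X:M\to\mathbb R^3$ a conformal minimal immersion whose image is not contained in a plane. Let $p\in M$ be a point with vertical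 normal, and put $s=1$ if $N(p)=(0,0,-1)$ (that is, $g(p)=0$) and $s=-1$ if $N(p)=(0,0,1)$ (that is, $g(p)=\infty$). Then there are an integer $k\ge1$, a real $r>0$ and a rotation $A\in SO(3)$ with $A(0,0,1)=(0,0,s)$ such that every neighbourhood $V$ of $p$ contains the domain $U\ni p$ of a holomorphic coordinate $z$ that maps $U$ onto a disc centred at $0$, with $z(p)=0$ and $g^s=c\,z^k$ on $U\setminus\{p\}$ for some $c\in\mathbb C$ with $|c|=1$, and such that: * $X_\lambda$ is single-valued on $U$ for every $\lambda>0$; * there is $\Lambda>0$ such that for all $\mu\ge\Lambda$ the map $X_{\mu^s}$ is not injective on $U$ (in particular, $X_{\mu^s}$ is not an embedding of $V$); * as $\mu\to\infty$, the rescaled maps $$\zeta\longmapsto \mu^{1+1/k}\Big(X_{\mu^s}\big(z^{-1}(\mu^{-1/k}\zeta)\big)-X_{\mu^s}(p)\Big)$$ converge, uniformly on compact subsets of $\mathbb C$, to $\zeta\mapsto r\,A\,E_k(\zeta)$. (ii) Let $\varepsilon>0$, $D^*=\{z\in\mathbb C: 0<|z|<\varepsilon\}$, and let $X:D^*\to\mathbb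 R^3$ be an injective conformal minimal immersion that represents a flat end with vertical limit normal: $X$ is complete at $0$ (curves in $D^*$ that tend to $0$ have infinite length), it has finite total curvature near $0$, $N(z)\to(0,0,-s)$ as $z\to0$ with $s\in\{1,-1\}$, and its logarithmic growth is zero, that is, with $\rho=(x_1^2+x_2^2)^{1/2}$ and for suitable $\beta,\gamma_1,\gamma_2\in\mathbb R$, along the end $x_3=\beta+\rho^{-2}(\gamma_1x_1+\gamma_2x_2)+O(\rho^{-2})$ for $\rho$ large. Then, unless $X(D^*)$ is contained in a plane, $X_\lambda$ is single-valued on $D^*$ for every $\lambda>0$, and there is $\Lambda>0$ such that for all $\mu\ge\Lambda$ the map $X_{\mu^s}$ is not injective on $D^*$; in particular it is not an embedding. -/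

import Mathlib

open Set Filter Topology MeasureTheory
open scoped Manifold ContDiff

noncomputable section

namespace LopezRos

/-- Euclidean three-space. -/
abbrev E3 : Type := EuclideanSpace ℝ (Fin 3)

/-- The vertical unit vector `(0, 0, 1)`. -/
def e3 : E3 := !₂[0, 0, 1]

/-- The vector product of `ℝ³`. -/
def cross (a b : E3) : E3 :=
  !₂[a 1 * b 2 - a 2 * b 1, a 2 * b 0 - a 0 * b 2, a 0 * b 1 - a 1 * b 0]

/-! ### Parametrized surfaces in a complex coordinate `z = u + i v` -/

/-- The partial derivative `F_u`. -/
def du (F : ℂ → E3) (z : ℂ) : E3 := fderiv ℝ F z 1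

/-- The partial derivative `F_v`. -/
def dv (F : ℂ → E3) (z : ℂ) : E3 := fderiv ℝ F z Complex.I

/-- The oriented unit normal `N = F_u × F_v / |F_u × F_v|`. -/
def unitNormal (F : ℂ → E3) (z : ℂ) : E3 :=
  ‖cross (du F z) (dv F z)‖⁻¹ • cross (du F z) (dv F z)

/-- The determinant `|F_u|² |F_v|² - ⟨F_u, F_v⟩²` of the first fundamental form. -/
def firstDet (F : ℂ → E3) (z : ℂ) : ℝ :=
  ‖du F z‖ ^ 2 * ‖dv F z‖ ^ 2 - inner ℝ (du F z) (dv F z) ^ 2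

/-- The coefficient `⟨F_uu, N⟩` of the second fundamental form. -/
def secondL (F : ℂ → E3) (z : ℂ) : ℝ := inner ℝ (du (du F) z) (unitNormal F z)

/-- The coefficient `⟨F_uv, N⟩` of the second fundamental form. -/
def secondM (F : ℂ → E3) (z : ℂ) : ℝ := inner ℝ (du (dv F) z) (unitNormal F z)

/-- The coefficient `⟨F_vv, N⟩` of the second fundamental form. -/
def secondN (F : ℂ → E3) (z : ℂ) : ℝ := inner ℝ (dv (dv F) z) (unitNormal F z)

/-- The mean curvature (average of the principal curvatures). -/
def meanCurvature (F : ℂ → E3) (z : ℂ) : ℝ :=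
  (secondL F z * ‖dv F z‖ ^ 2 - 2 * secondM F z * inner ℝ (du F z) (dv F z)
    + secondN F z * ‖du F z‖ ^ 2) / (2 * firstDet F z)

/-- The Gauss curvature (product of the principal curvatures). -/
def gaussCurvature (F : ℂ → E3) (z : ℂ) : ℝ :=
  (secondL F z * secondN F z - secondM F z ^ 2) / firstDet F z

/-- `F` is a conformal minimal immersion of the open set `U ⊆ ℂ` into `ℝ³`. -/
structure IsConformalMinimalImmersionOn (F : ℂ → E3) (U : Set ℂ) : Prop where
  smooth : ContDiffOn ℝ ∞ F U
  immersion : ∀ z ∈ U, Function.Injective (fderiv ℝ F z)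
  norm_eq : ∀ z ∈ U, ‖du F z‖ = ‖dv F z‖
  orthogonal : ∀ z ∈ U, inner ℝ (du F z) (dv F z) = 0
  minimal : ∀ z ∈ U, meanCurvature F z = 0

/-! ### Weierstrass data and the López–Ros deformation -/

/-- Stereographic projection from the north pole of the unit sphere; its value at the north
pole, which should be `∞`, is the junk value `0` and is never used. -/
def stereo (n : E3) : ℂ := (n 0 + Complex.I * n 1) / (1 - n 2)

/-- A direction is vertical if it is `(0, 0, ±1)`, i.e. if it projects to `∞` or `0`. -/
def IsVertical (n : E3) : Prop := n = e3 ∨ n = -e3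

/-- `F_u - i F_v`, the coefficient of the `ℂ³`-valued form `dF + i dF*` with respect to `dz`.
If it is the coefficient of a holomorphic form `Φ`, then `dF = Re Φ`. Its last component is the
coefficient of `dh`. -/
def complexVelocity (F : ℂ → E3) (z : ℂ) : Fin 3 → ℂ :=
  fun j => (du F z j : ℂ) - Complex.I * (dv F z j : ℂ)

/-- The Weierstrass form `(½ (g⁻¹ - g), (i/2) (g⁻¹ + g), 1) dh`, where `η` is the coefficient
of `dh`. -/
def weierstrassForm (g η : ℂ) : Fin 3 → ℂ :=
  ![(g⁻¹ - g) / 2 * η, Complex.I * (g⁻¹ + g) / 2 * η, η]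

/-- `Y` is a single-valued determination on the open set `U ⊆ ℂ` of the López–Ros deformation
`F_t = Re ∫ Φ_t` of `F`, the map with Weierstrass data `(t g, dh)`, where `(g, dh)` are the data
of `F`. The form `Φ_t` extends continuously over the points where `g` is `0` or `∞`; as `Y` is
smooth, it is enough to prescribe its differential at the other points. -/
def IsDeformationOn (t : ℝ) (F : ℂ → E3) (U : Set ℂ) (Y : ℂ → E3) : Prop :=
  ContDiffOn ℝ ∞ Y U ∧
    ∀ z ∈ U, ¬ IsVertical (unitNormal F z) →
      complexVelocity Y z
        = weierstrassForm ((t : ℂ) * stereo (unitNormal F z)) (complexVelocity F z 2)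

/-- The `k`-Enneper surface: `Re ∫₀^ζ Φ` for the Weierstrass data `g = z^k`, `dh = z^k dz`, so
that `Φ = (½ (1 - z^(2k)), (i/2) (1 + z^(2k)), z^k) dz`. -/
def enneper (k : ℕ) (ζ : ℂ) : E3 :=
  !₂[((ζ - ζ ^ (2 * k + 1) / (2 * k + 1)) / 2).re,
    (Complex.I * (ζ + ζ ^ (2 * k + 1) / (2 * k + 1)) / 2).re,
    (ζ ^ (k + 1) / (k + 1)).re]

/-- A set of `ℝ³` that is contained in some affine plane. -/
def IsPlanar (S : Set E3) : Prop :=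
  ∃ (n : E3) (c : ℝ), n ≠ 0 ∧ ∀ x ∈ S, inner ℝ n x = c

/-! ### Maps of a Riemann surface, through its holomorphic charts -/

section Surface

variable {M : Type*} [TopologicalSpace M] [ChartedSpace ℂ M]

/-- `X` is a conformal minimal immersion of the Riemann surface `M`. -/
def IsConformalMinimalImmersion (X : M → E3) : Prop :=
  ∀ e ∈ atlas ℂ M, IsConformalMinimalImmersionOn (X ∘ e.symm) e.target

/-- The Gauss map `N : M → S²`; it does not depend on the holomorphic chart. -/
def normalAt (X : M → E3) (p : M) : E3 :=
  unitNormal (X ∘ (chartAt ℂ p).symm) (chartAt ℂ p p)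

/-- `Y` is a single-valued determination of the López–Ros deformation `X_t` on the open set
`U ⊆ M`. -/
def IsDeformation (t : ℝ) (X : M → E3) (U : Set M) (Y : M → E3) : Prop :=
  ∀ e ∈ atlas ℂ M,
    IsDeformationOn t (X ∘ e.symm) (e.target ∩ e.symm ⁻¹' U) (Y ∘ e.symm)

end Surface

/-! ### Ends -/

/-- The punctured disc `0 < |z| < ε`. -/
def puncturedDisc (ε : ℝ) : Set ℂ := {z | 0 < ‖z‖ ∧ ‖z‖ < ε}

/-- Completeness at the puncture: every curve that diverges to it has infinite length. -/
def IsCompleteAtPuncture (F : ℂ → E3) (ε : ℝ) : Prop :=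
  ∀ γ : ℝ → ℂ, ContDiffOn ℝ 1 γ (Ico 0 1) → MapsTo γ (Ico 0 1) (puncturedDisc ε) →
    Tendsto γ (𝓝[<] 1) (𝓝 0) → ∫⁻ t in Ioo (0 : ℝ) 1, ‖deriv (F ∘ γ) t‖ₑ = ⊤

/-- Finite total curvature: `K dA` is integrable near the puncture. -/
def HasFiniteTotalCurvature (F : ℂ → E3) : Prop :=
  IntegrableAtFilter (fun z => gaussCurvature F z * √(firstDet F z)) (𝓝[≠] (0 : ℂ)) volume

/-- The distance `ρ = (x₁² + x₂²)^(1/2)` from the vertical axis. -/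
def rho (x : E3) : ℝ := √(x 0 ^ 2 + x 1 ^ 2)

/-- The end at the puncture has the asymptotic behaviour
`x₃ = α log ρ + β + ρ⁻² (γ₁ x₁ + γ₂ x₂) + O(ρ⁻²)`. -/
def HasLogarithmicGrowth (F : ℂ → E3) (α : ℝ) : Prop :=
  ∃ β γ₁ γ₂ C R : ℝ, ∀ᶠ z in 𝓝[≠] (0 : ℂ), R < rho (F z) →
    |F z 2 - (α * Real.log (rho (F z)) + β + (γ₁ * F z 0 + γ₂ * F z 1) / rho (F z) ^ 2)|
      ≤ C / rho (F z) ^ 2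

/-- `F` is a conformal minimal embedding of `0 < |z| < ε` that represents a flat end, with
limit normal `ν`, of a complete minimal surface of finite total curvature. -/
structure IsFlatEnd (F : ℂ → E3) (ε : ℝ) (ν : E3) : Prop where
  immersion : IsConformalMinimalImmersionOn F (puncturedDisc ε)
  injective : InjOn F (puncturedDisc ε)
  complete : IsCompleteAtPuncture F ε
  finiteCurvature : HasFiniteTotalCurvature F
  limitNormal : Tendsto (unitNormal F) (𝓝[≠] 0) (𝓝 ν)
  growth : HasLogarithmicGrowth F 0

end LopezRos

end

noncomputable section

namespace LopezRos

open ComplexConjugate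

/-! Write P = dh/g, H = dh and Q = g dh, so that P Q = H². If p, f, q are primitives, then 2(x₁ - i
x₂) = p - conj q and x₃ = Re f, up to a translation. The López–Ros deformation with parameter t
replaces p, f, q by p/t, f, t q, so it is single-valued as soon as these primitives are. It is
determined up to a translation, because its differential is prescribed on a connected set without
vertical points.

Suppose that g has a zero of order k at z = 0 and that p, f, q have leading terms of degrees a, k +
a and 2k + a. Here a = 1 at a point of the surface and a = -1 at a flat end. Put t = μ and z =
μ^(-1/k) y. All three coordinates then acquire the same power of μ, and the rescaled surfaces
converge to a model which, after a linear change of y and a rotation, is y ↦ (y^a/a - conj(y^m/m),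
Re(y^n/n)) with n = k + a and m = 2k + a. For a = 1 this is the k-Enneper surface, which gives the
limit in (i) (`deformation_local_model`). The model is symmetric under complex conjugation, so ξ and
conj ξ have the same image as soon as the first component is real at ξ. Such a ξ exists if a = 1, or
if a = -1 and k ≥ 2 (`exists_model_point`), and the two tangent planes there are transversal
(`tangent_span`). Transversal double points survive small perturbations
(`exists_double_point_of_transversal`), hence the deformed surface is not injective for large μ
(`exists_double_point`, `eventually_not_injOn`).

At a vertical point the leading terms are obtained by choosing a coordinate in which g = c z^k
(`exists_coordinate`, `exists_scale`).

At a flat end more is needed. The asymptotic expansion bounds the height only far from the axis;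
following curves on the surface that run almost horizontally, and using completeness, one bounds it
near the whole puncture (`exists_height_bound`). A Cauchy estimate then leaves at most a simple pole
for dh, and boundedness of the height removes that too (`exists_analytic_wH`). Completeness forces P
to have a pole, of order ℓ + 1 say (`exists_end_expansion`). Since F is single-valued, p is
single-valued too, so P has no residue and ℓ ≥ 1. Embeddedness gives ℓ = 1 (`winding_eq_one`).
Therefore a = -1 and k ≥ 2, and the model applies (`flatEnd_deformation`).

A half-turn about the x₁-axis replaces g by 1/g and t by 1/t, which reduces s = -1 to s = 1. -/

/-- The coefficient `g⁻¹ dh` of the Weierstrass data, `φ₀ - i φ₁`. -/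
def wP (F : ℂ → E3) (z : ℂ) : ℂ := complexVelocity F z 0 - Complex.I * complexVelocity F z 1

/-- The coefficient `g dh` of the Weierstrass data, `-(φ₀ + i φ₁)`. -/
def wQ (F : ℂ → E3) (z : ℂ) : ℂ := -(complexVelocity F z 0 + Complex.I * complexVelocity F z 1)

/-- The coefficient of `dh`. -/
def wH (F : ℂ → E3) (z : ℂ) : ℂ := complexVelocity F z 2

/-- The vector `φ` with `φ₀ - i φ₁ = p`, `φ₀ + i φ₁ = -q` and `φ₂ = η`. -/
def formVec (p q η : ℂ) : Fin 3 → ℂ := ![(p - q) / 2, Complex.I * (p + q) / 2, η]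

theorem complexVelocity_eq_formVec (F : ℂ → E3) (z : ℂ) :
    complexVelocity F z = formVec (wP F z) (wQ F z) (wH F z) := by
  have hI : Complex.I * Complex.I = -1 := Complex.I_mul_I
  funext j
  fin_cases j
  · simp [formVec, wP, wQ]; ring
  · simp [formVec, wP, wQ]; linear_combination (complexVelocity F z 1) * hI
  · simp [formVec, wH]

theorem weierstrassForm_eq (g η : ℂ) : weierstrassForm g η = formVec (g⁻¹ * η) (g * η) η := by
  funext j
  fin_cases j <;> simp [weierstrassForm, formVec] <;> ring

/-! ### Conformal tangent vectors and the Gauss map -/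

theorem norm_sq_E3 (a : E3) : ‖a‖ ^ 2 = a 0 ^ 2 + a 1 ^ 2 + a 2 ^ 2 := by
  simp [EuclideanSpace.norm_sq_eq, Fin.sum_univ_three]

theorem inner_E3 (a b : E3) : inner ℝ a b = a 0 * b 0 + a 1 * b 1 + a 2 * b 2 := by
  simp [PiLp.inner_apply, Fin.sum_univ_three]; ring

theorem ext_E3 {a b : E3} (h0 : a 0 = b 0) (h1 : a 1 = b 1) (h2 : a 2 = b 2) : a = b := by
  ext j; fin_cases j <;> assumption

@[simp] theorem cross_zero (a b : E3) : cross a b 0 = a 1 * b 2 - a 2 * b 1 := rfl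
@[simp] theorem cross_one (a b : E3) : cross a b 1 = a 2 * b 0 - a 0 * b 2 := rfl
@[simp] theorem cross_two (a b : E3) : cross a b 2 = a 0 * b 1 - a 1 * b 0 := rfl
@[simp] theorem e3_zero : e3 0 = 0 := rfl
@[simp] theorem e3_one : e3 1 = 0 := rfl
@[simp] theorem e3_two : e3 2 = 1 := rfl

theorem norm_cross_of_conformal {a b : E3} (h1 : ‖a‖ = ‖b‖) (h2 : inner ℝ a b = 0) :
    ‖cross a b‖ = ‖a‖ ^ 2 := by
  have e1 : ‖a‖ ^ 2 = ‖b‖ ^ 2 := by rw [h1]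
  rw [inner_E3] at h2
  have : ‖cross a b‖ ^ 2 = (‖a‖ ^ 2) ^ 2 := by
    have : (‖a‖ ^ 2) ^ 2 = ‖a‖ ^ 2 * ‖b‖ ^ 2 := by rw [← e1]; ring
    rw [this, norm_sq_E3, norm_sq_E3, norm_sq_E3, cross_zero, cross_one, cross_two]
    linear_combination (-(a 0 * b 0 + a 1 * b 1 + a 2 * b 2)) * h2
  exact (sq_eq_sq₀ (norm_nonneg _) (by positivity)).1 this

/-- A pair of tangent vectors that come from a null vector. -/
structure ConfPair (a b : E3) : Prop where
  norm_eq : ‖a‖ = ‖b‖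
  orth : inner ℝ a b = 0
  ne : a ≠ 0

namespace ConfPair
variable {a b : E3}

theorem pos (h : ConfPair a b) : 0 < ‖a‖ := norm_pos_iff.2 h.ne

theorem smul_cross (h : ConfPair a b) :
    ‖cross a b‖⁻¹ • cross a b = (‖a‖ ^ 2)⁻¹ • cross a b := by
  rw [norm_cross_of_conformal h.norm_eq h.orth]

theorem sq (h : ConfPair a b) : a 0 ^ 2 + a 1 ^ 2 + a 2 ^ 2 = b 0 ^ 2 + b 1 ^ 2 + b 2 ^ 2 := by
  rw [← norm_sq_E3, ← norm_sq_E3, h.norm_eq]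

theorem in0 (h : ConfPair a b) : a 0 * b 0 + a 1 * b 1 + a 2 * b 2 = 0 := by
  rw [← inner_E3, h.orth]

/-- With a = F_u and b = F_v the second factor on the left is |P|², so the identity reads |P| =
|F_u| |1 - N₃|: P vanishes exactly where the normal is (0, 0, 1). -/
theorem normP (h : ConfPair a b) :
    ‖a‖ ^ 2 * ((a 0 - b 1) ^ 2 + (a 1 + b 0) ^ 2) = (‖a‖ ^ 2 - cross a b 2) ^ 2 := by
  have h1 := h.sq
  have h2 := h.in0
  rw [norm_sq_E3, cross_two]
  linear_combination -a 2 ^ 2 * h1 + (a 0 * b 0 + a 1 * b 1 - a 2 * b 2) * h2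


/-- Here a₂² + b₂² = |H|². The horizontal part of the normal therefore vanishes exactly with H,
which is what `isVertical_iff` uses. -/
theorem cross_hor (h : ConfPair a b) :
    cross a b 0 ^ 2 + cross a b 1 ^ 2 = ‖a‖ ^ 2 * (a 2 ^ 2 + b 2 ^ 2) := by
  have h1 := h.sq
  have h2 := h.in0
  rw [norm_sq_E3, cross_zero, cross_one]
  linear_combination (-a 2 ^ 2) * h1 + (-2 * a 2 * b 2) * h2

theorem cross_vert (h : ConfPair a b) :
    cross a b 0 ^ 2 + cross a b 1 ^ 2 + cross a b 2 ^ 2 = (‖a‖ ^ 2) ^ 2 := by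
  rw [← norm_sq_E3, norm_cross_of_conformal h.norm_eq h.orth]

/-- Together with `stereo_im` this is (N₁ + i N₂) P = (1 - N₃) H, multiplied by |F_u|² and split
into real and imaginary parts; it yields g = H / P. -/
theorem stereo_re (h : ConfPair a b) :
    cross a b 0 * (a 0 - b 1) + cross a b 1 * (a 1 + b 0) = (‖a‖ ^ 2 - cross a b 2) * a 2 := by
  have h1 := h.sq
  have h2 := h.in0
  rw [norm_sq_E3, cross_zero, cross_one, cross_two]
  linear_combination (-a 2) * h1 - b 2 * h2

theorem stereo_im (h : ConfPair a b) :
    cross a b 1 * (a 0 - b 1) - cross a b 0 * (a 1 + b 0) = -(‖a‖ ^ 2 - cross a b 2) * b 2 := by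
  have h1 := h.sq
  have h2 := h.in0
  rw [norm_sq_E3, cross_zero, cross_one, cross_two]
  linear_combination a 2 * h2

end ConfPair

/-- `F_u` and `F_v` are conformal at `z`. -/
abbrev ConfAt (F : ℂ → E3) (z : ℂ) : Prop := ConfPair (du F z) (dv F z)

/-- The equation P Q = H² says φ₀² + φ₁² + φ₂² = 0 for φ = F_u - i F_v. Its real part is |F_u| =
|F_v| and its imaginary part is orthogonality. -/
theorem ConfPair.of_null {F : ℂ → E3} {z : ℂ} (h : wP F z * wQ F z = wH F z ^ 2)
    (h0 : wP F z ≠ 0 ∨ wQ F z ≠ 0) : ConfAt F z := by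
  have key := h
  simp only [wP, wQ, wH, complexVelocity, Complex.ext_iff] at h
  simp [pow_two] at h
  obtain ⟨h1, h2⟩ := h
  have e1 : ‖du F z‖ ^ 2 = ‖dv F z‖ ^ 2 := by
    rw [norm_sq_E3, norm_sq_E3]; linear_combination -h1
  have e1' : ‖du F z‖ = ‖dv F z‖ := (sq_eq_sq₀ (norm_nonneg _) (norm_nonneg _)).1 e1
  refine ⟨e1', by rw [inner_E3]; linear_combination h2 / 2, fun h3 => ?_⟩
  have h4 : dv F z = 0 := by rw [h3, norm_zero] at e1'; exact norm_eq_zero.1 e1'.symm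
  rcases h0 with h0 | h0 <;> exact h0 (by simp [wP, wQ, complexVelocity, h3, h4])

theorem ConfPair.null {F : ℂ → E3} {z : ℂ} (h : ConfAt F z) :
    wP F z * wQ F z = wH F z ^ 2 := by
  have h1 := h.sq
  have h2 := h.in0
  simp only [wP, wQ, wH, complexVelocity, Complex.ext_iff]
  simp [pow_two]
  constructor
  · linear_combination -h1
  · linear_combination 2 * h2

section Normal
variable {F : ℂ → E3} {z : ℂ}

theorem unitNormal_apply (h : ConfAt F z) (j : Fin 3) :
    unitNormal F z j = (‖du F z‖ ^ 2)⁻¹ * cross (du F z) (dv F z) j := by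
  rw [unitNormal, h.smul_cross]; rfl

theorem norm_wP_sq (h : ConfAt F z) :
    ‖wP F z‖ ^ 2 = ‖du F z‖ ^ 2 * (1 - unitNormal F z 2) ^ 2 := by
  have hp := h.pos
  have h1 := h.normP
  have : ‖wP F z‖ ^ 2 = (du F z 0 - dv F z 1) ^ 2 + (du F z 1 + dv F z 0) ^ 2 := by
    rw [← Complex.normSq_eq_norm_sq, Complex.normSq_apply]
    simp [wP, complexVelocity]; ring
  rw [this, unitNormal_apply h]
  field_simp
  linear_combination h1

theorem stereo_unitNormal (h : ConfAt F z) : stereo (unitNormal F z) = wH F z / wP F z := by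
  have hp := h.pos
  have hn := norm_wP_sq h
  by_cases h1 : 1 - unitNormal F z 2 = 0
  -- At the north pole P = 0 and both quotients take the default value 0 of division by zero.
  · have hP : wP F z = 0 := by
      rw [h1] at hn; simpa using hn
    have : (1 : ℂ) - unitNormal F z 2 = 0 := by
      rw [← Complex.ofReal_one, ← Complex.ofReal_sub, h1, Complex.ofReal_zero]
    rw [stereo, this, hP, div_zero, div_zero]
  · have hP : wP F z ≠ 0 := by
      intro h0; rw [h0] at hn
      have : 0 < ‖du F z‖ ^ 2 * (1 - unitNormal F z 2) ^ 2 := by positivity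
      simp at hn; rcases hn with hn | hn
      · exact h.ne hn
      · exact h1 hn
    have h2 : (1 : ℂ) - unitNormal F z 2 ≠ 0 := by
      rw [← Complex.ofReal_one, ← Complex.ofReal_sub]; exact Complex.ofReal_ne_zero.2 h1
    rw [stereo, div_eq_div_iff h2 hP]
    have hr := h.stereo_re
    have hi := h.stereo_im
    have ea : ((‖du F z‖ ^ 2 : ℝ) : ℂ) ≠ 0 := by exact_mod_cast (by positivity)
    simp only [unitNormal_apply h, wP, wH, complexVelocity]
    have : (‖du F z‖ ^ 2)⁻¹ * ‖du F z‖ ^ 2 = 1 := by field_simp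
    apply Complex.ext
    · simp only [Complex.add_re, Complex.mul_re, Complex.sub_re, Complex.ofReal_re, Complex.I_re,
        Complex.I_im, Complex.ofReal_im, Complex.sub_im, Complex.mul_im, Complex.add_im,
        Complex.one_re, Complex.one_im]
      linear_combination (‖du F z‖ ^ 2)⁻¹ * hr + du F z 2 * this
    · simp only [Complex.add_re, Complex.mul_re, Complex.sub_re, Complex.ofReal_re, Complex.I_re,
        Complex.I_im, Complex.ofReal_im, Complex.sub_im, Complex.mul_im, Complex.add_im,
        Complex.one_re, Complex.one_im]
      linear_combination (‖du F z‖ ^ 2)⁻¹ * hi - dv F z 2 * this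

theorem norm_unitNormal (h : ConfAt F z) :
    unitNormal F z 0 ^ 2 + unitNormal F z 1 ^ 2 + unitNormal F z 2 ^ 2 = 1 := by
  have hp := h.pos
  simp only [unitNormal_apply h]
  have := h.cross_vert
  field_simp
  linear_combination this

theorem isVertical_iff (h : ConfAt F z) : IsVertical (unitNormal F z) ↔ wH F z = 0 := by
  have hp := h.pos
  have hc := h.cross_hor
  have hn := norm_unitNormal h
  have h1 : wH F z = 0 ↔ du F z 2 = 0 ∧ dv F z 2 = 0 := by
    rw [Complex.ext_iff]; simp [wH, complexVelocity]
  have e : unitNormal F z 0 ^ 2 + unitNormal F z 1 ^ 2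
      = (‖du F z‖ ^ 2)⁻¹ * (du F z 2 ^ 2 + dv F z 2 ^ 2) := by
    simp only [unitNormal_apply h]
    field_simp
    linear_combination hc
  rw [h1]
  constructor
  · intro hv
    have : unitNormal F z 0 ^ 2 + unitNormal F z 1 ^ 2 = 0 := by
      rcases hv with hv | hv <;> simp [hv]
    rw [this] at e
    have e2 : du F z 2 ^ 2 + dv F z 2 ^ 2 = 0 := by
      rcases mul_eq_zero.1 e.symm with h3 | h3
      · exact absurd h3 (by positivity)
      · exact h3
    constructor <;> nlinarith [sq_nonneg (du F z 2), sq_nonneg (dv F z 2)]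
  · rintro ⟨h2, h3⟩
    rw [h2, h3] at e
    have e' : unitNormal F z 0 ^ 2 + unitNormal F z 1 ^ 2 = 0 := by rw [e]; simp
    have n0 : unitNormal F z 0 = 0 := by nlinarith [sq_nonneg (unitNormal F z 0), sq_nonneg (unitNormal F z 1)]
    have n1 : unitNormal F z 1 = 0 := by nlinarith [sq_nonneg (unitNormal F z 0), sq_nonneg (unitNormal F z 1)]
    have n2 : (unitNormal F z 2 - 1) * (unitNormal F z 2 + 1) = 0 := by
      rw [n0, n1] at hn; linear_combination hn
    rcases mul_eq_zero.1 n2 with n2 | n2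
    · left; exact ext_E3 (by simp [n0]) (by simp [n1]) (by simp; linarith)
    · right; exact ext_E3 (by simp [n0]) (by simp [n1]) (by simp; linarith)

theorem wP_ne_zero (h : ConfAt F z) (h1 : unitNormal F z 2 ≠ 1) : wP F z ≠ 0 := by
  intro h0
  have hn := norm_wP_sq h
  have hp := h.pos
  rw [h0] at hn
  have : 1 - unitNormal F z 2 ≠ 0 := fun h => h1 (by linarith)
  have : 0 < ‖du F z‖ ^ 2 * (1 - unitNormal F z 2) ^ 2 := by positivity
  rw [← hn] at this
  simp at this

end Normal

/-! ### Complex velocity and holomorphic changes of coordinate -/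

/-- The differential of a map in terms of its complex velocity. -/
theorem fderiv_apply_re {F : ℂ → E3} {z : ℂ} (v : ℂ) (j : Fin 3) :
    fderiv ℝ F z v j = (complexVelocity F z j * v).re := by
  have : v = v.re • (1 : ℂ) + v.im • Complex.I := by
    simp
  have h2 : fderiv ℝ F z v = v.re • du F z + v.im • dv F z := by
    conv_lhs => rw [this]
    rw [map_add, map_smul, map_smul]; rfl
  rw [h2]
  simp [complexVelocity]; ring

/-- Two maps have the same differential if they have the same complex velocity. -/
theorem fderiv_eq_of_complexVelocity_eq {F G : ℂ → E3} {z w : ℂ}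
    (h : complexVelocity F z = complexVelocity G w) : fderiv ℝ F z = fderiv ℝ G w := by
  ext v j
  rw [fderiv_apply_re, fderiv_apply_re, h]

/-- The velocity, and its three coordinates, of a composition with a holomorphic map. -/
theorem complexVelocity_comp {F : ℂ → E3} {τ : ℂ → ℂ} {z a : ℂ} (hτ : HasDerivAt τ a z)
    (hF : DifferentiableAt ℝ F (τ z)) :
    complexVelocity (F ∘ τ) z = fun j => complexVelocity F (τ z) j * a := by
  have h1 : HasFDerivAt (F ∘ τ) ((fderiv ℝ F (τ z)).comp
      ((ContinuousLinearMap.toSpanSingleton ℂ a).restrictScalars ℝ)) z :=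
    hF.hasFDerivAt.comp z (hτ.hasFDerivAt.restrictScalars ℝ)
  funext j
  have hu : du (F ∘ τ) z j = (complexVelocity F (τ z) j * a).re := by
    rw [du, h1.fderiv, ← fderiv_apply_re]; simp
  have hv : dv (F ∘ τ) z j = (complexVelocity F (τ z) j * (Complex.I * a)).re := by
    rw [dv, h1.fderiv, ← fderiv_apply_re]; simp
  simp only [complexVelocity, hu, hv]
  apply Complex.ext <;> simp <;> ring

theorem wP_comp {F : ℂ → E3} {τ : ℂ → ℂ} {z a : ℂ} (hτ : HasDerivAt τ a z)
    (hF : DifferentiableAt ℝ F (τ z)) : wP (F ∘ τ) z = wP F (τ z) * a := by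
  simp only [wP, complexVelocity_comp hτ hF]; ring

theorem wQ_comp {F : ℂ → E3} {τ : ℂ → ℂ} {z a : ℂ} (hτ : HasDerivAt τ a z)
    (hF : DifferentiableAt ℝ F (τ z)) : wQ (F ∘ τ) z = wQ F (τ z) * a := by
  simp only [wQ, complexVelocity_comp hτ hF]; ring

theorem wH_comp {F : ℂ → E3} {τ : ℂ → ℂ} {z a : ℂ} (hτ : HasDerivAt τ a z)
    (hF : DifferentiableAt ℝ F (τ z)) : wH (F ∘ τ) z = wH F (τ z) * a := by
  simp only [wH, complexVelocity_comp hτ hF]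

/-- The unit normal does not depend on the holomorphic coordinate. -/
theorem unitNormal_comp {F : ℂ → E3} {τ : ℂ → ℂ} {z a : ℂ} (hτ : HasDerivAt τ a z) (ha : a ≠ 0)
    (hF : DifferentiableAt ℝ F (τ z)) : unitNormal (F ∘ τ) z = unitNormal F (τ z) := by
  have h1 : HasFDerivAt (F ∘ τ) ((fderiv ℝ F (τ z)).comp
      ((ContinuousLinearMap.toSpanSingleton ℂ a).restrictScalars ℝ)) z :=
    hF.hasFDerivAt.comp z (hτ.hasFDerivAt.restrictScalars ℝ)
  have hu : ∀ j, du (F ∘ τ) z j = a.re * du F (τ z) j + a.im * dv F (τ z) j := by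
    intro j
    have : du (F ∘ τ) z j = (complexVelocity F (τ z) j * a).re := by
      rw [du, h1.fderiv, ← fderiv_apply_re]; simp
    rw [this]; simp [complexVelocity]; ring
  have hv : ∀ j, dv (F ∘ τ) z j = -a.im * du F (τ z) j + a.re * dv F (τ z) j := by
    intro j
    have : dv (F ∘ τ) z j = (complexVelocity F (τ z) j * (Complex.I * a)).re := by
      rw [dv, h1.fderiv, ← fderiv_apply_re]; simp
    rw [this]; simp [complexVelocity]; ring
  have hs : 0 < a.re ^ 2 + a.im ^ 2 := by
    have := Complex.normSq_pos.2 ha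
    rw [Complex.normSq_apply] at this; nlinarith
  have hc : cross (du (F ∘ τ) z) (dv (F ∘ τ) z)
      = (a.re ^ 2 + a.im ^ 2) • cross (du F (τ z)) (dv F (τ z)) := by
    apply ext_E3 <;> simp [hu, hv] <;> ring
  rw [unitNormal, unitNormal, hc, norm_smul, smul_smul, Real.norm_of_nonneg hs.le]
  congr 1
  field_simp

/-! ### Minimality as holomorphy of the Weierstrass form -/

/-- `F` is the real part of a primitive of a holomorphic null form without zeros. -/
structure IsWeierstrassOn (F : ℂ → E3) (U : Set ℂ) : Prop where
  smooth : ContDiffOn ℝ ∞ F U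
  hol : ∀ j, DifferentiableOn ℂ (fun z => complexVelocity F z j) U
  conf : ∀ z ∈ U, ConfAt F z

/-- By Lagrange, |a × b|² |L|² = ⟨L, a × b⟩² + |L × (a × b)|², and L × (a × b) = ⟨L, b⟩ a - ⟨L, a⟩
b. -/
theorem eq_zero_of_inner_eq_zero {a b L : E3} (hc : cross a b ≠ 0) (ha : inner ℝ L a = 0)
    (hb : inner ℝ L b = 0) (h : inner ℝ L (cross a b) = 0) : L = 0 := by
  have key : ‖cross a b‖ ^ 2 * ‖L‖ ^ 2 = 0 := by
    rw [inner_E3] at ha hb h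
    simp only [cross_zero, cross_one, cross_two] at h
    rw [norm_sq_E3, norm_sq_E3, cross_zero, cross_one, cross_two]
    have e0 : b 0 * (L 0 * a 0 + L 1 * a 1 + L 2 * a 2)
      - a 0 * (L 0 * b 0 + L 1 * b 1 + L 2 * b 2) = 0 := by rw [ha, hb]; ring
    have e1 : b 1 * (L 0 * a 0 + L 1 * a 1 + L 2 * a 2)
      - a 1 * (L 0 * b 0 + L 1 * b 1 + L 2 * b 2) = 0 := by rw [ha, hb]; ring
    have e2 : b 2 * (L 0 * a 0 + L 1 * a 1 + L 2 * a 2)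
      - a 2 * (L 0 * b 0 + L 1 * b 1 + L 2 * b 2) = 0 := by rw [ha, hb]; ring
    have : ∀ x y z w : ℝ, x = 0 → y = 0 → z = 0 → w = 0 → w ^ 2 + x ^ 2 + y ^ 2 + z ^ 2 = 0 := by
      intro x y z w hx hy hz hw; rw [hx, hy, hz, hw]; ring
    rw [← this _ _ _ _ e0 e1 e2 h]
    ring
  rcases mul_eq_zero.1 key with h1 | h1
  · exact absurd (norm_eq_zero.1 (pow_eq_zero_iff two_ne_zero |>.1 h1)) hc
  · exact norm_eq_zero.1 (pow_eq_zero_iff two_ne_zero |>.1 h1)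

section Harmonic
variable {F : ℂ → E3} {U : Set ℂ} {z : ℂ}

theorem contDiffAt_fderiv (h : ContDiffAt ℝ ∞ F z) : ContDiffAt ℝ ∞ (fderiv ℝ F) z :=
  h.fderiv_right (by simp)

theorem contDiffAt_du (h : ContDiffAt ℝ ∞ F z) : ContDiffAt ℝ ∞ (du F) z :=
  (contDiffAt_fderiv h).clm_apply contDiffAt_const

theorem contDiffAt_dv (h : ContDiffAt ℝ ∞ F z) : ContDiffAt ℝ ∞ (dv F) z :=
  (contDiffAt_fderiv h).clm_apply contDiffAt_const

theorem du_dv_comm (h : ContDiffAt ℝ ∞ F z) : du (dv F) z = dv (du F) z := by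
  have hd : DifferentiableAt ℝ (fderiv ℝ F) z := (contDiffAt_fderiv h).differentiableAt (by simp)
  have hs : IsSymmSndFDerivAt ℝ F z := h.isSymmSndFDerivAt (by
    rw [minSmoothness_of_isRCLikeNormedField]; exact WithTop.coe_le_coe.2 le_top)
  have e1 : du (dv F) z = fderiv ℝ (fderiv ℝ F) z 1 Complex.I := by
    rw [du]; change fderiv ℝ (fun w => fderiv ℝ F w Complex.I) z 1 = _
    rw [fderiv_clm_apply hd (by fun_prop)]; simp
  have e2 : dv (du F) z = fderiv ℝ (fderiv ℝ F) z Complex.I 1 := by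
    rw [dv]; change fderiv ℝ (fun w => fderiv ℝ F w 1) z Complex.I = _
    rw [fderiv_clm_apply hd (by fun_prop)]; simp
  rw [e1, e2]; exact hs _ _

theorem IsConformalMinimalImmersionOn.confAt (h : IsConformalMinimalImmersionOn F U)
    (hz : z ∈ U) : ConfAt F z := by
  refine ⟨h.norm_eq z hz, h.orthogonal z hz, fun h0 => ?_⟩
  have := h.immersion z hz (a₁ := 1) (a₂ := 0) (by rw [map_zero]; exact h0)
  exact one_ne_zero this

/-- Differentiating |F_u| = |F_v| and ⟨F_u, F_v⟩ = 0 shows that ΔF is orthogonal to F_u and F_v. In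
a conformal parameter the mean curvature is a multiple of ⟨ΔF, N⟩, so the normal component vanishes
as well. -/
theorem IsConformalMinimalImmersionOn.laplacian (h : IsConformalMinimalImmersionOn F U)
    (hU : IsOpen U) (hz : z ∈ U) : du (du F) z + dv (dv F) z = 0 := by
  have hs : ContDiffAt ℝ ∞ F z := h.smooth.contDiffAt (hU.mem_nhds hz)
  have hu : DifferentiableAt ℝ (du F) z := (contDiffAt_du hs).differentiableAt (by simp)
  have hv : DifferentiableAt ℝ (dv F) z := (contDiffAt_dv hs).differentiableAt (by simp)
  have hc := h.confAt hz
  have hp := hc.pos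
  have en : ∀ y, fderiv ℝ (fun w => inner ℝ (du F w) (du F w)) z y
      = fderiv ℝ (fun w => inner ℝ (dv F w) (dv F w)) z y := by
    intro y
    rw [Filter.EventuallyEq.fderiv_eq]
    filter_upwards [hU.mem_nhds hz] with w hw
    rw [real_inner_self_eq_norm_sq, real_inner_self_eq_norm_sq, h.norm_eq w hw]
  have eo : ∀ y, fderiv ℝ (fun w => inner ℝ (du F w) (dv F w)) z y = 0 := by
    intro y
    have : fderiv ℝ (fun w => inner ℝ (du F w) (dv F w)) z = fderiv ℝ (fun _ => (0 : ℝ)) z := by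
      apply Filter.EventuallyEq.fderiv_eq
      filter_upwards [hU.mem_nhds hz] with w hw
      exact h.orthogonal w hw
    rw [this]; simp
  have n1 := en 1
  have n2 := en Complex.I
  have o1 := eo 1
  have o2 := eo Complex.I
  rw [fderiv_inner_apply ℝ hu hu, fderiv_inner_apply ℝ hv hv] at n1 n2
  rw [fderiv_inner_apply ℝ hu hv] at o1 o2
  change inner ℝ (du F z) (du (du F) z) + inner ℝ (du (du F) z) (du F z)
    = inner ℝ (dv F z) (du (dv F) z) + inner ℝ (du (dv F) z) (dv F z) at n1
  change inner ℝ (du F z) (dv (du F) z) + inner ℝ (dv (du F) z) (du F z)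
    = inner ℝ (dv F z) (dv (dv F) z) + inner ℝ (dv (dv F) z) (dv F z) at n2
  change inner ℝ (du F z) (du (dv F) z) + inner ℝ (du (du F) z) (dv F z) = 0 at o1
  change inner ℝ (du F z) (dv (dv F) z) + inner ℝ (dv (du F) z) (dv F z) = 0 at o2
  rw [du_dv_comm hs] at n1 o1
  have hcr : cross (du F z) (dv F z) ≠ 0 := by
    rw [← norm_ne_zero_iff, norm_cross_of_conformal hc.norm_eq hc.orth]; positivity
  refine eq_zero_of_inner_eq_zero hcr ?_ ?_ ?_
  · rw [inner_add_left]
    rw [real_inner_comm (du (du F) z) (du F z), real_inner_comm (dv (du F) z) (dv F z)] at n1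
    rw [real_inner_comm (dv (dv F) z) (du F z)] at o2
    linarith
  · rw [inner_add_left]
    rw [real_inner_comm (dv (du F) z) (du F z), real_inner_comm (dv (dv F) z) (dv F z)] at n2
    rw [real_inner_comm (dv (du F) z) (du F z)] at o1
    linarith
  · have hm := h.minimal z hz
    have hfd : firstDet F z = ‖du F z‖ ^ 4 := by
      rw [firstDet, hc.orth, ← hc.norm_eq]; ring
    rw [meanCurvature, hfd, hc.orth, ← hc.norm_eq, div_eq_zero_iff] at hm
    rcases hm with hm | hm
    · have : (secondL F z + secondN F z) * ‖du F z‖ ^ 2 = 0 := by linarith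
      rcases mul_eq_zero.1 this with h1 | h1
      · rw [secondL, secondN, ← inner_add_left, unitNormal, inner_smul_right] at h1
        rcases mul_eq_zero.1 h1 with h2 | h2
        · exact absurd (inv_eq_zero.1 h2) (norm_ne_zero_iff.2 hcr)
        · exact h2
      · exact absurd h1 (by positivity)
    · exact absurd hm (by positivity)

/-- The Cauchy–Riemann equation for F_u - i F_v consists of ΔF = 0 and the symmetry of second
derivatives. -/
theorem IsConformalMinimalImmersionOn.isWeierstrassOn (h : IsConformalMinimalImmersionOn F U)
    (hU : IsOpen U) : IsWeierstrassOn F U := by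
  refine ⟨h.smooth, fun j z hz => ?_, fun z hz => h.confAt hz⟩
  have hs : ContDiffAt ℝ ∞ F z := h.smooth.contDiffAt (hU.mem_nhds hz)
  have hu : DifferentiableAt ℝ (du F) z := (contDiffAt_du hs).differentiableAt (by simp)
  have hv : DifferentiableAt ℝ (dv F) z := (contDiffAt_dv hs).differentiableAt (by simp)
  apply DifferentiableAt.differentiableWithinAt
  have hd : HasFDerivAt (fun z => complexVelocity F z j)
      (Complex.ofRealCLM ∘L (EuclideanSpace.proj j ∘L fderiv ℝ (du F) z)
        - Complex.I • (Complex.ofRealCLM ∘L (EuclideanSpace.proj j ∘L fderiv ℝ (dv F) z))) z := by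
    have hu' := (Complex.ofRealCLM ∘L (EuclideanSpace.proj j : E3 →L[ℝ] ℝ)).hasFDerivAt.comp z
      hu.hasFDerivAt
    have hv' := (Complex.ofRealCLM ∘L (EuclideanSpace.proj j : E3 →L[ℝ] ℝ)).hasFDerivAt.comp z
      hv.hasFDerivAt
    exact hu'.sub (hv'.const_smul Complex.I)
  rw [differentiableAt_complex_iff_differentiableAt_real]
  refine ⟨hd.differentiableAt, ?_⟩
  rw [hd.fderiv]
  have hl : dv (dv F) z j = - du (du F) z j := by
    have := congrArg (fun v : E3 => v j) (h.laplacian hU hz)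
    simp at this; linarith
  have hm : du (dv F) z j = dv (du F) z j := by rw [du_dv_comm hs]
  change ((dv (du F) z j : ℝ) : ℂ) - Complex.I * ((dv (dv F) z j : ℝ) : ℂ)
    = Complex.I * (((du (du F) z j : ℝ) : ℂ) - Complex.I * ((du (dv F) z j : ℝ) : ℂ))
  rw [hl, hm]; push_cast
  linear_combination (dv (du F) z j : ℂ) * Complex.I_mul_I

end Harmonic

/-! ### Transformations -/

theorem complexVelocity_congr {F G : ℂ → E3} {z : ℂ} (h : F =ᶠ[𝓝 z] G) :
    complexVelocity F z = complexVelocity G z := by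
  funext j
  simp only [complexVelocity, du, dv, h.fderiv_eq]

theorem unitNormal_congr {F G : ℂ → E3} {z : ℂ} (h : F =ᶠ[𝓝 z] G) :
    unitNormal F z = unitNormal G z := by
  simp only [unitNormal, du, dv, h.fderiv_eq]

theorem contDiffOn_restrictScalars_of_differentiableOn {τ : ℂ → ℂ} {V : Set ℂ} (hV : IsOpen V)
    (h : DifferentiableOn ℂ τ V) : ContDiffOn ℝ ∞ τ V :=
  (h.contDiffOn (n := ∞) hV).restrict_scalars ℝ

namespace IsWeierstrassOn
variable {F : ℂ → E3} {U V : Set ℂ} {τ : ℂ → ℂ}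

theorem differentiableAt (h : IsWeierstrassOn F U) (hU : IsOpen U) {z : ℂ} (hz : z ∈ U) :
    DifferentiableAt ℝ F z :=
  ((h.smooth.contDiffAt (hU.mem_nhds hz)).differentiableAt (by simp))

theorem holP (h : IsWeierstrassOn F U) : DifferentiableOn ℂ (wP F) U :=
  (h.hol 0).sub ((differentiableOn_const _).mul (h.hol 1))

theorem holQ (h : IsWeierstrassOn F U) : DifferentiableOn ℂ (wQ F) U :=
  ((h.hol 0).add ((differentiableOn_const _).mul (h.hol 1))).neg

theorem holH (h : IsWeierstrassOn F U) : DifferentiableOn ℂ (wH F) U := h.hol 2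

theorem mono (h : IsWeierstrassOn F U) (hV : V ⊆ U) : IsWeierstrassOn F V :=
  ⟨h.smooth.mono hV, fun j => (h.hol j).mono hV, fun z hz => h.conf z (hV hz)⟩

theorem comp (h : IsWeierstrassOn F U) (hU : IsOpen U) (hV : IsOpen V)
    (hτ : DifferentiableOn ℂ τ V) (hd : ∀ z ∈ V, deriv τ z ≠ 0) (hm : MapsTo τ V U) :
    IsWeierstrassOn (F ∘ τ) V := by
  have hτ' : ∀ z ∈ V, HasDerivAt τ (deriv τ z) z := fun z hz =>
    (hτ.differentiableAt (hV.mem_nhds hz)).hasDerivAt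
  refine ⟨h.smooth.comp (contDiffOn_restrictScalars_of_differentiableOn hV hτ) hm, fun j => ?_,
    fun z hz => ?_⟩
  · have : DifferentiableOn ℂ (fun z => complexVelocity F (τ z) j * deriv τ z) V :=
      ((h.hol j).comp hτ hm).mul (hτ.deriv hV)
    refine this.congr fun z hz => ?_
    rw [complexVelocity_comp (hτ' z hz) (h.differentiableAt hU (hm hz))]
  · have hz' := h.conf _ (hm hz)
    have hF := h.differentiableAt hU (hm hz)
    have hn := hz'.null
    apply ConfPair.of_null
    · rw [wP_comp (hτ' z hz) hF, wQ_comp (hτ' z hz) hF, wH_comp (hτ' z hz) hF]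
      linear_combination (deriv τ z) ^ 2 * hn
    · rw [wP_comp (hτ' z hz) hF, wQ_comp (hτ' z hz) hF]
      by_contra hcon
      push Not at hcon
      have hP := (mul_eq_zero.1 hcon.1).resolve_right (hd z hz)
      have hQ := (mul_eq_zero.1 hcon.2).resolve_right (hd z hz)
      rw [hP, zero_mul] at hn
      have hH : wH F (τ z) = 0 := by simpa using hn.symm
      have hcv := complexVelocity_eq_formVec F (τ z)
      rw [hP, hQ, hH] at hcv
      apply hz'.ne
      apply ext_E3 <;> rw [du, fderiv_apply_re, hcv] <;> simp [formVec]

theorem congr (h : IsWeierstrassOn F U) (hU : IsOpen U) {G : ℂ → E3} (hG : EqOn G F U) :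
    IsWeierstrassOn G U := by
  have he : ∀ z ∈ U, G =ᶠ[𝓝 z] F := fun z hz => by
    filter_upwards [hU.mem_nhds hz] with w hw using hG hw
  refine ⟨h.smooth.congr hG, fun j => (h.hol j).congr fun z hz => ?_, fun z hz => ?_⟩
  · rw [complexVelocity_congr (he z hz)]
  · have : ConfAt G z = ConfAt F z := by simp only [ConfAt, du, dv, (he z hz).fderiv_eq]
    rw [this]; exact h.conf z hz

/-- The deformation condition in terms of the holomorphic forms. -/
theorem isDeformationOn_iff (h : IsWeierstrassOn F U) {t : ℝ} {Y : ℂ → E3} :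
    IsDeformationOn t F U Y ↔ ContDiffOn ℝ ∞ Y U ∧ ∀ z ∈ U, wH F z ≠ 0 →
      complexVelocity Y z = formVec (wP F z / t) (t * wQ F z) (wH F z) := by
  rw [IsDeformationOn]
  refine and_congr_right fun _ => forall₂_congr fun z hz => ?_
  have hc := h.conf z hz
  rw [isVertical_iff hc, weierstrassForm_eq, stereo_unitNormal hc]
  refine imp_congr_right fun h0 => ?_
  have hn := hc.null
  -- Where H ≠ 0 the null relation makes P nonzero; then g = H / P is finite and nonzero, with H / g
  -- = P and g H = Q.
  have hP : wP F z ≠ 0 := fun hP => h0 (by rw [hP, zero_mul] at hn; simpa using hn.symm)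
  change complexVelocity Y z = formVec ((t * (wH F z / wP F z))⁻¹ * wH F z)
    (t * (wH F z / wP F z) * wH F z) (wH F z) ↔ _
  have e1 : ((t : ℂ) * (wH F z / wP F z))⁻¹ * wH F z = wP F z / t := by
    by_cases ht : (t : ℂ) = 0
    · simp [ht]
    · field_simp
  have e2 : (t : ℂ) * (wH F z / wP F z) * wH F z = t * wQ F z := by
    field_simp
    linear_combination -(t : ℂ) * hn
  rw [e1, e2]

end IsWeierstrassOn

theorem IsDeformationOn.comp {F Y : ℂ → E3} {U V : Set ℂ} {τ : ℂ → ℂ} {t : ℝ}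
    (hY : IsDeformationOn t F U Y) (h : IsWeierstrassOn F U) (hU : IsOpen U) (hV : IsOpen V)
    (hτ : DifferentiableOn ℂ τ V) (hd : ∀ z ∈ V, deriv τ z ≠ 0) (hm : MapsTo τ V U) :
    IsDeformationOn t (F ∘ τ) V (Y ∘ τ) := by
  have hτ' : ∀ z ∈ V, HasDerivAt τ (deriv τ z) z := fun z hz =>
    (hτ.differentiableAt (hV.mem_nhds hz)).hasDerivAt
  rw [(h.comp hU hV hτ hd hm).isDeformationOn_iff]
  rw [h.isDeformationOn_iff] at hY
  refine ⟨hY.1.comp (contDiffOn_restrictScalars_of_differentiableOn hV hτ) hm, fun z hz h0 => ?_⟩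
  have hF := h.differentiableAt hU (hm hz)
  have hYd : DifferentiableAt ℝ Y (τ z) :=
    (hY.1.contDiffAt (hU.mem_nhds (hm hz))).differentiableAt (by simp)
  rw [wH_comp (hτ' z hz) hF] at h0
  rw [complexVelocity_comp (hτ' z hz) hYd, hY.2 _ (hm hz) (left_ne_zero_of_mul h0),
    wP_comp (hτ' z hz) hF, wQ_comp (hτ' z hz) hF, wH_comp (hτ' z hz) hF]
  funext j
  fin_cases j <;> simp [formVec] <;> ring

theorem IsDeformationOn.congr {F G Y Z : ℂ → E3} {U : Set ℂ} {t : ℝ}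
    (hY : IsDeformationOn t F U Y) (hU : IsOpen U) (hG : EqOn G F U) (hZ : EqOn Z Y U) :
    IsDeformationOn t G U Z := by
  refine ⟨hY.1.congr hZ, fun z hz h0 => ?_⟩
  have eG : G =ᶠ[𝓝 z] F := by filter_upwards [hU.mem_nhds hz] with w hw using hG hw
  have eZ : Z =ᶠ[𝓝 z] Y := by filter_upwards [hU.mem_nhds hz] with w hw using hZ hw
  rw [unitNormal_congr eG] at h0 ⊢
  rw [complexVelocity_congr eG, complexVelocity_congr eZ]
  exact hY.2 z hz h0

theorem IsDeformationOn.mono {F Y : ℂ → E3} {U V : Set ℂ} {t : ℝ}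
    (hY : IsDeformationOn t F U Y) (hV : V ⊆ U) : IsDeformationOn t F V Y :=
  ⟨hY.1.mono hV, fun z hz => hY.2 z (hV hz)⟩

/-! ### Blow-up at a zero of the Gauss map and persistence of double points -/

/-- The map `(2 (x₁ - i x₂), x₃)`, blown up at scale `τ` around `0`, of the surface that is given
by the primitives `z ^ a A`, `z ^ n B`, `z ^ m C` of its Weierstrass forms. -/
def blowUp (a : ℤ) (n m : ℕ) (A B C : ℂ → ℂ) (x : ℝ × ℂ) : ℂ × ℝ :=
  (x.2 ^ a * A (x.1 * x.2) - conj (x.2 ^ m * C (x.1 * x.2)), (x.2 ^ n * B (x.1 * x.2)).re)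

section BlowUp
variable {a : ℤ} {n m : ℕ} {A B C : ℂ → ℂ} {y : ℂ}

theorem contDiffAt_comp_mul (hA : AnalyticAt ℂ A 0) :
    ContDiffAt ℝ 1 (fun x : ℝ × ℂ => A (x.1 * x.2)) (0, y) := by
  have h1 : ContDiffAt ℝ 1 A (((0 : ℝ), y).1 * ((0 : ℝ), y).2) := by
    simpa using (hA.contDiffAt (n := 1)).restrict_scalars ℝ
  have h2 : ContDiffAt ℝ 1 (fun x : ℝ × ℂ => (x.1 : ℂ) * x.2) (0, y) :=
    (Complex.ofRealCLM.contDiff.comp contDiff_fst).contDiffAt.mul contDiff_snd.contDiffAt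
  exact h1.comp (0, y) h2

theorem contDiffAt_blowUp (hA : AnalyticAt ℂ A 0) (hB : AnalyticAt ℂ B 0)
    (hC : AnalyticAt ℂ C 0) (hy : y ≠ 0 ∨ 0 ≤ a) :
    ContDiffAt ℝ 1 (blowUp a n m A B C) (0, y) := by
  have hz : ContDiffAt ℝ 1 (fun x : ℝ × ℂ => x.2 ^ a) (0, y) := by
    have h1 : ContDiffAt ℝ 1 (fun w : ℂ => w ^ a) y := by
      rcases hy with hy | ha
      · have : AnalyticAt ℂ (fun w : ℂ => w ^ a) y := (analyticAt_id (𝕜 := ℂ)).zpow hy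
        exact (this.contDiffAt (n := 1)).restrict_scalars ℝ
      · lift a to ℕ using ha
        simp only [zpow_natCast]
        exact contDiffAt_id.pow a
    exact ContDiffAt.comp (f := fun x : ℝ × ℂ => x.2) (0, y) h1 contDiff_snd.contDiffAt
  refine ContDiffAt.prodMk ?_ ?_
  · exact (hz.mul (contDiffAt_comp_mul hA)).sub (Complex.conjCLE.contDiff.contDiffAt.comp _
      ((contDiff_snd.contDiffAt.pow m).mul (contDiffAt_comp_mul hC)))
  · exact Complex.reCLM.contDiff.contDiffAt.comp _
      ((contDiff_snd.contDiffAt.pow n).mul (contDiffAt_comp_mul hB))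

/-- The real linear map `v ↦ (p v - conj (q v), Re (η v))`. -/
def tangentMap (p q η : ℂ) : ℂ →L[ℝ] ℂ × ℝ :=
  ((ContinuousLinearMap.toSpanSingleton ℂ p).restrictScalars ℝ
    - (Complex.conjCLE : ℂ →L[ℝ] ℂ) ∘L (ContinuousLinearMap.toSpanSingleton ℂ q).restrictScalars ℝ).prod
  (Complex.reCLM ∘L (ContinuousLinearMap.toSpanSingleton ℂ η).restrictScalars ℝ)

theorem tangentMap_apply (p q η v : ℂ) :
    tangentMap p q η v = (p * v - conj (q * v), (η * v).re) := by
  simp only [tangentMap]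
  ext <;> simp [mul_comm]

theorem hasFDerivAt_blowUp_zero (hy : y ≠ 0) :
    HasFDerivAt (fun w => blowUp a n m A B C (0, w))
      (tangentMap (a * y ^ (a - 1) * A 0) (m * y ^ (m - 1) * C 0) (n * y ^ (n - 1) * B 0)) y := by
  have h1 : HasDerivAt (fun w : ℂ => w ^ a * A 0) (a * y ^ (a - 1) * A 0) y :=
    (hasDerivAt_zpow a y (Or.inl hy)).mul_const _
  have h2 : HasDerivAt (fun w : ℂ => w ^ m * C 0) (m * y ^ (m - 1) * C 0) y :=
    (hasDerivAt_pow m y).mul_const _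
  have h3 : HasDerivAt (fun w : ℂ => w ^ n * B 0) (n * y ^ (n - 1) * B 0) y :=
    (hasDerivAt_pow n y).mul_const _
  have e : (fun w => blowUp a n m A B C (0, w))
      = fun w => (w ^ a * A 0 - conj (w ^ m * C 0), (w ^ n * B 0).re) := by
    funext w; simp [blowUp]
  rw [e]
  exact ((h1.hasFDerivAt.restrictScalars ℝ).sub
    ((Complex.conjCLE : ℂ →L[ℝ] ℂ).hasFDerivAt.comp y (h2.hasFDerivAt.restrictScalars ℝ))).prodMk
    (Complex.reCLM.hasFDerivAt.comp y (h3.hasFDerivAt.restrictScalars ℝ))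

/-- A transversal double point of the blow-up limit persists. -/
theorem exists_double_point_of_transversal (hA : AnalyticAt ℂ A 0) (hB : AnalyticAt ℂ B 0)
    (hC : AnalyticAt ℂ C 0) {y₀ y₁ : ℂ} (h0 : y₀ ≠ 0) (h1 : y₁ ≠ 0) (hne : y₀ ≠ y₁)
    {L₀ L₁ : ℂ →L[ℝ] ℂ × ℝ}
    (hL₀ : HasFDerivAt (fun w => blowUp a n m A B C (0, w)) L₀ y₀)
    (hL₁ : HasFDerivAt (fun w => blowUp a n m A B C (0, w)) L₁ y₁)
    (hd : blowUp a n m A B C (0, y₀) = blowUp a n m A B C (0, y₁))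
    (hs : ∀ x, ∃ v w, L₀ v - L₁ w = x) :
    ∃ R : ℝ, ∀ᶠ τ in 𝓝 (0 : ℝ), ∃ y y' : ℂ, y ≠ y' ∧ y ≠ 0 ∧ y' ≠ 0 ∧ ‖y‖ ≤ R ∧ ‖y'‖ ≤ R ∧
      blowUp a n m A B C (τ, y) = blowUp a n m A B C (τ, y') := by
  set Z := blowUp a n m A B C with hZ
  have c0 : ContDiffAt ℝ 1 Z (0, y₀) := contDiffAt_blowUp hA hB hC (Or.inl h0)
  have c1 : ContDiffAt ℝ 1 Z (0, y₁) := contDiffAt_blowUp hA hB hC (Or.inl h1)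
  obtain ⟨D₀, hD₀⟩ : ∃ D, HasStrictFDerivAt Z D (0, y₀) := ⟨_, c0.hasStrictFDerivAt (by simp)⟩
  obtain ⟨D₁, hD₁⟩ : ∃ D, HasStrictFDerivAt Z D (0, y₁) := ⟨_, c1.hasStrictFDerivAt (by simp)⟩
  have r0 : ∀ v, D₀ (0, v) = L₀ v := by
    intro v
    have := (hD₀.hasFDerivAt.comp y₀ (hasFDerivAt_prodMk_right (0 : ℝ) y₀)).unique hL₀
    rw [← this]; simp
  have r1 : ∀ v, D₁ (0, v) = L₁ v := by
    intro v
    have := (hD₁.hasFDerivAt.comp y₁ (hasFDerivAt_prodMk_right (0 : ℝ) y₁)).unique hL₁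
    rw [← this]; simp
  let p0 : ℝ × ℂ × ℂ →L[ℝ] ℝ × ℂ :=
    (ContinuousLinearMap.fst ℝ ℝ (ℂ × ℂ)).prod
      (ContinuousLinearMap.fst ℝ ℂ ℂ ∘L ContinuousLinearMap.snd ℝ ℝ (ℂ × ℂ))
  let p1 : ℝ × ℂ × ℂ →L[ℝ] ℝ × ℂ :=
    (ContinuousLinearMap.fst ℝ ℝ (ℂ × ℂ)).prod
      (ContinuousLinearMap.snd ℝ ℂ ℂ ∘L ContinuousLinearMap.snd ℝ ℝ (ℂ × ℂ))
  -- Keeping τ as a component of the target makes the perturbation parameter part of a single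
  -- submersion (τ, y, y') ↦ (τ, Z(τ, y) - Z(τ, y')). A submersion is locally open, so (τ, 0) is
  -- attained for every small τ.
  have hG : HasStrictFDerivAt (fun x : ℝ × ℂ × ℂ => (x.1, Z (p0 x) - Z (p1 x)))
      ((ContinuousLinearMap.fst ℝ ℝ (ℂ × ℂ)).prod (D₀ ∘L p0 - D₁ ∘L p1)) (0, y₀, y₁) :=
    (ContinuousLinearMap.fst ℝ ℝ (ℂ × ℂ)).hasStrictFDerivAt.prodMk
      ((HasStrictFDerivAt.comp (0, y₀, y₁) (by simpa [p0] using hD₀) p0.hasStrictFDerivAt).sub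
        (HasStrictFDerivAt.comp (0, y₀, y₁) (by simpa [p1] using hD₁) p1.hasStrictFDerivAt))
  have hsurj : ((ContinuousLinearMap.fst ℝ ℝ (ℂ × ℂ)).prod (D₀ ∘L p0 - D₁ ∘L p1)).range = ⊤ := by
    rw [LinearMap.range_eq_top]
    rintro ⟨s, x⟩
    -- The τ-derivatives of the two sheets are subtracted first; transversality absorbs what
    -- remains.
    obtain ⟨v, w, hvw⟩ := hs (x - (D₀ (s, 0) - D₁ (s, 0)))
    refine ⟨(s, v, w), ?_⟩
    have e0 : D₀ (s, v) = D₀ (s, 0) + L₀ v := by rw [← r0, ← map_add]; simp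
    have e1 : D₁ (s, w) = D₁ (s, 0) + L₁ w := by rw [← r1, ← map_add]; simp
    refine Prod.ext rfl ?_
    change D₀ (s, v) - D₁ (s, w) = x
    rw [e0, e1, ← sub_eq_zero]
    rw [← sub_eq_zero] at hvw
    rw [← hvw]; abel
  have hmap := hG.map_nhds_eq_of_surj hsurj
  have hval : (((0 : ℝ), y₀, y₁).1, Z (p0 (0, y₀, y₁)) - Z (p1 (0, y₀, y₁))) = (0, 0) := by
    simp [p0, p1, hd]
  rw [hval] at hmap
  set R := max ‖y₀‖ ‖y₁‖ + 1
  have hnb : ∀ᶠ x : ℝ × ℂ × ℂ in 𝓝 (0, y₀, y₁), x.2.1 ≠ x.2.2 ∧ x.2.1 ≠ 0 ∧ x.2.2 ≠ 0 ∧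
      ‖x.2.1‖ < R ∧ ‖x.2.2‖ < R := by
    have c0 : ContinuousAt (fun x : ℝ × ℂ × ℂ => x.2.1) (0, y₀, y₁) := by fun_prop
    have c1 : ContinuousAt (fun x : ℝ × ℂ × ℂ => x.2.2) (0, y₀, y₁) := by fun_prop
    refine ((c0.sub c1).eventually_ne (sub_ne_zero.2 hne)).and ?_ |>.mono
      fun x hx => ⟨sub_ne_zero.1 hx.1, hx.2⟩
    refine (c0.eventually_ne h0).and ((c1.eventually_ne h1).and ?_)
    refine (c0.norm.eventually_lt continuousAt_const ?_).and
      (c1.norm.eventually_lt continuousAt_const ?_)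
    · exact (le_max_left _ _).trans_lt (lt_add_one _)
    · exact (le_max_right _ _).trans_lt (lt_add_one _)
  have him := image_mem_map (m := fun x : ℝ × ℂ × ℂ => (x.1, Z (p0 x) - Z (p1 x))) hnb
  rw [hmap] at him
  refine ⟨R, ?_⟩
  have hc : Tendsto (fun τ : ℝ => (τ, (0 : ℂ × ℝ))) (𝓝 0) (𝓝 (0, 0)) :=
    Continuous.tendsto (by fun_prop) 0
  filter_upwards [hc him] with τ hτ
  obtain ⟨⟨s, y, y'⟩, ⟨q1, q2, q3, q4, q5⟩, q6⟩ := hτ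
  simp only [Prod.mk.injEq] at q6
  obtain ⟨rfl, q6⟩ := q6
  exact ⟨y, y', q1, q2, q3, q4.le, q5.le, sub_eq_zero.1 q6⟩

end BlowUp

/-! ### The double point of the model surface -/
section Model

/-- Cramer's rule: up to sign, Im(α conj γ) is the determinant of w ↦ (Re(α w), Re(γ w)). -/
theorem exists_re_re_eq {α γ : ℂ} (h : (α * conj γ).im ≠ 0) (p q : ℝ) :
    ∃ w : ℂ, (α * w).re = p ∧ (γ * w).re = q := by
  refine ⟨((-(α * conj γ).im)⁻¹ : ℝ) * (Complex.I * (p * conj γ - q * conj α)), ?_, ?_⟩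
  · have : (α * (((-(α * conj γ).im)⁻¹ : ℝ) * (Complex.I * (p * conj γ - q * conj α)))).re
        = (-(α * conj γ).im)⁻¹ * (p * -(α * conj γ).im) := by
      rw [mul_left_comm, Complex.re_ofReal_mul]
      congr 1
      simp; ring
    rw [this]; field_simp
  · have : (γ * (((-(α * conj γ).im)⁻¹ : ℝ) * (Complex.I * (p * conj γ - q * conj α)))).re
        = (-(α * conj γ).im)⁻¹ * (q * -(α * conj γ).im) := by
      rw [mul_left_comm, Complex.re_ofReal_mul]
      congr 1
      simp; ring
    rw [this]; field_simp

/-- The tangent planes at the two conjugate points span `ℝ³`. -/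
theorem tangent_span {G : ℂ} (h1 : G.im ≠ 0) (h2 : G ^ 2 + 1 ≠ 0) (x : ℂ) (h : ℝ) :
    ∃ w w' : ℂ, (w - conj (G ^ 2 * w)) - (w' - conj (conj G ^ 2 * w')) = x ∧
      (G * w).re - (conj G * w').re = h := by
  have hd : ((1 - G ^ 2) * conj G).im ≠ 0 := by
    have : ((1 - G ^ 2) * conj G).im = -((1 + (G.re ^ 2 + G.im ^ 2)) * G.im) := by
      simp [pow_two]; ring
    rw [this]
    exact neg_ne_zero.2 (mul_ne_zero (by positivity) h1)
  obtain ⟨d, hd1, hd2⟩ := exists_re_re_eq hd (x.re / 2) (h / 2)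
  obtain ⟨s, hs⟩ : ∃ s : ℂ, (1 + G ^ 2) * s = Complex.I * (x.im / 2 : ℝ) :=
    ⟨Complex.I * (x.im / 2 : ℝ) / (1 + G ^ 2), by rw [mul_div_cancel₀]; rwa [add_comm]⟩
  have hs' := congrArg Complex.im hs
  -- This splitting, symmetric and antisymmetric under conjugation, decouples the system. The real
  -- part of x and the height involve only d, with determinant -(1 + |G|²) Im G; the imaginary part
  -- of x involves only s, through (1 + G²) s.
  refine ⟨s + d, conj (s - d), ?_, ?_⟩
  · apply Complex.ext
    · simp [pow_two] at hd1 ⊢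
      linarith
    · simp [pow_two] at hs' ⊢
      linarith
  · simp at hd2 ⊢
    linarith

/-- For ξ = ρ e^(iφ) and a = ±1 the last condition reads ρ^(2k) = -m sin φ / sin(m φ), solvable once
sin φ > 0 > sin(m φ). The other two conditions hold when kφ lies strictly between π/2 and π, for
then ξ^k is neither real nor imaginary. The case a = -1, k = 1 must be excluded: there m = 1 and the
equation becomes ρ² = -1. -/
theorem exists_model_point {a : ℤ} {k m : ℕ} (h : (a = 1 ∧ 1 ≤ k) ∨ (a = -1 ∧ 2 ≤ k))
    (hm : (m : ℤ) = 2 * k + a) :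
    ∃ ξ : ℂ, (ξ ^ k).im ≠ 0 ∧ (ξ ^ k) ^ 2 + 1 ≠ 0 ∧ (ξ ^ a / a - conj (ξ ^ m / m)).im = 0 := by
  have hk : 1 ≤ k := by omega
  have hk' : (0 : ℝ) < k := by exact_mod_cast hk
  have hk1 : (1 : ℝ) ≤ k := by exact_mod_cast hk
  have hmpos : (0 : ℝ) < m := by
    have : 0 < m := by omega
    exact_mod_cast this
  have hmr : (m : ℝ) = 2 * k + a := by exact_mod_cast hm
  have hpi := Real.pi_pos
  -- Here α = kφ and mφ = 2α + aα/k. For a = 1 the angle α = 3π/5 gives 6π/5 < mφ ≤ 9π/5, and for a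
  -- = -1 the angle α = 4π/5 gives 6π/5 ≤ mφ < 8π/5 because k ≥ 2.
  obtain ⟨α, hα1, hα2, hα3, hα4⟩ : ∃ α : ℝ, Real.pi / 2 < α ∧ α < Real.pi ∧
      Real.pi < m * (α / k) ∧ m * (α / k) < 2 * Real.pi := by
    rcases h with ⟨rfl, -⟩ | ⟨rfl, hk2⟩
    · refine ⟨3 * Real.pi / 5, by linarith, by linarith, ?_, ?_⟩
      · rw [hmr, ← mul_div_assoc, lt_div_iff₀ hk']; push_cast; nlinarith
      · rw [hmr, ← mul_div_assoc, div_lt_iff₀ hk']; push_cast; nlinarith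
    · have hk2' : (2 : ℝ) ≤ k := by exact_mod_cast hk2
      refine ⟨4 * Real.pi / 5, by linarith, by linarith, ?_, ?_⟩
      · rw [hmr, ← mul_div_assoc, lt_div_iff₀ hk']; push_cast; nlinarith
      · rw [hmr, ← mul_div_assoc, div_lt_iff₀ hk']; push_cast; nlinarith
  set φ := α / k with hφ
  have hφ0 : 0 < φ := div_pos (by linarith) hk'
  have hφπ : φ < Real.pi := by
    rw [hφ, div_lt_iff₀ hk']; nlinarith
  have hkφ : k * φ = α := by rw [hφ]; field_simp
  have s1 : 0 < Real.sin φ := Real.sin_pos_of_pos_of_lt_pi hφ0 hφπ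
  have s2 : Real.sin (m * φ) < 0 := by
    have : 0 < Real.sin (m * φ - Real.pi) :=
      Real.sin_pos_of_pos_of_lt_pi (by linarith) (by linarith)
    rw [Real.sin_sub_pi] at this; linarith
  have s3 : 0 < Real.sin (k * φ) := by
    rw [hkφ]; exact Real.sin_pos_of_pos_of_lt_pi (by linarith) hα2
  have s4 : Real.cos (k * φ) < 0 := by
    rw [hkφ]; exact Real.cos_neg_of_pi_div_two_lt_of_lt hα1 (by linarith)
  have hq : 0 < -(m * Real.sin φ) / Real.sin (m * φ) :=
    div_pos_of_neg_of_neg (by nlinarith) s2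
  obtain ⟨ρ, hρ, hρk⟩ : ∃ ρ : ℝ, 0 < ρ ∧ ρ ^ (2 * k) = -(m * Real.sin φ) / Real.sin (m * φ) :=
    ⟨_, Real.rpow_pos_of_pos hq _, Real.rpow_inv_natCast_pow hq.le (by omega)⟩
  set E := Complex.exp (φ * Complex.I) with hE
  have hpow : ∀ j : ℕ, ((ρ : ℂ) * E) ^ j
      = ((ρ ^ j * Real.cos (j * φ) : ℝ) : ℂ) + ((ρ ^ j * Real.sin (j * φ) : ℝ) : ℂ) * Complex.I := by
    intro j
    have : (j : ℂ) * (φ * Complex.I) = ((j : ℂ) * φ) * Complex.I := by ring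
    rw [mul_pow, hE, ← Complex.exp_nat_mul, this, Complex.exp_mul_I]
    push_cast; ring
  have him : ∀ j : ℕ, (((ρ : ℂ) * E) ^ j).im = ρ ^ j * Real.sin (j * φ) := by
    intro j
    rw [hpow j, Complex.add_im, Complex.ofReal_im, Complex.im_ofReal_mul]; simp
  have hre : ∀ j : ℕ, (((ρ : ℂ) * E) ^ j).re = ρ ^ j * Real.cos (j * φ) := by
    intro j
    rw [hpow j, Complex.add_re, Complex.ofReal_re, Complex.re_ofReal_mul]; simp
  refine ⟨ρ * E, ?_, ?_, ?_⟩
  · rw [him]; positivity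
  · intro h0
    have h0' := congrArg Complex.im h0
    set G := ((ρ : ℂ) * E) ^ k with hG
    have g1 : G.im ≠ 0 := by rw [hG, him]; positivity
    have g2 : G.re ≠ 0 := by
      rw [hG, hre]; exact mul_ne_zero (by positivity) s4.ne
    simp [pow_two] at h0'
    have : G.re * G.im = 0 := by linarith
    exact (mul_ne_zero g2 g1) this
  · have e1 : (((ρ : ℂ) * E) ^ a / a).im = ρ ^ a * Real.sin φ := by
      rcases h with ⟨rfl, -⟩ | ⟨rfl, -⟩
      · have := him 1
        simpa using this
      · rw [zpow_neg_one, zpow_neg_one]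
        have i1 := him 1
        have r1 := hre 1
        simp only [pow_one, Nat.cast_one, one_mul] at i1 r1
        rw [Int.cast_neg, Int.cast_one, div_neg, div_one, Complex.neg_im, Complex.inv_im, i1,
          Complex.normSq_apply, i1, r1]
        have : ρ * Real.cos φ * (ρ * Real.cos φ) + ρ * Real.sin φ * (ρ * Real.sin φ) = ρ ^ 2 := by
          linear_combination ρ ^ 2 * Real.cos_sq_add_sin_sq φ
        rw [this]; field_simp
    have e2 : (((ρ : ℂ) * E) ^ m / m).im = ρ ^ m * Real.sin (m * φ) / m := by
      rw [Complex.div_natCast_im, him]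
    rw [Complex.sub_im, Complex.conj_im, e1, e2]
    have e3 : ρ ^ m = ρ ^ (2 * k) * ρ ^ a := by
      rw [← zpow_natCast, hm, ← zpow_natCast, ← zpow_add₀ hρ.ne']; push_cast; rfl
    rw [e3, hρk]
    have := s2.ne
    field_simp
    ring

end Model

/-! ### Normalizing the leading coefficients: double points of the family -/

section Family
variable {a : ℤ} {k n m : ℕ} {A B C : ℂ → ℂ}

/-- With μ = τ^(-k), both μ⁻¹ τ^a and μ τ^m equal τ^n, which is also the factor that the height
acquires. -/
theorem blowUp_fst_scale (hn : (n : ℤ) = k + a) (hm : (m : ℤ) = 2 * k + a) {τ μ : ℝ} (hτ : 0 < τ)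
    (hμ : τ ^ k * μ = 1) (y : ℂ) :
    (μ : ℂ)⁻¹ * ((τ * y) ^ a * A (τ * y)) - conj (μ * ((τ * y) ^ m * C (τ * y)))
      = (τ : ℂ) ^ n * (blowUp a n m A B C (τ, y)).1 := by
  have hτ' : (τ : ℂ) ≠ 0 := by exact_mod_cast hτ.ne'
  have hμ' : (τ : ℂ) ^ k * μ = 1 := by exact_mod_cast hμ
  have h1 : (μ : ℂ)⁻¹ = (τ : ℂ) ^ k := by
    rw [inv_eq_iff_eq_inv]; exact eq_inv_of_mul_eq_one_right hμ'
  have h2 : (τ : ℂ) ^ k * (τ : ℂ) ^ a = (τ : ℂ) ^ n := by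
    rw [← zpow_natCast, ← zpow_natCast, ← zpow_add₀ hτ', hn]
  have h3 : (τ : ℂ) ^ m = (τ : ℂ) ^ k * (τ : ℂ) ^ n := by
    rw [← pow_add]; congr 1; omega
  have h4 : (μ : ℂ) * (τ : ℂ) ^ m = (τ : ℂ) ^ n := by rw [h3]; linear_combination (τ : ℂ) ^ n * hμ'
  have h5 : (μ : ℂ) * ((τ * y) ^ m * C (τ * y)) = (τ : ℂ) ^ n * (y ^ m * C (τ * y)) := by
    rw [mul_pow]; linear_combination (y ^ m * C (τ * y)) * h4
  rw [h5, h1, mul_zpow, map_mul (starRingEnd ℂ), map_pow, Complex.conj_ofReal]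
  simp only [blowUp]
  linear_combination (y ^ a * A (τ * y)) * h2

theorem blowUp_snd_scale (τ : ℝ) (y : ℂ) :
    ((τ * y) ^ n * B (τ * y)).re = τ ^ n * (blowUp a n m A B C (τ, y)).2 := by
  simp only [blowUp]
  rw [← Complex.re_ofReal_mul]
  push_cast
  rw [mul_pow]; congr 1; ring

/-- The blow-up parameter `τ = μ ^ (-1 / k)`. -/
theorem rpow_neg_inv_pow_mul (hk : 1 ≤ k) {μ : ℝ} (hμ : 0 < μ) :
    (μ ^ (-(1 / (k : ℝ)))) ^ k * μ = 1 := by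
  have hk' : (k : ℝ) ≠ 0 := by positivity
  rw [← Real.rpow_natCast, ← Real.rpow_mul hμ.le]
  have : -(1 / (k : ℝ)) * k = -1 := by field_simp
  rw [this, Real.rpow_neg_one, inv_mul_cancel₀ hμ.ne']

theorem tendsto_rpow_neg_inv (hk : 1 ≤ k) :
    Tendsto (fun μ : ℝ => μ ^ (-(1 / (k : ℝ)))) atTop (𝓝 0) :=
  tendsto_rpow_neg_atTop (by positivity)

/-- For large `μ` the surface with primitives `μ⁻¹ z ^ a A`, `z ^ n B`, `μ z ^ m C`, whose leading
coefficients are those of a zero of order `k` of the Gauss map, has double points close to `0`. -/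
theorem exists_double_point (h : (a = 1 ∧ 1 ≤ k) ∨ (a = -1 ∧ 2 ≤ k)) (hn : (n : ℤ) = k + a)
    (hm : (m : ℤ) = 2 * k + a) (hA : AnalyticAt ℂ A 0) (hB : AnalyticAt ℂ B 0)
    (hC : AnalyticAt ℂ C 0) {p g : ℂ} (hp : p ≠ 0) (hg : g ≠ 0) (hA0 : a * A 0 = p)
    (hB0 : n * B 0 = g * p) (hC0 : m * C 0 = g ^ 2 * p) {d : ℝ} (hd : 0 < d) :
    ∃ Λ > 0, ∀ μ : ℝ, Λ ≤ μ → ∃ z z' : ℂ, z ≠ z' ∧ z ≠ 0 ∧ z' ≠ 0 ∧ ‖z‖ < d ∧ ‖z'‖ < d ∧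
      (μ : ℂ)⁻¹ * (z ^ a * A z) - conj (μ * (z ^ m * C z))
        = (μ : ℂ)⁻¹ * (z' ^ a * A z') - conj (μ * (z' ^ m * C z')) ∧
      (z ^ n * B z).re = (z' ^ n * B z').re := by
  have hk : 1 ≤ k := by omega
  have hn1 : 1 ≤ n := by omega
  have hm1 : 1 ≤ m := by omega
  have ha0 : a ≠ 0 := by omega
  obtain ⟨ξ, hi, hsq, hreal⟩ := exists_model_point h hm
  have hξ : ξ ≠ 0 := by
    rintro rfl
    rw [zero_pow (by omega)] at hi; simp at hi
  -- The substitution y = β x is to turn the leading terms into those of the model. Equal moduli of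
  -- p β^a, g p β^n and g² p β^m require |g| |β|^k = 1, hence |β| = s; the argument of β is chosen
  -- to make g p β^n positive. What is left over is a unit factor u, a rotation about the vertical
  -- axis.
  obtain ⟨s, hs, hsk⟩ : ∃ s : ℝ, 0 < s ∧ s ^ k = ‖g‖⁻¹ :=
    ⟨_, Real.rpow_pos_of_pos (by positivity) _,
      Real.rpow_inv_natCast_pow (inv_nonneg.2 (norm_nonneg g)) (by omega)⟩
  set r : ℝ := s ^ n * ‖g * p‖ with hr
  have hgp : g * p ≠ 0 := mul_ne_zero hg hp
  have hrpos : 0 < r := by positivity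
  have hrc : (r : ℂ) ≠ 0 := by exact_mod_cast hrpos.ne'
  obtain ⟨β, hβ⟩ : ∃ β : ℂ, β ^ n = r / (g * p) :=
    IsAlgClosed.exists_pow_nat_eq _ (by omega)
  have hβn : ‖β‖ = s := by
    have : ‖β‖ ^ n = s ^ n := by
      rw [← norm_pow, hβ, norm_div, Complex.norm_of_nonneg hrpos.le, hr]; field_simp
    exact (pow_left_inj₀ (norm_nonneg _) hs.le (by omega)).1 this
  have hβ0 : β ≠ 0 := by rw [← norm_pos_iff, hβn]; exact hs
  have hβn' : g * p * β ^ n = r := by rw [hβ]; field_simp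
  set u : ℂ := p * β ^ a / r with hu
  have hru : p * β ^ a = r * u := by rw [hu]; field_simp
  have hnr : ‖p * β ^ a‖ = r := by
    have e1 : s ^ n = s ^ k * s ^ a := by
      rw [← zpow_natCast, ← zpow_natCast, ← zpow_add₀ hs.ne', hn]
    rw [norm_mul, norm_zpow, hβn, hr, e1, hsk, norm_mul]
    field_simp
  have hu1 : u * conj u = 1 := by
    rw [Complex.mul_conj, Complex.normSq_eq_norm_sq, hu, norm_div, hnr,
      Complex.norm_of_nonneg hrpos.le, div_self hrpos.ne']
    simp
  have hβk : g * β ^ k * u = 1 := by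
    have e : β ^ n = β ^ k * β ^ a := by
      rw [← zpow_natCast, ← zpow_natCast, ← zpow_add₀ hβ0, hn]
    rw [e] at hβn'
    have : (r : ℂ) * (g * β ^ k * u) = r * 1 := by linear_combination hβn' - g * β ^ k * hru
    exact mul_left_cancel₀ hrc this
  have hβm : g ^ 2 * p * β ^ m = r * conj u := by
    have e : β ^ m = β ^ k * β ^ n := by rw [← pow_add]; congr 1; omega
    have e2 : g * β ^ k = conj u := by
      calc g * β ^ k = g * β ^ k * (u * conj u) := by rw [hu1, mul_one]
        _ = (g * β ^ k * u) * conj u := by ring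
        _ = conj u := by rw [hβk, one_mul]
    rw [e]; linear_combination (g * β ^ k) * hβn' + r * e2
  have hac : (a : ℂ) ≠ 0 := by exact_mod_cast ha0
  have hnc : (n : ℂ) ≠ 0 := by exact_mod_cast (by omega : n ≠ 0)
  have hmc : (m : ℂ) ≠ 0 := by exact_mod_cast (by omega : m ≠ 0)
  have huc : conj u ≠ 0 := fun h0 => by rw [h0, mul_zero] at hu1; exact zero_ne_one hu1
  have hu0 : u ≠ 0 := fun h0 => by rw [h0, zero_mul] at hu1; exact zero_ne_one hu1
  have hval : ∀ x : ℂ, blowUp a n m A B C (0, β * x)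
      = (r * u * (x ^ a / a - conj (x ^ m / m)), r * (x ^ n / n).re) := by
    intro x
    have e1 : (β * x) ^ a * A 0 = r * u * (x ^ a / a) := by
      rw [mul_zpow, ← hru, ← hA0]; field_simp
    have e2 : (β * x) ^ m * C 0 = r * conj u * (x ^ m / m) := by
      rw [mul_pow, ← hβm, ← hC0]; field_simp
    have e3 : (β * x) ^ n * B 0 = r * (x ^ n / n) := by
      rw [mul_pow, ← hβn', ← hB0]; field_simp
    simp only [blowUp, Complex.ofReal_zero, zero_mul, e1, e2, e3]
    rw [map_mul (starRingEnd ℂ), map_mul (starRingEnd ℂ), Complex.conj_conj, Complex.conj_ofReal,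
      Complex.re_ofReal_mul]
    congr 1; ring
  -- The factor x^(1 - a) rescales the parameter direction so that P, H, Q become 1, x^k, x^(2k),
  -- the form treated in `tangent_span`.
  have hder : ∀ x : ℂ, x ≠ 0 → ∀ w : ℂ,
      tangentMap (a * (β * x) ^ (a - 1) * A 0) (m * (β * x) ^ (m - 1) * C 0)
        (n * (β * x) ^ (n - 1) * B 0) (β * x ^ (1 - a) * w)
        = (r * u * (w - conj ((x ^ k) ^ 2 * w)), r * (x ^ k * w).re) := by
    intro x hx w
    have hx1 : x ^ (a - 1) * x ^ (1 - a) = 1 := by rw [← zpow_add₀ hx]; simp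
    have e1 : a * (β * x) ^ (a - 1) * A 0 * (β * x ^ (1 - a) * w) = r * u * w := by
      have : β ^ (a - 1) * β = β ^ a := by rw [← zpow_add_one₀ hβ0]; simp
      rw [mul_zpow]
      linear_combination (β ^ (a - 1) * x ^ (a - 1) * β * x ^ (1 - a) * w) * hA0
        + (p * w * β ^ (a - 1) * β) * hx1 + p * w * this + w * hru
    have e2 : m * (β * x) ^ (m - 1) * C 0 * (β * x ^ (1 - a) * w)
        = r * conj u * ((x ^ k) ^ 2 * w) := by
      have h1 : β ^ (m - 1) * β = β ^ m := by rw [← pow_succ]; congr 1; omega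
      have h2 : x ^ (m - 1) * x ^ (1 - a) = (x ^ k) ^ 2 := by
        rw [← pow_mul, ← zpow_natCast, ← zpow_natCast, ← zpow_add₀ hx]; congr 1; omega
      rw [mul_pow]
      linear_combination (β ^ (m - 1) * x ^ (m - 1) * β * x ^ (1 - a) * w) * hC0
        + (g ^ 2 * p * w * β ^ (m - 1) * β) * h2 + (g ^ 2 * p * w * (x ^ k) ^ 2) * h1
        + (x ^ k) ^ 2 * w * hβm
    have e3 : n * (β * x) ^ (n - 1) * B 0 * (β * x ^ (1 - a) * w) = r * (x ^ k * w) := by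
      have h1 : β ^ (n - 1) * β = β ^ n := by rw [← pow_succ]; congr 1; omega
      have h2 : x ^ (n - 1) * x ^ (1 - a) = x ^ k := by
        rw [← zpow_natCast, ← zpow_natCast, ← zpow_add₀ hx]; congr 1; omega
      rw [mul_pow]
      linear_combination (β ^ (n - 1) * x ^ (n - 1) * β * x ^ (1 - a) * w) * hB0
        + (g * p * w * β ^ (n - 1) * β) * h2 + (g * p * w * x ^ k) * h1 + x ^ k * w * hβn'
    rw [tangentMap_apply, e1, e2, e3, map_mul (starRingEnd ℂ), map_mul (starRingEnd ℂ),
      Complex.conj_conj, Complex.conj_ofReal, Complex.re_ofReal_mul]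
    congr 1; ring
  have hcξ : conj ξ ≠ 0 := by simpa using hξ
  have hne : β * ξ ≠ β * conj ξ := by
    intro h0
    have h1 : ξ = conj ξ := mul_left_cancel₀ hβ0 h0
    apply hi
    have : conj (ξ ^ k) = ξ ^ k := by rw [map_pow, ← h1]
    exact Complex.conj_eq_iff_im.1 this
  obtain ⟨R, hR⟩ := exists_double_point_of_transversal hA hB hC (mul_ne_zero hβ0 hξ)
    (mul_ne_zero hβ0 hcξ) hne (hasFDerivAt_blowUp_zero (mul_ne_zero hβ0 hξ))
    (hasFDerivAt_blowUp_zero (mul_ne_zero hβ0 hcξ)) (a := a) (n := n) (m := m)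
    -- Conjugating x conjugates the first component of the model, real at ξ, and preserves its
    -- height.
    (by
      rw [hval, hval]
      have e : (conj ξ ^ a / a - conj (conj ξ ^ m / m)) = conj (ξ ^ a / a - conj (ξ ^ m / m)) := by
        simp
      rw [e, Complex.conj_eq_iff_im.2 hreal]
      congr 2
      have : conj ξ ^ n / n = conj (ξ ^ n / n) := by simp
      rw [this, Complex.conj_re])
    (by
      rintro ⟨x, y⟩
      obtain ⟨w, w', h1, h2⟩ := tangent_span hi hsq (x / (r * u)) (y / r)
      refine ⟨β * ξ ^ (1 - a) * w, β * conj ξ ^ (1 - a) * w', ?_⟩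
      rw [hder ξ hξ, hder (conj ξ) hcξ]
      rw [map_pow] at h1 h2
      refine Prod.ext ?_ ?_
      · change r * u * _ - r * u * _ = x
        rw [← mul_sub, h1]; field_simp
      · change r * _ - r * _ = y
        rw [← mul_sub, h2]; field_simp)
  have hev : ∀ᶠ μ : ℝ in atTop, ∃ z z' : ℂ, z ≠ z' ∧ z ≠ 0 ∧ z' ≠ 0 ∧ ‖z‖ < d ∧ ‖z'‖ < d ∧
      (μ : ℂ)⁻¹ * (z ^ a * A z) - conj (μ * (z ^ m * C z))
        = (μ : ℂ)⁻¹ * (z' ^ a * A z') - conj (μ * (z' ^ m * C z')) ∧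
      (z ^ n * B z).re = (z' ^ n * B z').re := by
    have ht := tendsto_rpow_neg_inv hk
    have hsmall : ∀ᶠ τ in 𝓝 (0 : ℝ), |τ| * R < d := by
      have : ContinuousAt (fun τ : ℝ => |τ| * R) 0 := by fun_prop
      exact this.eventually_lt continuousAt_const (by simpa using hd)
    filter_upwards [ht.eventually hR, ht.eventually hsmall, eventually_gt_atTop 0]
      with μ h1 h2 hμ
    obtain ⟨y, y', q1, q2, q3, q4, q5, q6⟩ := h1
    set τ : ℝ := μ ^ (-(1 / (k : ℝ))) with hτ
    have hτ0 : 0 < τ := Real.rpow_pos_of_pos hμ _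
    have hτc : (τ : ℂ) ≠ 0 := by exact_mod_cast hτ0.ne'
    have hτμ : τ ^ k * μ = 1 := rpow_neg_inv_pow_mul hk hμ
    rw [abs_of_pos hτ0] at h2
    have hnorm : ∀ w : ℂ, ‖w‖ ≤ R → ‖(τ : ℂ) * w‖ < d := by
      intro w hw
      rw [norm_mul, Complex.norm_of_nonneg hτ0.le]
      exact (mul_le_mul_of_nonneg_left hw hτ0.le).trans_lt h2
    refine ⟨τ * y, τ * y', fun h0 => q1 (mul_left_cancel₀ hτc h0), mul_ne_zero hτc q2,
      mul_ne_zero hτc q3, hnorm y q4, hnorm y' q5, ?_, ?_⟩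
    · rw [blowUp_fst_scale (B := B) hn hm hτ0 hτμ, blowUp_fst_scale (B := B) hn hm hτ0 hτμ, q6]
    · rw [blowUp_snd_scale (a := a) (m := m) (A := A) (C := C),
        blowUp_snd_scale (a := a) (m := m) (A := A) (C := C), q6]
  obtain ⟨Λ, hΛ⟩ := eventually_atTop.1 hev
  exact ⟨max Λ 1, by positivity, fun μ hμ => hΛ μ ((le_max_left _ _).trans hμ)⟩

end Family

/-! ### Surfaces and their deformations from primitives -/

/-- The point of `ℝ³` with given values of the primitives of `g⁻¹ dh`, `dh` and `g dh`. -/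
def ofPrim (p f q : ℂ) : E3 := !₂[((p - q) / 2).re, (Complex.I * (p + q) / 2).re, f.re]

theorem ofPrim_zero (p f q : ℂ) : ofPrim p f q 0 = (p.re - q.re) / 2 := by
  simp [ofPrim]

theorem ofPrim_one (p f q : ℂ) : ofPrim p f q 1 = -(p.im + q.im) / 2 := by
  simp [ofPrim]

theorem ofPrim_two (p f q : ℂ) : ofPrim p f q 2 = f.re := rfl

theorem ofPrim_eq {p f q p' f' q' : ℂ} (h : p - conj q = p' - conj q') (hf : f.re = f'.re) :
    ofPrim p f q = ofPrim p' f' q' := by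
  have h1 := congrArg Complex.re h
  have h2 := congrArg Complex.im h
  simp at h1 h2
  apply ext_E3
  · rw [ofPrim_zero, ofPrim_zero, h1]
  · rw [ofPrim_one, ofPrim_one, h2]
  · exact hf

theorem ofPrim_sub (p f q p' f' q' : ℂ) :
    ofPrim p f q - ofPrim p' f' q' = ofPrim (p - p') (f - f') (q - q') := by
  apply ext_E3 <;> simp [ofPrim_zero, ofPrim_one, ofPrim_two] <;> ring

theorem smul_ofPrim (r : ℝ) (p f q : ℂ) :
    r • ofPrim p f q = ofPrim (r * p) (r * f) (r * q) := by
  apply ext_E3 <;> simp [ofPrim_zero, ofPrim_one, ofPrim_two] <;> ring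

theorem enneper_eq_ofPrim (k : ℕ) (ζ : ℂ) :
    enneper k ζ = ofPrim ζ (ζ ^ (k + 1) / (k + 1)) (ζ ^ (2 * k + 1) / (2 * k + 1)) := rfl

/-- `ofPrim` as a continuous linear map. -/
def ofPrimCLM : ℂ × ℂ × ℂ →L[ℝ] E3 :=
  LinearMap.toContinuousLinearMap
    { toFun := fun x => ofPrim x.1 x.2.1 x.2.2
      map_add' := fun x y => by
        apply ext_E3 <;> simp [ofPrim_zero, ofPrim_one, ofPrim_two] <;> ring
      map_smul' := fun r x => by
        apply ext_E3 <;> simp [ofPrim_zero, ofPrim_one, ofPrim_two] <;> ring }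

theorem ofPrimCLM_apply (x : ℂ × ℂ × ℂ) : ofPrimCLM x = ofPrim x.1 x.2.1 x.2.2 := rfl

section Primitives
variable {p f q : ℂ → ℂ} {U : Set ℂ} {z : ℂ} {P H Q : ℂ}

theorem hasFDerivAt_ofPrim (hp : HasDerivAt p P z) (hf : HasDerivAt f H z) (hq : HasDerivAt q Q z) :
    HasFDerivAt (fun w => ofPrim (p w) (f w) (q w))
      (ofPrimCLM ∘L (((ContinuousLinearMap.toSpanSingleton ℂ P).restrictScalars ℝ).prod
        (((ContinuousLinearMap.toSpanSingleton ℂ H).restrictScalars ℝ).prod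
          ((ContinuousLinearMap.toSpanSingleton ℂ Q).restrictScalars ℝ)))) z :=
  ofPrimCLM.hasFDerivAt.comp z ((hp.hasFDerivAt.restrictScalars ℝ).prodMk
    ((hf.hasFDerivAt.restrictScalars ℝ).prodMk (hq.hasFDerivAt.restrictScalars ℝ)))

theorem complexVelocity_ofPrim (hp : HasDerivAt p P z) (hf : HasDerivAt f H z)
    (hq : HasDerivAt q Q z) :
    complexVelocity (fun w => ofPrim (p w) (f w) (q w)) z = formVec P Q H := by
  have hd := (hasFDerivAt_ofPrim hp hf hq).fderiv
  have hu : du (fun w => ofPrim (p w) (f w) (q w)) z = ofPrim P H Q := by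
    rw [du, hd]; simp [ofPrimCLM_apply]
  have hv : dv (fun w => ofPrim (p w) (f w) (q w)) z
      = ofPrim (Complex.I * P) (Complex.I * H) (Complex.I * Q) := by
    rw [dv, hd]; simp [ofPrimCLM_apply]
  funext j
  fin_cases j
  · change ((du _ z 0 : ℝ) : ℂ) - Complex.I * ((dv _ z 0 : ℝ) : ℂ) = (P - Q) / 2
    rw [hu, hv, ofPrim_zero, ofPrim_zero]
    apply Complex.ext <;> simp <;> ring
  · change ((du _ z 1 : ℝ) : ℂ) - Complex.I * ((dv _ z 1 : ℝ) : ℂ) = Complex.I * (P + Q) / 2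
    rw [hu, hv, ofPrim_one, ofPrim_one]
    apply Complex.ext <;> simp <;> ring
  · change ((du _ z 2 : ℝ) : ℂ) - Complex.I * ((dv _ z 2 : ℝ) : ℂ) = H
    rw [hu, hv, ofPrim_two, ofPrim_two]
    apply Complex.ext <;> simp

theorem contDiffOn_ofPrim (hU : IsOpen U) (hp : DifferentiableOn ℂ p U)
    (hf : DifferentiableOn ℂ f U) (hq : DifferentiableOn ℂ q U) :
    ContDiffOn ℝ ∞ (fun w => ofPrim (p w) (f w) (q w)) U :=
  ofPrimCLM.contDiff.comp_contDiffOn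
    ((contDiffOn_restrictScalars_of_differentiableOn hU hp).prodMk
      ((contDiffOn_restrictScalars_of_differentiableOn hU hf).prodMk
        (contDiffOn_restrictScalars_of_differentiableOn hU hq)))

/-- `p`, `f`, `q` are primitives of the Weierstrass forms of `F` on `U`. -/
structure HasPrimitivesOn (F : ℂ → E3) (p f q : ℂ → ℂ) (U : Set ℂ) : Prop where
  derivP : ∀ z ∈ U, HasDerivAt p (wP F z) z
  derivH : ∀ z ∈ U, HasDerivAt f (wH F z) z
  derivQ : ∀ z ∈ U, HasDerivAt q (wQ F z) z

namespace HasPrimitivesOn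
variable {F : ℂ → E3}

theorem mono {V : Set ℂ} (h : HasPrimitivesOn F p f q U) (hV : V ⊆ U) :
    HasPrimitivesOn F p f q V :=
  ⟨fun z hz => h.derivP z (hV hz), fun z hz => h.derivH z (hV hz),
    fun z hz => h.derivQ z (hV hz)⟩

theorem complexVelocity_deformed (h : HasPrimitivesOn F p f q U) (t : ℝ) (hz : z ∈ U) :
    complexVelocity (fun w => ofPrim (p w / t) (f w) (t * q w)) z
      = formVec (wP F z / t) (t * wQ F z) (wH F z) :=
  complexVelocity_ofPrim ((h.derivP z hz).div_const _) (h.derivH z hz)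
    ((h.derivQ z hz).const_mul _)

theorem contDiffOn_deformed (h : HasPrimitivesOn F p f q U) (hU : IsOpen U) (t : ℝ) :
    ContDiffOn ℝ ∞ (fun w => ofPrim (p w / t) (f w) (t * q w)) U :=
  contDiffOn_ofPrim hU
    (fun z hz => ((h.derivP z hz).div_const _).differentiableAt.differentiableWithinAt)
    (fun z hz => (h.derivH z hz).differentiableAt.differentiableWithinAt)
    (fun z hz => ((h.derivQ z hz).const_mul _).differentiableAt.differentiableWithinAt)

theorem isDeformationOn (h : HasPrimitivesOn F p f q U) (hF : IsWeierstrassOn F U) (hU : IsOpen U)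
    (t : ℝ) : IsDeformationOn t F U (fun w => ofPrim (p w / t) (f w) (t * q w)) := by
  rw [hF.isDeformationOn_iff]
  exact ⟨h.contDiffOn_deformed hU t, fun z hz _ => h.complexVelocity_deformed t hz⟩

/-- The deformation is unique up to translations. -/
theorem exists_eq_add_const (h : HasPrimitivesOn F p f q U) (hF : IsWeierstrassOn F U)
    (hU : IsOpen U) (hc : IsPreconnected U) (hH : ∀ z ∈ U, wH F z ≠ 0) {t : ℝ} {Y : ℂ → E3}
    (hY : IsDeformationOn t F U Y) :
    ∃ c : E3, ∀ z ∈ U, Y z = ofPrim (p z / t) (f z) (t * q z) + c := by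
  rw [hF.isDeformationOn_iff] at hY
  have hs := h.contDiffOn_deformed hU t
  obtain ⟨c, hc⟩ := hU.exists_is_const_of_fderiv_eq_zero (𝕜 := ℝ)
    (f := fun z => Y z - ofPrim (p z / t) (f z) (t * q z)) hc
    ((hY.1.differentiableOn (by simp)).sub (hs.differentiableOn (by simp)))
    (fun z hz => by
      have d1 : DifferentiableAt ℝ Y z :=
        (hY.1.contDiffAt (hU.mem_nhds hz)).differentiableAt (by simp)
      have d2 := (hs.contDiffAt (hU.mem_nhds hz)).differentiableAt (by simp)
      rw [fderiv_fun_sub d1 d2, fderiv_eq_of_complexVelocity_eq (w := z)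
        ((hY.2 z hz (hH z hz)).trans (h.complexVelocity_deformed t hz).symm)]
      simp)
  exact ⟨c, fun z hz => by rw [← hc z hz]; abel⟩

end HasPrimitivesOn
end Primitives

/-! ### The punctured disc -/

theorem isOpen_puncturedDisc (d : ℝ) : IsOpen (puncturedDisc d) :=
  (isOpen_lt continuous_const continuous_norm).inter (isOpen_lt continuous_norm continuous_const)

theorem isPreconnected_puncturedDisc (d : ℝ) : IsPreconnected (puncturedDisc d) := by
  have : puncturedDisc d = (fun x : ℝ × ℝ => (x.1 : ℂ) * Complex.exp (x.2 * Complex.I)) ''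
      (Ioo 0 d ×ˢ univ) := by
    ext z
    constructor
    · rintro ⟨h1, h2⟩
      exact ⟨(‖z‖, z.arg), ⟨⟨h1, h2⟩, mem_univ _⟩, Complex.norm_mul_exp_arg_mul_I z⟩
    · rintro ⟨⟨r, θ⟩, ⟨⟨h1, h2⟩, -⟩, rfl⟩
      have : ‖(r : ℂ) * Complex.exp (θ * Complex.I)‖ = r := by
        rw [norm_mul, Complex.norm_exp_ofReal_mul_I, mul_one, Complex.norm_of_nonneg h1.le]
      exact ⟨this.symm ▸ h1, this.symm ▸ h2⟩
  rw [this]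
  exact (isPreconnected_Ioo.prod isPreconnected_univ).image _ (by fun_prop)

theorem puncturedDisc_eq (d : ℝ) : puncturedDisc d = Metric.ball 0 d \ {0} := by
  ext z; simp [puncturedDisc, and_comm]

theorem puncturedDisc_mem_nhdsNE {d : ℝ} (hd : 0 < d) : puncturedDisc d ∈ 𝓝[≠] (0 : ℂ) := by
  rw [puncturedDisc_eq, sdiff_eq, inter_comm]
  exact inter_mem_nhdsWithin _ (Metric.ball_mem_nhds _ hd)

theorem exists_puncturedDisc_of_eventually {P : ℂ → Prop} (h : ∀ᶠ z in 𝓝[≠] (0 : ℂ), P z) :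
    ∃ d > 0, ∀ z ∈ puncturedDisc d, P z := by
  rw [eventually_nhdsWithin_iff, Metric.eventually_nhds_iff] at h
  obtain ⟨d, hd, h⟩ := h
  exact ⟨d, hd, fun z hz => h (by simpa using hz.2) (by simpa using hz.1)⟩

/-- The main non-injectivity statement, for a surface whose data have the primitives
`z ^ a A`, `z ^ n B`, `z ^ m C`. -/
theorem eventually_not_injOn {F : ℂ → E3} {p f q : ℂ → ℂ} {d : ℝ} (hd : 0 < d)
    (hF : IsWeierstrassOn F (puncturedDisc d)) (hH : ∀ z ∈ puncturedDisc d, wH F z ≠ 0)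
    (hprim : HasPrimitivesOn F p f q (puncturedDisc d))
    {a : ℤ} {k n m : ℕ} {A B C : ℂ → ℂ} (h : (a = 1 ∧ 1 ≤ k) ∨ (a = -1 ∧ 2 ≤ k))
    (hn : (n : ℤ) = k + a) (hm : (m : ℤ) = 2 * k + a) (hA : AnalyticAt ℂ A 0)
    (hB : AnalyticAt ℂ B 0) (hC : AnalyticAt ℂ C 0) {P g : ℂ} (hP : P ≠ 0) (hg : g ≠ 0)
    (hA0 : a * A 0 = P) (hB0 : n * B 0 = g * P) (hC0 : m * C 0 = g ^ 2 * P)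
    (ep : ∀ z ∈ puncturedDisc d, p z = z ^ a * A z) (ef : ∀ z ∈ puncturedDisc d, f z = z ^ n * B z)
    (eq : ∀ z ∈ puncturedDisc d, q z = z ^ m * C z) :
    ∃ Λ > 0, ∀ μ : ℝ, Λ ≤ μ → ∀ Y : ℂ → E3, IsDeformationOn μ F (puncturedDisc d) Y →
      ∃ z ∈ puncturedDisc d, ∃ z' ∈ puncturedDisc d, z ≠ z' ∧ Y z = Y z' := by
  obtain ⟨Λ, hΛ, h⟩ := exists_double_point h hn hm hA hB hC hP hg hA0 hB0 hC0 hd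
  refine ⟨Λ, hΛ, fun μ hμ Y hY => ?_⟩
  obtain ⟨z, z', h1, h2, h3, h4, h5, h6, h7⟩ := h μ hμ
  obtain ⟨c, hc⟩ := hprim.exists_eq_add_const hF (isOpen_puncturedDisc d)
    (isPreconnected_puncturedDisc d) hH hY
  have hz : z ∈ puncturedDisc d := ⟨norm_pos_iff.2 h2, h4⟩
  have hz' : z' ∈ puncturedDisc d := ⟨norm_pos_iff.2 h3, h5⟩
  refine ⟨z, hz, z', hz', h1, ?_⟩
  rw [hc z hz, hc z' hz']
  congr 1
  rw [ep z hz, ep z' hz', ef z hz, ef z' hz', eq z hz, eq z' hz']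
  refine ofPrim_eq ?_ h7
  rw [div_eq_inv_mul, div_eq_inv_mul]
  exact h6

/-! ### Isometries -/

theorem exists_isometry_of_matrix (T : Matrix (Fin 3) (Fin 3) ℝ)
    (h : ∀ x : E3, ‖Matrix.toEuclideanLin T x‖ = ‖x‖) :
    ∃ A : E3 ≃ₗᵢ[ℝ] E3, (∀ x, A x = Matrix.toEuclideanLin T x) ∧
      LinearMap.det (A.toLinearEquiv : E3 →ₗ[ℝ] E3) = T.det := by
  refine ⟨LinearIsometry.toLinearIsometryEquiv ⟨Matrix.toEuclideanLin T, h⟩ rfl, fun x => rfl, ?_⟩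
  rw [← LinearMap.det_toLin (EuclideanSpace.basisFun (Fin 3) ℝ).toBasis T,
    ← Matrix.toEuclideanLin_eq_toLin_orthonormal]
  rfl

/-- Since 2(x₁ - i x₂) = p - conj q, multiplying this number by u rotates space about the vertical
axis and replaces (p, q) by (u p, conj u q). -/
theorem exists_rotation {u : ℂ} (hu : ‖u‖ = 1) :
    ∃ A : E3 ≃ₗᵢ[ℝ] E3, LinearMap.det (A.toLinearEquiv : E3 →ₗ[ℝ] E3) = 1 ∧ A e3 = e3 ∧
      ∀ p f q : ℂ, A (ofPrim p f q) = ofPrim (u * p) f (conj u * q) := by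
  have hu2 : u.re ^ 2 + u.im ^ 2 = 1 := by
    have := Complex.normSq_eq_norm_sq u
    rw [Complex.normSq_apply, hu] at this; nlinarith
  let T : Matrix (Fin 3) (Fin 3) ℝ := !![u.re, u.im, 0; -u.im, u.re, 0; 0, 0, 1]
  have t0 : ∀ x : E3, Matrix.toEuclideanLin T x 0 = u.re * x 0 + u.im * x 1 := by
    intro x; simp [T, Matrix.toEuclideanLin, Matrix.mulVec, dotProduct, Fin.sum_univ_three]
  have t1 : ∀ x : E3, Matrix.toEuclideanLin T x 1 = -u.im * x 0 + u.re * x 1 := by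
    intro x; simp [T, Matrix.toEuclideanLin, Matrix.mulVec, dotProduct, Fin.sum_univ_three]
  have t2 : ∀ x : E3, Matrix.toEuclideanLin T x 2 = x 2 := by
    intro x; simp [T, Matrix.toEuclideanLin, Matrix.mulVec, dotProduct, Fin.sum_univ_three]
  obtain ⟨A, hA, hdet⟩ := exists_isometry_of_matrix T fun x => by
    rw [← sq_eq_sq₀ (norm_nonneg _) (norm_nonneg _), norm_sq_E3, norm_sq_E3, t0, t1, t2]
    linear_combination (x 0 ^ 2 + x 1 ^ 2) * hu2
  refine ⟨A, ?_, ?_, fun p f q => ?_⟩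
  · rw [hdet, Matrix.det_fin_three]; simp [T]; linear_combination hu2
  · rw [hA]; apply ext_E3 <;> simp [t0, t1, t2]
  · rw [hA]; apply ext_E3
    · rw [t0, ofPrim_zero, ofPrim_one, ofPrim_zero]; simp; ring
    · rw [t1, ofPrim_zero, ofPrim_one, ofPrim_one]; simp; ring
    · rw [t2, ofPrim_two, ofPrim_two]

/-- The half turn about the `x₁`-axis. -/
theorem exists_halfTurn :
    ∃ A : E3 ≃ₗᵢ[ℝ] E3, LinearMap.det (A.toLinearEquiv : E3 →ₗ[ℝ] E3) = 1 ∧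
      ∀ x, A x 0 = x 0 ∧ A x 1 = -x 1 ∧ A x 2 = -x 2 := by
  let T : Matrix (Fin 3) (Fin 3) ℝ := !![1, 0, 0; 0, -1, 0; 0, 0, -1]
  have t0 : ∀ x : E3, Matrix.toEuclideanLin T x 0 = x 0 := by
    intro x; simp [T, Matrix.toEuclideanLin, Matrix.mulVec, dotProduct, Fin.sum_univ_three]
  have t1 : ∀ x : E3, Matrix.toEuclideanLin T x 1 = - x 1 := by
    intro x; simp [T, Matrix.toEuclideanLin, Matrix.mulVec, dotProduct, Fin.sum_univ_three]
  have t2 : ∀ x : E3, Matrix.toEuclideanLin T x 2 = - x 2 := by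
    intro x; simp [T, Matrix.toEuclideanLin, Matrix.mulVec, dotProduct, Fin.sum_univ_three]
  obtain ⟨A, hA, hdet⟩ := exists_isometry_of_matrix T fun x => by
    rw [← sq_eq_sq₀ (norm_nonneg _) (norm_nonneg _), norm_sq_E3, norm_sq_E3, t0, t1, t2]
    ring
  refine ⟨A, ?_, fun x => ?_⟩
  · rw [hdet, Matrix.det_fin_three]; simp [T]
  · rw [hA]; exact ⟨t0 x, t1 x, t2 x⟩

/-! ### Factoring out powers -/

/-- A solution of `(a + 1) f + z f' = z ^ n u` vanishes to order `n`. -/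
theorem exists_factor_of_ode (n : ℕ) : ∀ (a : ℕ) (f u : ℂ → ℂ), AnalyticAt ℂ f 0 →
    AnalyticAt ℂ u 0 → (∀ᶠ z in 𝓝[≠] (0 : ℂ), (a + 1) * f z + z * deriv f z = z ^ n * u z) →
    ∃ B : ℂ → ℂ, AnalyticAt ℂ B 0 ∧ (∀ᶠ z in 𝓝 (0 : ℂ), f z = z ^ n * B z) ∧
      (n + a + 1) * B 0 = u 0 := by
  induction n with
  | zero =>
    intro a f u hf hu h
    refine ⟨f, hf, by simp, ?_⟩
    have c1 : ContinuousAt (fun z => (a + 1) * f z + z * deriv f z) 0 :=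
      (continuousAt_const.mul hf.continuousAt).add (continuousAt_id.mul hf.deriv.continuousAt)
    have c2 : ContinuousAt (fun z => z ^ 0 * u z) 0 := by simpa using hu.continuousAt
    have := tendsto_nhds_unique_of_eventuallyEq (c1.mono_left nhdsWithin_le_nhds)
      (c2.mono_left (nhdsWithin_le_nhds (s := {0}ᶜ))) h
    simpa using this
  | succ n ih =>
    intro a f u hf hu h
    -- At z = 0 the equation reads (a + 1) f(0) = 0. Writing f = z f₁ and cancelling z then leaves
    -- the same equation for f₁, with a + 1 in place of a and n in place of n + 1.
    have hf0 : f 0 = 0 := by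
      have c1 : ContinuousAt (fun z => (a + 1) * f z + z * deriv f z) 0 :=
        (continuousAt_const.mul hf.continuousAt).add (continuousAt_id.mul hf.deriv.continuousAt)
      have c2 : ContinuousAt (fun z => z ^ (n + 1) * u z) 0 :=
        (continuousAt_id.pow _).mul hu.continuousAt
      have := tendsto_nhds_unique_of_eventuallyEq (c1.mono_left nhdsWithin_le_nhds)
        (c2.mono_left (nhdsWithin_le_nhds (s := {0}ᶜ))) h
      simp at this
      rcases this with h1 | h1
      · exact absurd h1 (Nat.cast_add_one_ne_zero a)
      · exact h1
    have hg : AnalyticAt ℂ (dslope f 0) 0 := by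
      obtain ⟨s, hs, hd⟩ := hf.eventually_analyticAt.exists_mem
      have : DifferentiableOn ℂ (dslope f 0) s :=
        (Complex.differentiableOn_dslope hs).2
          fun z hz => (hd z hz).differentiableAt.differentiableWithinAt
      exact this.analyticAt hs
    have hfg : ∀ z, f z = z * dslope f 0 z := by
      intro z
      have := sub_smul_dslope f 0 z
      simpa [hf0] using this.symm
    obtain ⟨B, hB, hfB, hB0⟩ := ih (a + 1) (dslope f 0) u hg hu (by
      filter_upwards [h, self_mem_nhdsWithin, nhdsWithin_le_nhds hg.eventually_analyticAt]
        with z hz hz0 han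
      have hz0' : z ≠ 0 := hz0
      have hder : deriv f z = dslope f 0 z + z * deriv (dslope f 0) z := by
        have h1 : f = fun w => w * dslope f 0 w := funext hfg
        have h2 : HasDerivAt (fun w => w * dslope f 0 w)
            (1 * dslope f 0 z + z * deriv (dslope f 0) z) z :=
          (hasDerivAt_id z).mul han.differentiableAt.hasDerivAt
        rw [one_mul] at h2
        rw [← h2.deriv, ← h1]
      rw [hder, hfg z] at hz
      apply mul_left_cancel₀ hz0'
      push_cast
      linear_combination hz)
    refine ⟨B, hB, ?_, ?_⟩
    · filter_upwards [hfB] with z hz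
      rw [hfg z, hz]; ring
    · rw [← hB0]; push_cast; ring

/-- A primitive of `z ^ n u` that vanishes at `0` is `z ^ (n + 1) B`. -/
theorem exists_factor_of_primitive {n : ℕ} {f u : ℂ → ℂ} (hf : AnalyticAt ℂ f 0)
    (hu : AnalyticAt ℂ u 0) (hf0 : f 0 = 0) (h : ∀ᶠ z in 𝓝[≠] (0 : ℂ), deriv f z = z ^ n * u z) :
    ∃ B : ℂ → ℂ, AnalyticAt ℂ B 0 ∧ (∀ᶠ z in 𝓝 (0 : ℂ), f z = z ^ (n + 1) * B z) ∧
      (n + 1) * B 0 = u 0 := by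
  have hg : AnalyticAt ℂ (dslope f 0) 0 := by
    obtain ⟨s, hs, hd⟩ := hf.eventually_analyticAt.exists_mem
    have : DifferentiableOn ℂ (dslope f 0) s :=
      (Complex.differentiableOn_dslope hs).2
        fun z hz => (hd z hz).differentiableAt.differentiableWithinAt
    exact this.analyticAt hs
  have hfg : ∀ z, f z = z * dslope f 0 z := by
    intro z
    have := sub_smul_dslope f 0 z
    simpa [hf0] using this.symm
  obtain ⟨B, hB, hfB, hB0⟩ := exists_factor_of_ode n 0 (dslope f 0) u hg hu (by
    filter_upwards [h, nhdsWithin_le_nhds hg.eventually_analyticAt] with z hz han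
    have h1 : f = fun w => w * dslope f 0 w := funext hfg
    have h2 : HasDerivAt (fun w => w * dslope f 0 w)
        (1 * dslope f 0 z + z * deriv (dslope f 0) z) z :=
      (hasDerivAt_id z).mul han.differentiableAt.hasDerivAt
    rw [← h1] at h2
    rw [← hz, h2.deriv]; simp)
  refine ⟨B, hB, ?_, by simpa using hB0⟩
  filter_upwards [hfB] with z hz
  rw [hfg z, hz]; ring

/-! ### Maximal integral curves -/
section ODE
variable {E : Type*} [NormedAddCommGroup E] [NormedSpace ℝ E]

/-- `γ` is an integral curve of `f` in `D` for times in the interval `(a, b)`. -/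
def IsSolOn (f : E → E) (D : Set E) (γ : ℝ → E) (a b : ℝ) : Prop :=
  ∀ t ∈ Ioo a b, HasDerivAt γ (f (γ t)) t ∧ γ t ∈ D

/-- The existence time ε is common to all initial points in a ball. This allows a solution to be
continued near a mere cluster point, without knowing that it converges. -/
theorem exists_flowBox [CompleteSpace E] {f : E → E} {x : E} {D : Set E} (hf : ContDiffAt ℝ 1 f x) (hD : D ∈ 𝓝 x) :
    ∃ r > (0 : ℝ), ∃ ε > (0 : ℝ), ∀ y ∈ Metric.closedBall x r, ∃ α : ℝ → E, α 0 = y ∧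
      IsSolOn f D α (-ε) ε := by
  obtain ⟨ε, hε, a, r, L, K, hr, hpl⟩ := IsPicardLindelof.of_contDiffAt_one hf
  obtain ⟨α, h1, h2⟩ := (hpl 0).exists_forall_mem_closedBall_eq_hasDerivWithinAt_continuousOn
  have hnb : Metric.closedBall x r ×ˢ Icc (0 - ε) (0 + ε) ∈ 𝓝 (x, (0 : ℝ)) :=
    prod_mem_nhds (Metric.closedBall_mem_nhds x (by exact_mod_cast hr))
      (Icc_mem_nhds (by linarith) (by linarith))
  have hc : ContinuousAt α (x, 0) := h2.continuousAt hnb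
  have hx0 : α (x, 0) = x := (h1 x (Metric.mem_closedBall_self r.2)).1
  have hev : ∀ᶠ p in 𝓝 (x, (0 : ℝ)), α p ∈ D := by
    apply hc; rw [hx0]; exact hD
  obtain ⟨ρ, hρ, hball⟩ := Metric.eventually_nhds_iff.1 (hev.and hnb)
  have key : ∀ y ∈ Metric.closedBall x (ρ / 2), ∀ t ∈ Ioo (-(ρ / 2)) (ρ / 2),
      α (y, t) ∈ D ∧ (y, t) ∈ Metric.closedBall x r ×ˢ Icc (0 - ε) (0 + ε) := by
    intro y hy t ht
    apply hball
    rw [Prod.dist_eq, max_lt_iff]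
    refine ⟨(Metric.mem_closedBall.1 hy).trans_lt (by linarith), ?_⟩
    rw [Real.dist_eq, sub_zero, abs_lt]
    exact ⟨by linarith [ht.1], by linarith [ht.2]⟩
  refine ⟨ρ / 2, by positivity, min (ρ / 2) ε, by positivity, fun y hy => ?_⟩
  have hy' : y ∈ Metric.closedBall x r := (key y hy 0 ⟨by linarith, by linarith⟩).2.1
  obtain ⟨h3, h4⟩ := h1 y hy'
  refine ⟨fun t => α (y, t), h3, fun t ht => ?_⟩
  have ht1 : t ∈ Ioo (-(ρ / 2)) (ρ / 2) :=
    ⟨by linarith [ht.1, min_le_left (ρ / 2) ε], by linarith [ht.2, min_le_left (ρ / 2) ε]⟩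
  have ht2 : -ε < t := by linarith [ht.1, min_le_right (ρ / 2) ε]
  have ht3 : t < ε := by linarith [ht.2, min_le_right (ρ / 2) ε]
  exact ⟨(h4 t ⟨by linarith, by linarith⟩).hasDerivAt
    (Icc_mem_nhds (by linarith) (by linarith)), (key y hy t ht1).1⟩

theorem IsSolOn.eqOn {f : E → E} {D : Set E} (hf : ∀ x ∈ D, ContDiffAt ℝ 1 f x)
    {γ₁ γ₂ : ℝ → E} {a b t₀ : ℝ} (h1 : IsSolOn f D γ₁ a b) (h2 : IsSolOn f D γ₂ a b)
    (ht₀ : t₀ ∈ Ioo a b) (h0 : γ₁ t₀ = γ₂ t₀) : EqOn γ₁ γ₂ (Ioo a b) := by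
  have hloc : ∀ t ∈ Ioo a b, γ₁ t = γ₂ t → γ₁ =ᶠ[𝓝 t] γ₂ := by
    intro t ht he
    obtain ⟨K, s, hs, hl⟩ := (hf _ (h1 t ht).2).exists_lipschitzOnWith
    have hI := isOpen_Ioo.mem_nhds ht
    refine ODE_solution_unique_of_eventually (v := fun _ => f) (s := fun _ => s) (K := K)
      (Eventually.of_forall fun _ => hl) ?_ ?_ he
    · filter_upwards [hI, (h1 t ht).1.continuousAt.eventually_mem hs] with w hw hws
      exact ⟨(h1 w hw).1, hws⟩
    · rw [he] at hs
      filter_upwards [hI, (h2 t ht).1.continuousAt.eventually_mem hs] with w hw hws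
      exact ⟨(h2 w hw).1, hws⟩
  -- The set of times near which the curves agree is open by definition and relatively closed by
  -- continuity together with local uniqueness.
  have hsub : Ioo a b ⊆ {t | γ₁ =ᶠ[𝓝 t] γ₂} := by
    refine isPreconnected_Ioo.subset_of_closure_inter_subset isOpen_setOfPred_eventually_nhds
      ⟨t₀, ht₀, hloc t₀ ht₀ h0⟩ ?_
    rintro t ⟨hcl, ht⟩
    apply hloc t ht
    have hfr : ∃ᶠ w in 𝓝 t, γ₁ w - γ₂ w = 0 := by
      rw [mem_closure_iff_frequently] at hcl
      exact hcl.mono fun w hw => sub_eq_zero.2 hw.self_of_nhds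
    by_contra hne
    have hc : ContinuousAt (fun w => γ₁ w - γ₂ w) t :=
      (h1 t ht).1.continuousAt.sub (h2 t ht).1.continuousAt
    exact hfr (hc.eventually_ne (sub_ne_zero.2 hne))
  exact fun t ht => (hsub ht).self_of_nhds

theorem IsSolOn.mono {f : E → E} {D : Set E} {γ : ℝ → E} {a b c d : ℝ} (h : IsSolOn f D γ a b)
    (h1 : a ≤ c) (h2 : d ≤ b) : IsSolOn f D γ c d :=
  fun t ht => h t ⟨h1.trans_lt ht.1, ht.2.trans_le h2⟩

/-- An integral curve that always has a cluster point in `D` can be continued to time `L`. -/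
theorem exists_isSolOn [CompleteSpace E] {f : E → E} {D : Set E} (hD : IsOpen D) (hf : ∀ x ∈ D, ContDiffAt ℝ 1 f x)
    {z₀ : E} (hz₀ : z₀ ∈ D) {L : ℝ} (hL : 0 < L)
    (hesc : ∀ δ > 0, ∀ T, 0 < T → T < L → ∀ γ : ℝ → E, γ 0 = z₀ → IsSolOn f D γ (-δ) T →
      ∃ x ∈ D, MapClusterPt x (𝓝[<] T) γ) :
    ∃ δ > 0, ∃ γ : ℝ → E, γ 0 = z₀ ∧ IsSolOn f D γ (-δ) L := by
  obtain ⟨r, hr, δ, hδ, hbox⟩ := exists_flowBox (hf z₀ hz₀) (hD.mem_nhds hz₀)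
  obtain ⟨α₀, hα₀, hα₀'⟩ := hbox z₀ (Metric.mem_closedBall_self hr.le)
  -- All competitors start at the same time -δ < 0. By uniqueness they agree on common intervals, so
  -- they glue to a solution up to the supremum T₀.
  set S : Set ℝ := {T | 0 < T ∧ T ≤ L ∧ ∃ γ : ℝ → E, γ 0 = z₀ ∧ IsSolOn f D γ (-δ) T} with hS
  have hSne : min δ L ∈ S :=
    ⟨lt_min hδ hL, min_le_right _ _, α₀, hα₀, hα₀'.mono le_rfl (min_le_left _ _)⟩
  have hSb : BddAbove S := ⟨L, fun T hT => hT.2.1⟩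
  set T₀ := sSup S with hT₀
  have hT₀L : T₀ ≤ L := csSup_le ⟨_, hSne⟩ fun T hT => hT.2.1
  have hT₀pos : 0 < T₀ := (lt_min hδ hL).trans_le (le_csSup hSb hSne)
  have hex : ∀ T, T ∈ S → ∃ γ : ℝ → E, γ 0 = z₀ ∧ IsSolOn f D γ (-δ) T := fun T hT => hT.2.2
  choose! G hG0 hG using hex
  have hc : ∀ t, t < T₀ → ∃ T ∈ S, t < T := fun t ht => exists_lt_of_lt_csSup ⟨_, hSne⟩ ht
  choose! c hcS hc using hc
  set γ : ℝ → E := fun t => G (c t) t with hγ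
  have hglue : ∀ T ∈ S, ∀ t ∈ Ioo (-δ) T, γ t = G T t := by
    intro T hT t ht
    have ht0 : t < T₀ := ht.2.trans_le (le_csSup hSb hT)
    have hcS' := hcS t ht0
    have hm : 0 < min (c t) T := lt_min hcS'.1 hT.1
    exact ((hG _ hcS').mono le_rfl (min_le_left _ T)).eqOn hf
      ((hG T hT).mono le_rfl (min_le_right _ _)) (t₀ := 0) ⟨by linarith, hm⟩
      (by rw [hG0 _ hcS', hG0 T hT]) ⟨ht.1, lt_min (hc t ht0) ht.2⟩
  have hγsol : IsSolOn f D γ (-δ) T₀ := by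
    intro t ht
    have hcS' := hcS t ht.2
    have htc : t ∈ Ioo (-δ) (c t) := ⟨ht.1, hc t ht.2⟩
    have he : γ =ᶠ[𝓝 t] G (c t) := by
      filter_upwards [isOpen_Ioo.mem_nhds htc] with w hw using hglue _ hcS' w hw
    obtain ⟨d1, d2⟩ := hG _ hcS' t htc
    rw [he.self_of_nhds]
    exact ⟨d1.congr_of_eventuallyEq he, d2⟩
  have hγ0 : γ 0 = z₀ := by
    rw [hglue _ hSne 0 ⟨by linarith, hSne.1⟩, hG0 _ hSne]
  rcases hT₀L.eq_or_lt with hTL | hTL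
  · rw [hTL] at hγsol; exact ⟨δ, hδ, γ, hγ0, hγsol⟩
  exfalso
  obtain ⟨x, hxD, hx⟩ := hesc δ hδ T₀ hT₀pos hTL γ hγ0 hγsol
  -- If T₀ < L, some time t₁ within ε/2 of T₀ has its point in the flow box around the cluster
  -- point. Restarting there with existence time ε passes T₀, a contradiction.
  obtain ⟨r', hr', ε, hε, hbox'⟩ := exists_flowBox (hf x hxD) (hD.mem_nhds hxD)
  have hnear : ∀ᶠ t in 𝓝[<] T₀, max 0 (T₀ - ε / 2) < t ∧ t < T₀ := by
    have hlt : max 0 (T₀ - ε / 2) < T₀ := max_lt hT₀pos (by linarith)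
    exact Ioo_mem_nhdsLT hlt
  obtain ⟨t₁, ht₁, ht₁'⟩ :=
    ((hx.frequently (Metric.closedBall_mem_nhds x hr')).and_eventually hnear).exists
  obtain ⟨ht₁0, ht₁T⟩ := ht₁'
  have ht₁pos : 0 < t₁ := (le_max_left _ _).trans_lt ht₁0
  have ht₁ε : T₀ - ε / 2 < t₁ := (le_max_right _ _).trans_lt ht₁0
  obtain ⟨α, hα0, hα⟩ := hbox' _ ht₁
  set β : ℝ → E := fun t => α (t - t₁) with hβ
  have hβsol : IsSolOn f D β (t₁ - ε) (t₁ + ε) := by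
    intro t ht
    obtain ⟨e1, e2⟩ := hα (t - t₁) ⟨by linarith [ht.1], by linarith [ht.2]⟩
    exact ⟨e1.comp_sub_const t t₁, e2⟩
  set a' := max (-δ) (t₁ - ε) with ha'
  have ha't : a' < t₁ := max_lt (by linarith) (by linarith)
  have heq : EqOn γ β (Ioo a' T₀) :=
    (hγsol.mono (le_max_left _ _) le_rfl).eqOn hf
      (hβsol.mono (le_max_right _ _) (by linarith)) (t₀ := t₁) ⟨ha't, ht₁T⟩
      (by simp [hβ, hα0])
  have hnew : min (t₁ + ε) L ∈ S := by
    refine ⟨lt_min (by linarith) hL, min_le_right _ _, fun t => if t < T₀ then γ t else β t, ?_, ?_⟩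
    · simp [hT₀pos, hγ0]
    · intro t ht
      by_cases htT : t < T₀
      · have he : (fun t => if t < T₀ then γ t else β t) =ᶠ[𝓝 t] γ := by
          filter_upwards [isOpen_Iio.mem_nhds htT] with w hw
          exact if_pos hw
        obtain ⟨d1, d2⟩ := hγsol t ⟨ht.1, htT⟩
        rw [he.self_of_nhds]
        exact ⟨d1.congr_of_eventuallyEq he, d2⟩
      · have hat : a' < t := ha't.trans (ht₁T.trans_le (not_lt.1 htT))
        have he : (fun t => if t < T₀ then γ t else β t) =ᶠ[𝓝 t] β := by
          filter_upwards [isOpen_Ioi.mem_nhds hat] with w hw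
          by_cases hwT : w < T₀
          · rw [if_pos hwT]; exact heq ⟨hw, hwT⟩
          · exact if_neg hwT
        obtain ⟨d1, d2⟩ := hβsol t ⟨by linarith [le_max_right (-δ) (t₁ - ε)],
          ht.2.trans_le (min_le_left _ _)⟩
        rw [he.self_of_nhds]
        exact ⟨d1.congr_of_eventuallyEq he, d2⟩
  have := le_csSup hSb hnew
  rw [← hT₀] at this
  exact absurd this (not_le.2 (lt_min (by linarith) hTL))

end ODE

/-! ### The height of a complete end with vertical limit normal -/

theorem norm_le_of_coord_le {v : E3} {c : ℝ} (hc : 0 ≤ c) (h : ∀ j, |v j| ≤ c) : ‖v‖ ≤ 2 * c := by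
  have hs : ∀ j, v j ^ 2 ≤ c ^ 2 := fun j => by
    rw [← sq_abs]; exact pow_le_pow_left₀ (abs_nonneg _) (h j) 2
  rw [← sq_le_sq₀ (norm_nonneg _) (by positivity), norm_sq_E3]
  nlinarith [hs 0, hs 1, hs 2]

theorem IsCompleteAtPuncture.mono {F : ℂ → E3} {ε ε' : ℝ} (h : IsCompleteAtPuncture F ε)
    (hε : ε' ≤ ε) : IsCompleteAtPuncture F ε' :=
  fun γ h1 h2 h3 => h γ h1 (fun _ ht => ⟨(h2 ht).1, (h2 ht).2.trans_le hε⟩) h3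

theorem puncturedDisc_mono {ε ε' : ℝ} (hε : ε' ≤ ε) : puncturedDisc ε' ⊆ puncturedDisc ε :=
  fun _ hz => ⟨hz.1, hz.2.trans_le hε⟩

/-- The velocity of the image of a curve. -/
theorem hasDerivAt_comp_curve {F : ℂ → E3} {γ : ℝ → ℂ} {t : ℝ} {v : ℂ}
    (hF : DifferentiableAt ℝ F (γ t)) (hγ : HasDerivAt γ v t) :
    HasDerivAt (fun s => F (γ s)) (fderiv ℝ F (γ t) v) t :=
  hF.hasFDerivAt.comp_hasDerivAt t hγ

/-- A curve along which the velocity of its image is bounded does not reach the puncture in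
finite time. -/
theorem IsCompleteAtPuncture.not_tendsto {F : ℂ → E3} {ε : ℝ} (h : IsCompleteAtPuncture F ε)
    {γ γ' : ℝ → ℂ} {δ T c : ℝ} (hδ : 0 < δ) (hT : 0 < T)
    (hd : ∀ t ∈ Ioo (-δ) T, HasDerivAt γ (γ' t) t) (hc : ContinuousOn γ' (Ioo (-δ) T))
    (hm : ∀ t ∈ Ioo (-δ) T, γ t ∈ puncturedDisc ε)
    (hF : ∀ z ∈ puncturedDisc ε, DifferentiableAt ℝ F z)
    (hb : ∀ t ∈ Ioo (-δ) T, ‖fderiv ℝ F (γ t) (γ' t)‖ ≤ c) : ¬ Tendsto γ (𝓝[<] T) (𝓝 0) := by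
  intro hlim
  -- Rescaling time by T puts the curve on the unit interval used in the completeness condition; its
  -- length is then at most T c.
  have hmaps : MapsTo (fun s : ℝ => T * s) (Ico 0 1) (Ioo (-δ) T) := fun s hs => by
    have h1 : 0 ≤ T * s := mul_nonneg hT.le hs.1
    have h2 : T * s < T := by nlinarith [hs.2]
    exact ⟨by linarith, h2⟩
  have hcd : ContDiffOn ℝ 1 γ (Ioo (-δ) T) := by
    rw [show (1 : WithTop ℕ∞) = 0 + 1 by simp, contDiffOn_succ_iff_deriv_of_isOpen isOpen_Ioo]
    refine ⟨fun t ht => (hd t ht).differentiableAt.differentiableWithinAt, by simp, ?_⟩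
    exact contDiffOn_zero.2 (hc.congr fun t ht => (hd t ht).deriv)
  have hlen := h (fun s => γ (T * s))
    (hcd.comp (contDiff_const.mul contDiff_id).contDiffOn hmaps)
    (fun s hs => hm _ (hmaps hs)) (by
      refine hlim.comp (tendsto_nhdsWithin_iff.2 ⟨?_, ?_⟩)
      · have : ContinuousAt (fun s : ℝ => T * s) 1 := by fun_prop
        have h1 := this.tendsto
        rw [mul_one] at h1
        exact h1.mono_left nhdsWithin_le_nhds
      · filter_upwards [self_mem_nhdsWithin] with s hs
        have : s < 1 := hs
        show T * s < T
        nlinarith)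
  have hle : ∫⁻ s in Ioo (0 : ℝ) 1, ‖deriv (F ∘ fun s => γ (T * s)) s‖ₑ
      ≤ ∫⁻ _ in Ioo (0 : ℝ) 1, ENNReal.ofReal (T * c) := by
    refine setLIntegral_mono' measurableSet_Ioo fun s hs => ?_
    have hs' := hmaps ⟨hs.1.le, hs.2⟩
    have h1 : HasDerivAt (fun s => γ (T * s)) (T • γ' (T * s)) s := by
      have := (hd _ hs').scomp s ((hasDerivAt_id s).const_mul T)
      rw [mul_one] at this
      exact this
    have h2 := hasDerivAt_comp_curve (F := F) (γ := fun s => γ (T * s)) (t := s) (hF _ (hm _ hs')) h1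
    have h3 : deriv (F ∘ fun s => γ (T * s)) s = T • fderiv ℝ F (γ (T * s)) (γ' (T * s)) := by
      rw [← map_smul]; exact h2.deriv
    rw [h3, ← ofReal_norm, norm_smul, Real.norm_of_nonneg hT.le]
    exact ENNReal.ofReal_le_ofReal (mul_le_mul_of_nonneg_left (hb _ hs') hT.le)
  rw [hlen] at hle
  simp at hle

/-- A multiple of `1 / P` moves the surface with velocity `((1 - g²) / 2, i (1 + g²) / 2, g)`. -/
theorem fderiv_inv_wP {F : ℂ → E3} {z : ℂ} (h : ConfAt F z) (hP : wP F z ≠ 0) :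
    fderiv ℝ F z (wP F z)⁻¹ = ofPrim 1 (wH F z / wP F z) ((wH F z / wP F z) ^ 2) := by
  have hn := h.null
  have hQ : wQ F z * (wP F z)⁻¹ = (wH F z / wP F z) ^ 2 := by
    field_simp; linear_combination hn
  have hPP : wP F z * (wP F z)⁻¹ = 1 := mul_inv_cancel₀ hP
  apply ext_E3 <;> rw [fderiv_apply_re, complexVelocity_eq_formVec]
  · change ((wP F z - wQ F z) / 2 * (wP F z)⁻¹).re = ((1 - (wH F z / wP F z) ^ 2) / 2).re
    congr 1; linear_combination hPP / 2 - hQ / 2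
  · change (Complex.I * (wP F z + wQ F z) / 2 * (wP F z)⁻¹).re
      = (Complex.I * (1 + (wH F z / wP F z) ^ 2) / 2).re
    congr 1; linear_combination Complex.I * hPP / 2 + Complex.I * hQ / 2
  · rfl

theorem abs_le_of_hasDerivAt_le {y y' : ℝ → ℝ} {t δ : ℝ} (ht : 0 ≤ t)
    (hy : ∀ s ∈ Icc 0 t, HasDerivAt y (y' s) s) (hb : ∀ s ∈ Icc 0 t, |y' s| ≤ δ) :
    |y t - y 0| ≤ δ * t := by
  have := (convex_Icc 0 t).norm_image_sub_le_of_norm_hasDerivWithin_le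
    (fun s hs => (hy s hs).hasDerivWithinAt) hb (left_mem_Icc.2 ht) (right_mem_Icc.2 ht)
  simpa [abs_of_nonneg ht] using this

/-- If the normal of a complete end tends to the vertical direction and the end has bounded height
outside of a vertical solid cylinder, then it has bounded height. -/
theorem exists_height_bound {F : ℂ → E3} {ε : ℝ} (hε : 0 < ε)
    (hF : IsWeierstrassOn F (puncturedDisc ε)) (hP : ∀ z ∈ puncturedDisc ε, wP F z ≠ 0)
    (hcomp : IsCompleteAtPuncture F ε)
    (hg : Tendsto (fun z => wH F z / wP F z) (𝓝[≠] 0) (𝓝 0)) {R C : ℝ}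
    (hgrowth : ∀ᶠ z in 𝓝[≠] (0 : ℂ), R < rho (F z) → |F z 2| ≤ C) :
    ∃ M, ∀ᶠ z in 𝓝[≠] (0 : ℂ), |F z 2| ≤ M := by
  set R' := max R 0 with hR'
  have hR'0 : 0 ≤ R' := le_max_right _ _
  -- The curves below move with x₁-velocity at least 1/4, so time 8R' + 4 < L carries them from -R'
  -- beyond R'. Requiring |g| ≤ 1/L keeps the change of height over time L at most 1.
  set L := 8 * R' + 8 with hL
  have hLpos : 0 < L := by positivity
  have hgs : ∀ᶠ z in 𝓝[≠] (0 : ℂ), ‖wH F z / wP F z‖ ≤ 1 / L := by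
    have : ∀ᶠ z in 𝓝[≠] (0 : ℂ), ‖wH F z / wP F z‖ < 1 / L :=
      (hg.norm.eventually (gt_mem_nhds (by rw [norm_zero]; positivity)))
    exact this.mono fun z hz => hz.le
  obtain ⟨d, hd, hdP⟩ := exists_puncturedDisc_of_eventually (hgs.and hgrowth)
  set ε₀ := min (d / 2) (ε / 2) with hε₀
  have hε₀pos : 0 < ε₀ := by positivity
  have hε₀ε : ε₀ < ε := (min_le_right _ _).trans_lt (by linarith)
  have hε₀d : ε₀ < d := (min_le_left _ _).trans_lt (by linarith)
  have hFd : ∀ z ∈ puncturedDisc ε, DifferentiableAt ℝ F z := fun z hz =>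
    hF.differentiableAt (isOpen_puncturedDisc ε) hz
  have hF2 : ∀ z ∈ puncturedDisc ε, ContinuousAt (fun w => |F w 2|) z := fun z hz => by
    have h1 := (hFd z hz).continuousAt
    have h2 : ContinuousAt (fun w => F w 2) z :=
      (EuclideanSpace.proj (𝕜 := ℝ) (2 : Fin 3)).continuous.continuousAt.comp h1
    exact h2.abs
  obtain ⟨M₀, hM₀⟩ : ∃ M₀, ∀ z : ℂ, ‖z‖ = ε₀ → |F z 2| ≤ M₀ := by
    have hK : IsCompact (Metric.sphere (0 : ℂ) ε₀) := isCompact_sphere _ _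
    obtain ⟨M₀, hM₀⟩ := hK.bddAbove_image (f := fun w => |F w 2|) (fun z hz => by
      have : ‖z‖ = ε₀ := by simpa using hz
      exact (hF2 z ⟨by rw [this]; exact hε₀pos, by rw [this]; exact hε₀ε⟩).continuousWithinAt)
    exact ⟨M₀, fun z hz => hM₀ ⟨z, by simpa using hz, rfl⟩⟩
  refine ⟨max M₀ C + 1, ?_⟩
  filter_upwards [puncturedDisc_mem_nhdsNE hε₀pos] with z₀ hz₀
  by_contra hcon
  rw [not_le] at hcon
  have hbig1 : M₀ + 1 < |F z₀ 2| := by linarith [le_max_left M₀ C]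
  have hbig2 : C + 1 < |F z₀ 2| := by linarith [le_max_right M₀ C]
  have hsub : puncturedDisc ε₀ ⊆ puncturedDisc ε := puncturedDisc_mono hε₀ε.le
  have hsubd : puncturedDisc ε₀ ⊆ puncturedDisc d := puncturedDisc_mono hε₀d.le
  have hrho : rho (F z₀) ≤ R' := by
    by_contra hr
    rw [not_le] at hr
    have := (hdP z₀ (hsubd hz₀)).2 ((le_max_left _ _).trans_lt hr)
    linarith
  -- Along z' = 1 / P the image moves with velocity ((1 - g²)/2, i(1 + g²)/2, g), real parts taken:
  -- nearly half the first unit vector when g is small.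
  have hf : ∀ x ∈ puncturedDisc ε₀, ContDiffAt ℝ 1 (fun z => (wP F z)⁻¹) x := fun x hx => by
    have h1 : DifferentiableOn ℂ (fun z => (wP F z)⁻¹) (puncturedDisc ε) := hF.holP.inv hP
    exact ((h1.contDiffOn (n := 1) (isOpen_puncturedDisc ε)).contDiffAt
      ((isOpen_puncturedDisc ε).mem_nhds (hsub hx))).restrict_scalars ℝ
  -- the velocity of the lifted curves
  have hvel : ∀ {γ : ℝ → ℂ} {δ T : ℝ},
      IsSolOn (fun z => (wP F z)⁻¹) (puncturedDisc ε₀) γ (-δ) T → ∀ t ∈ Ioo (-δ) T, ∀ j,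
      HasDerivAt (fun s => F (γ s) j) (ofPrim 1 (wH F (γ t) / wP F (γ t))
        ((wH F (γ t) / wP F (γ t)) ^ 2) j) t := by
    intro γ δ T hγ t ht j
    obtain ⟨h1, h2⟩ := hγ t ht
    have h3 := hasDerivAt_comp_curve (F := F) (hFd _ (hsub h2)) h1
    rw [fderiv_inv_wP (hF.conf _ (hsub h2)) (hP _ (hsub h2))] at h3
    exact (EuclideanSpace.proj (𝕜 := ℝ) j).hasFDerivAt.comp_hasDerivAt t h3
  have hL8 : 1 / L ≤ 1 / 8 := one_div_le_one_div_of_le (by norm_num) (by linarith)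
  have hgnorm : ∀ z ∈ puncturedDisc ε₀, ‖(wH F z / wP F z) ^ 2‖ ≤ 1 / 8 := fun z hz => by
    have h1 := (hdP z (hsubd hz)).1
    rw [norm_pow]
    have h0 := norm_nonneg (wH F z / wP F z)
    nlinarith
  have hheight : ∀ {γ : ℝ → ℂ} {δ T : ℝ}, 0 < δ → γ 0 = z₀ → T ≤ L →
      IsSolOn (fun z => (wP F z)⁻¹) (puncturedDisc ε₀) γ (-δ) T → ∀ t ∈ Ico 0 T,
      |F z₀ 2| - 1 ≤ |F (γ t) 2| := by
    intro γ δ T hδ h0 hTL hγ t ht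
    have h1 := abs_le_of_hasDerivAt_le (y := fun s => F (γ s) 2) (δ := 1 / L) ht.1
      (fun s hs => hvel hγ s ⟨by linarith [hs.1], hs.2.trans_lt ht.2⟩ 2)
      (fun s hs => by
        rw [ofPrim_two]
        exact (Complex.abs_re_le_norm _).trans
          (hdP _ (hsubd (hγ s ⟨by linarith [hs.1], hs.2.trans_lt ht.2⟩).2)).1)
    rw [h0] at h1
    have h2 : 1 / L * t ≤ 1 := by
      rw [one_div, inv_mul_le_iff₀ hLpos, mul_one]; linarith [ht.2]
    have h3 := abs_sub_abs_le_abs_sub (F z₀ 2) (F (γ t) 2)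
    rw [abs_sub_comm] at h3
    linarith
  obtain ⟨δ, hδ, γ, hγ0, hγ⟩ := exists_isSolOn (isOpen_puncturedDisc ε₀) hf hz₀ hLpos (by
    intro δ hδ T hT hTL γ hγ0 hγ
    -- Without a cluster point in the punctured disc, the curve can accumulate only at the puncture
    -- or on the circle of radius ε₀. On the circle the height is at most M₀, too small; convergence
    -- to the puncture in finite time contradicts completeness.
    by_contra hno
    have hin : ∀ᶠ t in 𝓝[<] T, t ∈ Ioo 0 T := Ioo_mem_nhdsLT hT
    have hlim : Tendsto γ (𝓝[<] T) (𝓝 0) := by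
      refine (isCompact_closedBall (0 : ℂ) ε₀).tendsto_nhds_of_unique_mapClusterPt ?_ ?_
      · filter_upwards [hin] with t ht
        have := (hγ t ⟨by linarith [ht.1], ht.2⟩).2.2
        simpa using this.le
      · intro w hw hcl
        by_contra hw0
        have hwn : ‖w‖ ≤ ε₀ := by simpa using hw
        have hwpos : 0 < ‖w‖ := norm_pos_iff.2 hw0
        rcases hwn.lt_or_eq with hlt | heq
        · exact hno ⟨w, ⟨hwpos, hlt⟩, hcl⟩
        · have hwM := hM₀ w heq
          have hcw := hF2 w ⟨hwpos, heq ▸ hε₀ε⟩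
          have hlt : ∀ᶠ z in 𝓝 w, |F z 2| < |F z₀ 2| - 1 :=
            hcw.eventually (gt_mem_nhds (by linarith))
          obtain ⟨t, ht1, ht2⟩ := ((hcl.frequently hlt).and_eventually hin).exists
          have := hheight hδ hγ0 hTL.le hγ t ⟨ht2.1.le, ht2.2⟩
          linarith
    refine (hcomp.mono hε₀ε.le).not_tendsto (γ' := fun t => (wP F (γ t))⁻¹) (c := 2 * 1) hδ hT
      (fun t ht => (hγ t ht).1) ?_ (fun t ht => (hγ t ht).2) (fun z hz => hFd z (hsub hz)) ?_ hlim
    · intro t ht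
      exact ((hf _ (hγ t ht).2).continuousAt.comp
        (hγ t ht).1.continuousAt).continuousWithinAt
    · intro t ht
      have hz := (hγ t ht).2
      rw [fderiv_inv_wP (hF.conf _ (hsub hz)) (hP _ (hsub hz))]
      have hg2 := hgnorm _ hz
      have hre := (Complex.abs_re_le_norm ((wH F (γ t) / wP F (γ t)) ^ 2)).trans hg2
      have him := (Complex.abs_im_le_norm ((wH F (γ t) / wP F (γ t)) ^ 2)).trans hg2
      have hre' := abs_le.1 hre
      have him' := abs_le.1 him
      refine norm_le_of_coord_le zero_le_one fun j => ?_
      fin_cases j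
      · change |ofPrim _ _ _ 0| ≤ 1
        rw [ofPrim_zero, Complex.one_re, abs_le]; constructor <;> linarith
      · change |ofPrim _ _ _ 1| ≤ 1
        rw [ofPrim_one, Complex.one_im, abs_le]; constructor <;> linarith
      · change |ofPrim _ _ _ 2| ≤ 1
        rw [ofPrim_two]
        exact (Complex.abs_re_le_norm _).trans (by linarith [(hdP _ (hsubd hz)).1]))
  -- the lifted curve leaves the cylinder
  set t₁ := 8 * R' + 4 with ht₁
  have ht₁0 : 0 ≤ t₁ := by positivity
  have ht₁L : t₁ < L := by rw [ht₁, hL]; linarith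
  have hx0 : 1 / 4 * (t₁ - 0) ≤ F (γ t₁) 0 - F (γ 0) 0 := by
    refine (convex_Icc 0 t₁).mul_sub_le_image_sub_of_le_deriv (f := fun s => F (γ s) 0)
      (fun s hs => ?_) (fun s hs => ?_) (fun s hs => ?_) 0 (left_mem_Icc.2 ht₁0) t₁
      (right_mem_Icc.2 ht₁0) ht₁0
    · exact (hvel hγ s ⟨by linarith [hs.1], hs.2.trans_lt ht₁L⟩ 0).continuousAt.continuousWithinAt
    · rw [interior_Icc] at hs
      exact (hvel hγ s ⟨by linarith [hs.1], hs.2.trans ht₁L⟩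
        0).differentiableAt.differentiableWithinAt
    · rw [interior_Icc] at hs
      have hs' : s ∈ Ioo (-δ) L := ⟨by linarith [hs.1], hs.2.trans ht₁L⟩
      rw [(hvel hγ s hs' 0).deriv, ofPrim_zero, Complex.one_re]
      have := (Complex.re_le_norm ((wH F (γ s) / wP F (γ s)) ^ 2)).trans
        (hgnorm _ (hγ s hs').2)
      linarith
  have habs : ∀ x : E3, |x 0| ≤ rho x := fun x => by
    rw [rho, ← Real.sqrt_sq_eq_abs]
    exact Real.sqrt_le_sqrt (by nlinarith [sq_nonneg (x 1)])
  -- At the start x₁ ≥ -R', so at time t₁ one has x₁ ≥ R' + 1. There the growth hypothesis bounds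
  -- the height by C, whereas it has changed by at most 1 from a value above C + 1.
  have h0 := abs_le.1 ((habs (F z₀)).trans hrho)
  rw [hγ0] at hx0
  have hbig : R' < rho (F (γ t₁)) := by
    have := (le_abs_self _).trans (habs (F (γ t₁)))
    linarith [h0.1]
  have hz₁ := (hγ t₁ ⟨by linarith, ht₁L⟩).2
  have h1 := (hdP _ (hsubd hz₁)).2 ((le_max_left _ _).trans_lt hbig)
  have h2 := hheight hδ hγ0 le_rfl hγ t₁ ⟨ht₁0, ht₁L⟩
  linarith

/-! ### The Weierstrass data at a complete end of bounded height -/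

/-- The Gauss map of an end with limit normal `-e3` tends to `0`. -/
theorem tendsto_gauss {F : ℂ → E3} {ε : ℝ} (hε : 0 < ε)
    (hF : IsWeierstrassOn F (puncturedDisc ε))
    (hlim : Tendsto (unitNormal F) (𝓝[≠] 0) (𝓝 (-e3))) :
    (∀ᶠ z in 𝓝[≠] (0 : ℂ), wP F z ≠ 0) ∧ Tendsto (fun z => wH F z / wP F z) (𝓝[≠] 0) (𝓝 0) := by
  have hc : ∀ j : Fin 3, Tendsto (fun z => unitNormal F z j) (𝓝[≠] 0) (𝓝 ((-e3) j)) := fun j =>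
    ((EuclideanSpace.proj (𝕜 := ℝ) j).continuous.tendsto _).comp hlim
  have hn2 : ∀ᶠ z in 𝓝[≠] (0 : ℂ), unitNormal F z 2 < 1 :=
    (hc 2).eventually (gt_mem_nhds (by simp))
  have hdisc := puncturedDisc_mem_nhdsNE hε
  refine ⟨?_, ?_⟩
  · filter_upwards [hn2, hdisc] with z hz hz'
    exact wP_ne_zero (hF.conf z hz') hz.ne
  · have h1 : Tendsto (fun z => stereo (unitNormal F z)) (𝓝[≠] 0)
        (𝓝 ((((-e3 : E3) 0 : ℝ) + Complex.I * ((-e3 : E3) 1 : ℝ)) / (1 - ((-e3 : E3) 2 : ℝ)))) := by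
      have hcc : ∀ j : Fin 3, Tendsto (fun z => ((unitNormal F z j : ℝ) : ℂ)) (𝓝[≠] 0)
          (𝓝 (((-e3 : E3) j : ℝ) : ℂ)) := fun j =>
        (Complex.continuous_ofReal.tendsto _).comp (hc j)
      refine ((hcc 0).add (tendsto_const_nhds.mul (hcc 1))).div (tendsto_const_nhds.sub (hcc 2)) ?_
      simp
    have h2 : ((((-e3 : E3) 0 : ℝ) + Complex.I * ((-e3 : E3) 1 : ℝ)) / (1 - ((-e3 : E3) 2 : ℝ)) : ℂ)
        = 0 := by simp
    rw [h2] at h1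
    refine h1.congr' ?_
    filter_upwards [hdisc] with z hz
    exact stereo_unitNormal (hF.conf z hz)

/-- A holomorphic function on a punctured neighbourhood with limit `0` that is not identically
zero has a zero of finite positive order. -/
theorem exists_order_of_tendsto_zero {g : ℂ → ℂ} (hd : ∀ᶠ z in 𝓝[≠] (0 : ℂ), DifferentiableAt ℂ g z)
    (hlim : Tendsto g (𝓝[≠] 0) (𝓝 0)) (hne : ¬ ∀ᶠ z in 𝓝[≠] (0 : ℂ), g z = 0) :
    ∃ (k : ℕ) (h : ℂ → ℂ), 1 ≤ k ∧ AnalyticAt ℂ h 0 ∧ h 0 ≠ 0 ∧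
      ∀ᶠ z in 𝓝[≠] (0 : ℂ), g z = z ^ k * h z := by
  set G := Function.update g 0 0 with hG
  have he : ∀ᶠ z in 𝓝[≠] (0 : ℂ), G z = g z := by
    filter_upwards [self_mem_nhdsWithin] with z hz using Function.update_of_ne hz _ _
  have han : AnalyticAt ℂ G 0 := by
    refine Complex.analyticAt_of_differentiable_on_punctured_nhds_of_continuousAt ?_ ?_
    · filter_upwards [hd, self_mem_nhdsWithin] with z hz hz0
      refine hz.congr_of_eventuallyEq ?_
      filter_upwards [isOpen_compl_singleton.mem_nhds hz0] with w hw
      exact Function.update_of_ne hw _ _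
    · exact continuousAt_update_same.2 hlim
  have hne' : ¬ ∀ᶠ z in 𝓝 (0 : ℂ), G z = 0 := fun h => hne (by
    filter_upwards [he, nhdsWithin_le_nhds h] with z h1 h2
    rw [← h1, h2])
  obtain ⟨k, h, h1, h2, h3⟩ := han.exists_eventuallyEq_pow_smul_nonzero_iff.2 hne'
  refine ⟨k, h, ?_, h1, h2, ?_⟩
  · by_contra hk
    have hk0 : k = 0 := by omega
    have := h3.self_of_nhds
    rw [hk0] at this
    simp [hG] at this
    exact h2 this.symm
  · filter_upwards [he, nhdsWithin_le_nhds h3] with z e1 e2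
    rw [← e1, e2]; simp

/-- The differential of the height. -/
theorem hasFDerivAt_height {F : ℂ → E3} {z : ℂ} (h : DifferentiableAt ℝ F z) :
    HasFDerivAt (fun w => F w 2) (Complex.reCLM ∘L
      (ContinuousLinearMap.toSpanSingleton ℂ (wH F z)).restrictScalars ℝ) z := by
  have h1 := (EuclideanSpace.proj (𝕜 := ℝ) (2 : Fin 3)).hasFDerivAt.comp z h.hasFDerivAt
  refine h1.congr_fderiv ?_
  ext v
  change fderiv ℝ F z v 2 = _
  rw [fderiv_apply_re]
  simp [wH, mul_comm]

theorem hasFDerivAt_re {f : ℂ → ℂ} {z a : ℂ} (h : HasDerivAt f a z) :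
    HasFDerivAt (fun w => (f w).re) (Complex.reCLM ∘L
      (ContinuousLinearMap.toSpanSingleton ℂ a).restrictScalars ℝ) z :=
  Complex.reCLM.hasFDerivAt.comp z (h.hasFDerivAt.restrictScalars ℝ)

/-- Gradient estimate: the height differential is `O(1 / |z|)` if the height is bounded. -/
theorem norm_wH_le {F : ℂ → E3} {ε M : ℝ} (hF : IsWeierstrassOn F (puncturedDisc ε))
    (hM : ∀ z ∈ puncturedDisc ε, |F z 2| ≤ M) {z : ℂ} (hz : z ∈ puncturedDisc (ε / 2)) :
    ‖wH F z‖ * ‖z‖ ≤ 2 * Real.exp M * Real.exp M := by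
  have hzpos := hz.1
  have hball : Metric.ball z ‖z‖ ⊆ puncturedDisc ε := fun w hw => by
    rw [Metric.mem_ball, dist_eq_norm] at hw
    constructor
    · rw [norm_pos_iff]; rintro rfl; simp at hw
    · have := norm_le_norm_add_norm_sub' w z
      linarith [hz.2]
  obtain ⟨f, hfz, hf⟩ := ((hF.holH.mono hball).isExactOn_ball).with_val_at z (F z 2 : ℂ)
  have hre : ∀ w ∈ Metric.ball z ‖z‖, (f w).re = F w 2 := by
    have hd : ∀ w ∈ Metric.ball z ‖z‖, HasFDerivAt (fun w => F w 2 - (f w).re)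
        (0 : ℂ →L[ℝ] ℝ) w := fun w hw => by
      have := (hasFDerivAt_height (hF.differentiableAt (isOpen_puncturedDisc ε) (hball hw))).sub
        (hasFDerivAt_re (hf w hw))
      rwa [sub_self] at this
    intro w hw
    have := (convex_ball z ‖z‖).is_const_of_fderivWithin_eq_zero (𝕜 := ℝ)
      (fun w hw => (hd w hw).differentiableAt.differentiableWithinAt)
      (fun w hw => by
        rw [fderivWithin_of_isOpen Metric.isOpen_ball hw, (hd w hw).fderiv])
      hw (Metric.mem_ball_self hzpos)
    simp [hfz] at this
    linarith
  -- The Cauchy estimate is applied to exp f, whose modulus e^(x₃) is controlled by the height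
  -- alone, whatever the conjugate function does.
  have hnorm : ∀ w ∈ Metric.ball z ‖z‖, ‖Complex.exp (f w)‖ = Real.exp (F w 2) := fun w hw => by
    rw [Complex.norm_exp, hre w hw]
  have hcb : Metric.closedBall z (‖z‖ / 2) ⊆ Metric.ball z ‖z‖ :=
    Metric.closedBall_subset_ball (by linarith)
  have hdiff : DifferentiableOn ℂ (fun w => Complex.exp (f w)) (Metric.ball z ‖z‖) :=
    fun w hw => (hf w hw).cexp.differentiableAt.differentiableWithinAt
  have hC := Complex.norm_deriv_le_of_forall_mem_sphere_norm_le (half_pos hzpos)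
    (hdiff.diffContOnCl_ball hcb) (C := Real.exp M) (fun w hw => by
      have hw' := hcb (Metric.sphere_subset_closedBall hw)
      rw [hnorm w hw']
      exact Real.exp_le_exp.2 ((le_abs_self _).trans (hM w (hball hw'))))
  have hzb := Metric.mem_ball_self (x := z) hzpos
  rw [(hf z hzb).cexp.deriv, norm_mul, hnorm z hzb, le_div_iff₀ (half_pos hzpos)] at hC
  -- Since |exp f| ≥ e^(-M), the bound on (exp f)' = exp(f) H passes to H.
  have hlow : 1 ≤ Real.exp (F z 2) * Real.exp M := by
    rw [← Real.exp_add]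
    apply Real.one_le_exp
    linarith [neg_le_of_abs_le (hM z (hball hzb))]
  have h0 : 0 ≤ ‖wH F z‖ * ‖z‖ := by positivity
  have hE := Real.exp_pos M
  nlinarith

/-- A function on the logarithmic half plane. -/
theorem eq_zero_of_height_log {D : ℂ → ℝ} {c : ℂ} {r M : ℝ} (hr : 0 < r)
    (hD : ∀ z ∈ puncturedDisc r, HasFDerivAt D (Complex.reCLM ∘L
      (ContinuousLinearMap.toSpanSingleton ℂ (c / z)).restrictScalars ℝ) z)
    (hb : ∀ z ∈ puncturedDisc r, |D z| ≤ M) : c = 0 := by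
  set S : Set ℂ := {s | s.re < Real.log r} with hS
  have hSo : IsOpen S := isOpen_lt Complex.continuous_re continuous_const
  have hSc : Convex ℝ S := convex_halfSpace_re_lt _
  have hexp : ∀ s ∈ S, Complex.exp s ∈ puncturedDisc r := fun s hs => by
    have hs' : s.re < Real.log r := hs
    rw [puncturedDisc, mem_ofPred_eq, Complex.norm_exp]
    exact ⟨Real.exp_pos _, by rw [← Real.lt_log_iff_exp_lt hr]; exact hs'⟩
  -- Under z = e^s the form c dz / z becomes c ds, so D(e^s) - Re(c s) is constant on the half
  -- plane.
  have hd : ∀ s ∈ S, HasFDerivAt (fun s => D (Complex.exp s) - (c * s).re) (0 : ℂ →L[ℝ] ℝ) s :=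
    fun s hs => by
      have h1 := (hD _ (hexp s hs)).comp s
        ((Complex.hasDerivAt_exp s).hasFDerivAt.restrictScalars ℝ)
      have h2 := hasFDerivAt_re ((hasDerivAt_id s).const_mul c)
      refine (h1.sub h2).congr_fderiv ?_
      ext v
      change ((v * Complex.exp s) * (c / Complex.exp s)).re - (v * (c * 1)).re = 0
      have : v * Complex.exp s * (c / Complex.exp s) = v * c := by
        have := Complex.exp_ne_zero s
        field_simp
      rw [this, mul_one, sub_self]
  have hconst : ∀ s ∈ S, ∀ s' ∈ S,
      D (Complex.exp s) - (c * s).re = D (Complex.exp s') - (c * s').re := fun s hs s' hs' =>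
    hSc.is_const_of_fderivWithin_eq_zero (𝕜 := ℝ) (f := fun s => D (Complex.exp s) - (c * s).re)
      (fun w hw => (hd w hw).differentiableAt.differentiableWithinAt)
      (fun w hw => by rw [fderivWithin_of_isOpen hSo hw, (hd w hw).fderiv]) hs hs'
  have hmem : ∀ (x y : ℝ), x < Real.log r → ((x : ℂ) + y * Complex.I) ∈ S := fun x y hx => by
    simpa [hS] using hx
  -- The function D(e^s) has period 2πi, while Re(c s) changes by -2π Im c.
  have him : c.im = 0 := by
    have := hconst _ (hmem (Real.log r - 1) 0 (by linarith)) _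
      (hmem (Real.log r - 1) (2 * Real.pi) (by linarith))
    have hper : Complex.exp (((Real.log r - 1 : ℝ) : ℂ) + ((2 * Real.pi : ℝ) : ℂ) * Complex.I)
        = Complex.exp (((Real.log r - 1 : ℝ) : ℂ) + ((0 : ℝ) : ℂ) * Complex.I) := by
      rw [Complex.exp_add]
      push_cast
      rw [Complex.exp_two_pi_mul_I]; simp
    rw [hper] at this
    simp at this
    have h0 : c.im * (2 * Real.pi) = 0 := by linarith
    exact (mul_eq_zero.1 h0).resolve_right Real.two_pi_pos.ne'
  have hre : c.re = 0 := by
    by_contra hne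
    set x₀ := Real.log r - 1 with hx₀
    -- Moving s by K to the left would change D by 2M + 1, more than the bound |D| ≤ M permits.
    set K := (2 * M + 1) / |c.re| with hK
    have hM : 0 ≤ M := (abs_nonneg _).trans (hb _ (hexp _ (hmem x₀ 0 (by linarith))))
    have hKpos : 0 < K := by positivity
    have h1 := hconst _ (hmem x₀ 0 (by linarith)) _ (hmem (x₀ - K) 0 (by linarith))
    have b1 := abs_le.1 (hb _ (hexp _ (hmem x₀ 0 (by linarith))))
    have b2 := abs_le.1 (hb _ (hexp _ (hmem (x₀ - K) 0 (by linarith))))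
    have e1 : (c * ((x₀ : ℂ) + ((0 : ℝ) : ℂ) * Complex.I)).re = c.re * x₀ := by simp
    have e2 : (c * (((x₀ - K : ℝ) : ℂ) + ((0 : ℝ) : ℂ) * Complex.I)).re = c.re * (x₀ - K) := by simp
    rw [e1, e2] at h1
    have e3 : |c.re * K| = 2 * M + 1 := by
      rw [abs_mul, abs_of_pos hKpos, hK]; field_simp
    have e4 : |c.re * K| ≤ 2 * M := by
      rw [abs_le]; constructor <;> nlinarith
    linarith
  exact Complex.ext hre him

/-- The height differential of an end of bounded height extends holomorphically. -/
theorem exists_analytic_wH {F : ℂ → E3} {ε M : ℝ} (hε : 0 < ε)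
    (hF : IsWeierstrassOn F (puncturedDisc ε)) (hM : ∀ z ∈ puncturedDisc ε, |F z 2| ≤ M) :
    ∃ E : ℂ → ℂ, AnalyticAt ℂ E 0 ∧ ∀ᶠ z in 𝓝[≠] (0 : ℂ), wH F z = E z := by
  -- By the gradient estimate z² H tends to 0, hence H = E₁(0)/z + E₂ with E₂ analytic; only the
  -- simple pole has to be excluded.
  set E₀ : ℂ → ℂ := fun z => z ^ 2 * wH F z with hE₀
  have hdisc := puncturedDisc_mem_nhdsNE hε
  have han0 : AnalyticAt ℂ E₀ 0 := by
    refine Complex.analyticAt_of_differentiable_on_punctured_nhds_of_continuousAt ?_ ?_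
    · filter_upwards [hdisc] with z hz
      exact (differentiableAt_id.pow 2).mul
        (hF.holH.differentiableAt ((isOpen_puncturedDisc ε).mem_nhds hz))
    · rw [← continuousWithinAt_compl_self]
      have h0 : E₀ 0 = 0 := by simp [hE₀]
      rw [ContinuousWithinAt, h0]
      refine squeeze_zero_norm' (a := fun z => 2 * Real.exp M * Real.exp M * ‖z‖) ?_ ?_
      · filter_upwards [puncturedDisc_mem_nhdsNE (half_pos hε)] with z hz
        have := norm_wH_le hF hM hz
        rw [hE₀, norm_mul, norm_pow]
        nlinarith [norm_nonneg z]
      · have : Continuous fun z : ℂ => 2 * Real.exp M * Real.exp M * ‖z‖ := by fun_prop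
        have h1 := this.tendsto 0
        simp only [norm_zero, mul_zero] at h1
        exact h1.mono_left nhdsWithin_le_nhds
  have hds : ∀ {G : ℂ → ℂ}, AnalyticAt ℂ G 0 → AnalyticAt ℂ (dslope G 0) 0 := fun {G} hG => by
    obtain ⟨s, hs, hd⟩ := hG.eventually_analyticAt.exists_mem
    have : DifferentiableOn ℂ (dslope G 0) s :=
      (Complex.differentiableOn_dslope hs).2
        fun z hz => (hd z hz).differentiableAt.differentiableWithinAt
    exact this.analyticAt hs
  have han1 := hds han0
  have han2 := hds han1
  set E₁ := dslope E₀ 0 with hE₁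
  set E₂ := dslope E₁ 0 with hE₂
  have hval : ∀ z : ℂ, z ≠ 0 → wH F z = E₁ 0 / z + E₂ z := by
    intro z hz
    have h1 := sub_smul_dslope E₀ 0 z
    have h2 := sub_smul_dslope E₁ 0 z
    rw [← hE₁] at h1
    rw [← hE₂] at h2
    simp [hE₀] at h1 h2
    field_simp
    rw [h2]
    apply mul_left_cancel₀ hz
    linear_combination -h1
  refine ⟨E₂, han2, ?_⟩
  obtain ⟨r₀, hr₀, hball⟩ := Metric.eventually_nhds_iff_ball.1 han2.eventually_analyticAt
  have hprim : DifferentiableOn ℂ E₂ (Metric.ball 0 r₀) := fun z hz =>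
    (hball z hz).differentiableAt.differentiableWithinAt
  obtain ⟨v, hv⟩ := hprim.isExactOn_ball
  set r := min (r₀ / 2) ε with hr
  have hrpos : 0 < r := by positivity
  have hrr : r < r₀ := (min_le_left _ _).trans_lt (by linarith)
  have hcomp : ∃ K, ∀ z ∈ Metric.closedBall (0 : ℂ) r, |(v z).re| ≤ K := by
    obtain ⟨K, hK⟩ := (isCompact_closedBall (0 : ℂ) r).bddAbove_image
      (f := fun z => |(v z).re|) (fun z hz => by
        have h1 := (hv z (Metric.closedBall_subset_ball hrr hz)).continuousAt
        exact ((Complex.continuous_re.continuousAt.comp h1).abs).continuousWithinAt)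
    exact ⟨K, fun z hz => hK ⟨z, hz, rfl⟩⟩
  obtain ⟨K, hK⟩ := hcomp
  -- Subtracting Re ∫ E₂ from the height leaves a bounded function with differential Re(E₁(0) dz /
  -- z).
  have hc : E₁ 0 = 0 := by
    refine eq_zero_of_height_log (D := fun z => F z 2 - (v z).re) (M := M + K) hrpos ?_ ?_
    · intro z hz
      have hz1 : z ∈ puncturedDisc ε := puncturedDisc_mono (min_le_right _ _) hz
      have hz2 : z ∈ Metric.ball (0 : ℂ) r₀ := by simpa using hz.2.trans hrr
      have h1 := (hasFDerivAt_height (hF.differentiableAt (isOpen_puncturedDisc ε) hz1)).sub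
        (hasFDerivAt_re (hv z hz2))
      refine h1.congr_fderiv ?_
      have := hval z (norm_pos_iff.1 hz.1)
      rw [this]
      ext w
      simp; ring
    · intro z hz
      have hz1 : z ∈ puncturedDisc ε := puncturedDisc_mono (min_le_right _ _) hz
      have hz2 : z ∈ Metric.closedBall (0 : ℂ) r := by simpa using hz.2.le
      exact (abs_sub _ _).trans (add_le_add (hM z hz1) (hK z hz2))
  filter_upwards [self_mem_nhdsWithin] with z hz
  rw [hval z hz, hc]; simp

/-- A holomorphic function on the punctured disc with a removable singularity has a primitive. -/
theorem exists_primitive_of_removable {φ E : ℂ → ℂ} {ε : ℝ} (hε : 0 < ε)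
    (hφ : DifferentiableOn ℂ φ (puncturedDisc ε)) (hE : AnalyticAt ℂ E 0)
    (he : ∀ᶠ z in 𝓝[≠] (0 : ℂ), φ z = E z) :
    ∃ f : ℂ → ℂ, DifferentiableOn ℂ f (Metric.ball 0 ε) ∧ f 0 = 0 ∧
      ∀ z ∈ puncturedDisc ε, HasDerivAt f (φ z) z := by
  set G := Function.update φ 0 (E 0) with hG
  have hd : DifferentiableOn ℂ G (Metric.ball 0 ε) := by
    rw [← Complex.differentiableOn_compl_singleton_and_continuousAt_iff
      (Metric.ball_mem_nhds (0 : ℂ) hε), ← puncturedDisc_eq]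
    refine ⟨hφ.congr fun z hz => Function.update_of_ne (norm_pos_iff.1 hz.1) _ _, ?_⟩
    rw [hG, continuousAt_update_same]
    exact (hE.continuousAt.tendsto.mono_left nhdsWithin_le_nhds).congr'
      (he.mono fun z hz => hz.symm)
  obtain ⟨f, hf0, hf⟩ := hd.isExactOn_ball.with_val_at 0 0
  refine ⟨f, fun z hz => (hf z hz).differentiableAt.differentiableWithinAt, hf0, fun z hz => ?_⟩
  have := hf z (by simpa using hz.2)
  rwa [hG, Function.update_of_ne (norm_pos_iff.1 hz.1)] at this

/-- The primitive of `g⁻¹ dh` that is determined by a primitive of `g dh` and the surface. -/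
theorem hasDerivAt_primP {F : ℂ → E3} {q : ℂ → ℂ} {z : ℂ} (hF : DifferentiableAt ℝ F z)
    (hq : HasDerivAt q (wQ F z) z) :
    HasDerivAt (fun w => 2 * ((F w 0 : ℂ) - Complex.I * (F w 1 : ℂ)) + conj (q w)) (wP F z) z := by
  have h0 := (Complex.ofRealCLM ∘L (EuclideanSpace.proj (0 : Fin 3) : E3 →L[ℝ] ℝ)).hasFDerivAt.comp
    z hF.hasFDerivAt
  have h1 := (Complex.ofRealCLM ∘L (EuclideanSpace.proj (1 : Fin 3) : E3 →L[ℝ] ℝ)).hasFDerivAt.comp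
    z hF.hasFDerivAt
  have h2 := (Complex.conjCLE : ℂ →L[ℝ] ℂ).hasFDerivAt.comp z (hq.hasFDerivAt.restrictScalars ℝ)
  have h3 := ((h0.sub (h1.const_smul Complex.I)).const_smul (2 : ℂ)).add h2
  -- The real differential of 2(x₁ - i x₂) is P dz - conj(Q dz). Adding conj q cancels the
  -- antilinear part.
  refine hasFDerivAt_of_restrictScalars ℝ h3 ?_
  ext v
  change _ = 2 * (((fderiv ℝ F z v 0 : ℝ) : ℂ) - Complex.I * ((fderiv ℝ F z v 1 : ℝ) : ℂ))
    + conj (v * wQ F z)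
  rw [fderiv_apply_re, fderiv_apply_re]
  apply Complex.ext <;> simp [wP, wQ] <;> ring

theorem analyticAt_dslope {G : ℂ → ℂ} {c : ℂ} (hG : AnalyticAt ℂ G c) :
    AnalyticAt ℂ (dslope G c) c := by
  obtain ⟨s, hs, hd⟩ := hG.eventually_analyticAt.exists_mem
  have : DifferentiableOn ℂ (dslope G c) s :=
    (Complex.differentiableOn_dslope hs).2
      fun z hz => (hd z hz).differentiableAt.differentiableWithinAt
  exact this.analyticAt hs

/-! ### Laurent primitives, residues and the winding number of an embedded end -/

/-- Formal integration of `U / z ^ (ℓ + 1)`. -/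
theorem exists_laurent_primitive (ℓ : ℕ) : ∀ U : ℂ → ℂ, AnalyticAt ℂ U 0 →
    ∃ (c : ℂ) (v : ℂ → ℂ), AnalyticAt ℂ v 0 ∧
      (∀ᶠ z in 𝓝[≠] (0 : ℂ), HasDerivAt (fun z => v z * (z ^ ℓ)⁻¹)
        (U z * (z ^ (ℓ + 1))⁻¹ - c * z⁻¹) z) ∧
      ℓ * v 0 = -U 0 + (if ℓ = 0 then c else 0) := by
  induction ℓ with
  | zero =>
    intro U hU
    obtain ⟨r, hr, hball⟩ :=
      Metric.eventually_nhds_iff_ball.1 (analyticAt_dslope hU).eventually_analyticAt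
    have hd : DifferentiableOn ℂ (dslope U 0) (Metric.ball 0 r) := fun z hz =>
      (hball z hz).differentiableAt.differentiableWithinAt
    obtain ⟨v, hv⟩ := hd.isExactOn_ball
    refine ⟨U 0, v, ?_, ?_, by simp⟩
    · exact DifferentiableOn.analyticAt
        (fun z hz => (hv z hz).differentiableAt.differentiableWithinAt) (Metric.ball_mem_nhds _ hr)
    · filter_upwards [self_mem_nhdsWithin, nhdsWithin_le_nhds (Metric.ball_mem_nhds (0 : ℂ) hr)]
        with z hz0 hz
      have hz0' : z ≠ 0 := hz0
      have h1 := sub_smul_dslope U 0 z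
      simp at h1
      have h2 : U z * (z ^ (0 + 1))⁻¹ - U 0 * z⁻¹ = dslope U 0 z := by
        rw [zero_add, pow_one]; field_simp; rw [h1]
      rw [h2]
      simpa using hv z hz
  | succ ℓ ih =>
    intro U hU
    obtain ⟨c, v, hv, hder, -⟩ := ih (dslope U 0) (analyticAt_dslope hU)
    have hl : ((ℓ : ℂ) + 1) ≠ 0 := Nat.cast_add_one_ne_zero ℓ
    -- The constant term U(0) / z^(ℓ + 2) is integrated explicitly; the remainder has a pole of
    -- order one less and the same residue.
    refine ⟨c, fun z => -U 0 / (ℓ + 1) + z * v z, analyticAt_const.add (analyticAt_id.mul hv),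
      ?_, by simp; field_simp⟩
    filter_upwards [self_mem_nhdsWithin, hder] with z hz0 hz
    have hz0' : z ≠ 0 := hz0
    have h1 := sub_smul_dslope U 0 z
    simp at h1
    have h3 : HasDerivAt (fun w : ℂ => (w ^ (ℓ + 1))⁻¹)
        (-(((ℓ + 1 : ℕ) : ℂ) * z ^ ℓ) / (z ^ (ℓ + 1)) ^ 2) z :=
      (hasDerivAt_pow (ℓ + 1) z).inv (pow_ne_zero _ hz0')
    have h4 := (h3.const_mul (-U 0 / (ℓ + 1))).add hz
    have h5 : -U 0 / (ℓ + 1) * (-(((ℓ + 1 : ℕ) : ℂ) * z ^ ℓ) / (z ^ (ℓ + 1)) ^ 2)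
        + (dslope U 0 z * (z ^ (ℓ + 1))⁻¹ - c * z⁻¹)
        = U z * (z ^ (ℓ + 1 + 1))⁻¹ - c * z⁻¹ := by
      have h6 : U z = U 0 + z * dslope U 0 z := by rw [h1]; ring
      rw [h6]; push_cast
      field_simp
      ring
    rw [h5] at h4
    refine h4.congr_of_eventuallyEq ?_
    filter_upwards [isOpen_compl_singleton.mem_nhds hz0] with w hw
    have hw' : w ≠ 0 := hw
    simp only [Pi.add_apply]
    field_simp
    ring

/-- A function with a single-valued primitive has no residue. -/
theorem residue_eq_zero {G : ℂ → ℂ} {c : ℂ}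
    (h : ∀ᶠ z in 𝓝[≠] (0 : ℂ), HasDerivAt G (c * z⁻¹) z) : c = 0 := by
  obtain ⟨d, hd, h⟩ := exists_puncturedDisc_of_eventually h
  have hd2 : 0 < d / 2 := half_pos hd
  have h1 : (∮ z in C(0, d / 2), c * z⁻¹) = 0 :=
    circleIntegral.integral_eq_zero_of_hasDerivWithinAt hd2.le fun z hz => by
      have hz' : ‖z‖ = d / 2 := by simpa using hz
      exact (h z ⟨by rw [hz']; exact hd2, by rw [hz']; linarith⟩).hasDerivWithinAt
  have h2 : (∮ z in C(0, d / 2), c * z⁻¹) = c * (2 * Real.pi * Complex.I) := by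
    rw [circleIntegral.integral_const_mul]
    congr 1
    simpa using circleIntegral.integral_sub_center_inv 0 hd2.ne'
  rw [h1] at h2
  rcases mul_eq_zero.1 h2.symm with h3 | h3
  · exact h3
  · simp [Real.pi_ne_zero] at h3

/-- A continuous function of period `ℓ T` takes equal values at some points at distance `T`. -/
theorem exists_eq_add_of_periodic {y : ℝ → ℝ} (hy : Continuous y) {ℓ : ℕ} (hℓ : 1 ≤ ℓ) {T : ℝ}
    (hper : ∀ θ, y (θ + ℓ * T) = y θ) : ∃ θ, y (θ + T) = y θ := by
  by_contra hne
  push Not at hne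
  set d : ℝ → ℝ := fun θ => y (θ + T) - y θ with hd
  have hdc : Continuous d := by fun_prop
  have hd0 : ∀ θ, d θ ≠ 0 := fun θ => sub_ne_zero.2 (hne θ)
  -- The increments over one full period telescope to zero, so they cannot all have the same strict
  -- sign; the intermediate value theorem then gives a zero increment.
  have hsum : ∑ j ∈ Finset.range ℓ, d (j * T) = 0 := by
    have h1 : ∑ j ∈ Finset.range ℓ, d (j * T)
        = ∑ j ∈ Finset.range ℓ, (y ((j + 1 : ℕ) * T) - y (j * T)) := by
      refine Finset.sum_congr rfl fun j _ => ?_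
      simp only [hd]; push_cast; ring_nf
    rw [h1, Finset.sum_range_sub (fun j : ℕ => y (j * T))]
    have := hper 0
    simp at this ⊢
    rw [this, sub_self]
  have hsign : (∀ θ, 0 < d θ) ∨ ∀ θ, d θ < 0 := by
    by_contra hcon
    push Not at hcon
    obtain ⟨⟨a, ha⟩, ⟨b, hb⟩⟩ := hcon
    obtain ⟨x, hx⟩ := mem_range_of_exists_le_of_exists_ge hdc ⟨a, ha⟩ ⟨b, hb⟩
    exact hd0 x hx
  have hne' : (Finset.range ℓ).Nonempty := Finset.nonempty_range_iff.2 (by omega)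
  rcases hsign with h | h
  · exact (Finset.sum_pos (fun j _ => h _) hne').ne' hsum
  · exact (Finset.sum_neg (fun j _ => h _) hne').ne hsum

/-- An embedded end is a graph: the end winds once around its axis. -/
theorem winding_eq_one {F : ℂ → E3} {ε : ℝ} (hF : ContinuousOn F (puncturedDisc ε))
    (hε : 0 < ε) (hinj : InjOn F (puncturedDisc ε)) {q v : ℂ → ℂ} {K : ℂ} {ℓ : ℕ} (hℓ : 1 ≤ ℓ)
    (hq : AnalyticAt ℂ q 0) (hv : AnalyticAt ℂ v 0) (hv0 : v 0 ≠ 0)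
    (hW : ∀ᶠ z in 𝓝[≠] (0 : ℂ), 2 * ((F z 0 : ℂ) - Complex.I * (F z 1 : ℂ)) + conj (q z)
      = v z * (z ^ ℓ)⁻¹ + K) : ℓ = 1 := by
  by_contra hne
  have hℓc : (ℓ : ℂ) ≠ 0 := by exact_mod_cast (by omega : ℓ ≠ 0)
  -- The horizontal position is 2(x₁ - i x₂) = K + u z^(-ℓ), with u merely C¹ because of conj q.
  set u : ℂ → ℂ := fun z => v z - z ^ ℓ * conj (q z) with hu
  have hu0 : u 0 = v 0 := by simp [hu, zero_pow (show ℓ ≠ 0 by omega)]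
  have hucd : ContDiffAt ℝ 1 u 0 :=
    ((hv.contDiffAt (n := 1)).restrict_scalars ℝ).sub ((contDiffAt_id.pow ℓ).mul
      (Complex.conjCLE.contDiff.contDiffAt.comp _ ((hq.contDiffAt (n := 1)).restrict_scalars ℝ)))
  set w : ℂ → ℂ := fun z => (u z / u 0) ^ (-(1 / ℓ) : ℂ) with hw
  have hu00 : u 0 ≠ 0 := by rw [hu0]; exact hv0
  have hwcd : ContDiffAt ℝ 1 w 0 := by
    have h1 : AnalyticAt ℂ (fun x : ℂ => x ^ (-(1 / ℓ) : ℂ)) (u 0 / u 0) := by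
      refine analyticAt_id.cpow analyticAt_const ?_
      rw [id, div_self hu00]; simp
    exact ContDiffAt.comp (g := fun x : ℂ => x ^ (-(1 / ℓ) : ℂ)) (f := fun z => u z / u 0) (0 : ℂ)
      ((h1.contDiffAt (n := 1)).restrict_scalars ℝ) (hucd.div_const _)
  have hw0 : w 0 = 1 := by simp [hw, div_self hu00]
  -- In the C¹ coordinate χ = z (u/u(0))^(-1/ℓ) the horizontal position is exactly K + u(0) χ^(-ℓ):
  -- turning χ by 2π/ℓ preserves it.
  set χ : ℂ → ℂ := fun z => z * w z with hχ
  have hχcd : ContDiffAt ℝ 1 χ 0 := contDiffAt_id.mul hwcd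
  have hχd : HasFDerivAt χ (ContinuousLinearEquiv.refl ℝ ℂ : ℂ →L[ℝ] ℂ) 0 := by
    have h1 := (hasFDerivAt_id (𝕜 := ℝ) (0 : ℂ)).mul
      (hwcd.differentiableAt (by simp)).hasFDerivAt
    refine h1.congr_fderiv ?_
    ext z
    simp [hw0]
  set e := hχcd.toOpenPartialHomeomorph χ hχd (by simp) with he
  have hecoe : (e : ℂ → ℂ) = χ := rfl
  have h0s : (0 : ℂ) ∈ e.source := hχcd.mem_toOpenPartialHomeomorph_source hχd (by simp)
  have hχ0 : χ 0 = 0 := by simp [hχ]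
  have h0t : (0 : ℂ) ∈ e.target := by rw [← hχ0]; exact e.map_source h0s
  have hes0 : e.symm 0 = 0 := by
    have := e.left_inv h0s
    rwa [hecoe, hχ0] at this
  have hgood : ∀ᶠ z in 𝓝 (0 : ℂ), z ≠ 0 → (2 * ((F z 0 : ℂ) - Complex.I * (F z 1 : ℂ)) + conj (q z)
      = v z * (z ^ ℓ)⁻¹ + K) ∧ z ∈ puncturedDisc ε ∧ u z ≠ 0 := by
    have h1 : ∀ᶠ z in 𝓝[≠] (0 : ℂ), u z ≠ 0 :=
      nhdsWithin_le_nhds (hucd.continuousAt.eventually_ne hu00)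
    have h2 : ∀ᶠ z in 𝓝[≠] (0 : ℂ), z ∈ puncturedDisc ε := puncturedDisc_mem_nhdsNE hε
    have := hW.and (h2.and h1)
    rwa [eventually_nhdsWithin_iff] at this
  have hsymm0 : Tendsto e.symm (𝓝 0) (𝓝 0) := by
    have := e.continuousAt_symm h0t
    rwa [ContinuousAt, hes0] at this
  obtain ⟨δ₀, hδ₀, hball⟩ := Metric.eventually_nhds_iff_ball.1
    ((hsymm0.eventually hgood).and (e.open_target.mem_nhds h0t))
  set δ := δ₀ / 2 with hδ
  have hδpos : 0 < δ := half_pos hδ₀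
  set c : ℝ → ℂ := fun θ => δ * Complex.exp (θ * Complex.I) with hc
  have hcn : ∀ θ, ‖c θ‖ = δ := fun θ => by
    rw [hc, norm_mul, Complex.norm_exp_ofReal_mul_I, mul_one, Complex.norm_of_nonneg hδpos.le]
  have hc0 : ∀ θ, c θ ≠ 0 := fun θ => by rw [← norm_pos_iff, hcn]; exact hδpos
  have hcball : ∀ θ, c θ ∈ Metric.ball (0 : ℂ) δ₀ := fun θ => by
    rw [mem_ball_zero_iff, hcn, hδ]; linarith
  have hct : ∀ θ, c θ ∈ e.target := fun θ => (hball _ (hcball θ)).2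
  set ζ : ℝ → ℂ := fun θ => e.symm (c θ) with hζ
  have hχζ : ∀ θ, χ (ζ θ) = c θ := fun θ => e.right_inv (hct θ)
  have hζ0 : ∀ θ, ζ θ ≠ 0 := fun θ h0 => hc0 θ (by rw [← hχζ, h0, hχ0])
  have hζg : ∀ θ, _ := fun θ => (hball _ (hcball θ)).1 (hζ0 θ)
  have hζc : Continuous ζ := by
    refine continuous_iff_continuousAt.2 fun θ => ?_
    have hcc : Continuous c := by fun_prop
    exact (e.continuousAt_symm (hct θ)).comp hcc.continuousAt
  have hyc : Continuous fun θ => F (ζ θ) 2 := by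
    refine continuous_iff_continuousAt.2 fun θ => ?_
    have h1 : ContinuousAt F (ζ θ) :=
      hF.continuousAt ((isOpen_puncturedDisc ε).mem_nhds (hζg θ).2.1)
    exact (EuclideanSpace.proj (𝕜 := ℝ) (2 : Fin 3)).continuous.continuousAt.comp
      (ContinuousAt.comp (f := ζ) h1 hζc.continuousAt)
  have hcper : ∀ θ, c (θ + ℓ * (2 * Real.pi / ℓ)) = c θ := fun θ => by
    have : ((ℓ : ℝ) * (2 * Real.pi / ℓ)) = 2 * Real.pi := by
      have : (ℓ : ℝ) ≠ 0 := by exact_mod_cast (by omega : ℓ ≠ 0)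
      field_simp
    rw [this, hc]
    simp only
    congr 1
    push_cast
    rw [add_mul, Complex.exp_add, Complex.exp_two_pi_mul_I, mul_one]
  -- On a small circle in the χ-plane some two points 2π/ℓ apart also have equal height. For ℓ ≥ 2
  -- they are distinct, contrary to injectivity.
  obtain ⟨θ, hθ⟩ := exists_eq_add_of_periodic hyc hℓ (T := 2 * Real.pi / ℓ)
    (fun θ => by simp only [hζ, hcper])
  set θ' := θ + 2 * Real.pi / ℓ with hθ'
  have hcθ : c θ' = c θ * Complex.exp (2 * Real.pi * Complex.I / ℓ) := by
    rw [hc, hθ']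
    simp only
    push_cast
    rw [add_mul, Complex.exp_add]
    ring_nf
  have hprim := Complex.isPrimitiveRoot_exp ℓ (by omega)
  have hpow : c θ' ^ ℓ = c θ ^ ℓ := by rw [hcθ, mul_pow, hprim.pow_eq_one, mul_one]
  have hWval : ∀ θ, v (ζ θ) * (ζ θ ^ ℓ)⁻¹ - conj (q (ζ θ)) = u 0 * (c θ ^ ℓ)⁻¹ := by
    intro θ
    have hz0 := hζ0 θ
    have huz := (hζg θ).2.2
    have h1 : c θ ^ ℓ = ζ θ ^ ℓ * (u (ζ θ) / u 0)⁻¹ := by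
      rw [← hχζ, hχ, mul_pow, hw]
      simp only
      rw [← Complex.cpow_nat_mul]
      have : (ℓ : ℂ) * -(1 / ℓ) = -1 := by field_simp
      rw [this, Complex.cpow_neg_one]
    rw [h1]
    have h2 : u 0 * (ζ θ ^ ℓ * (u (ζ θ) / u 0)⁻¹)⁻¹ = u (ζ θ) * (ζ θ ^ ℓ)⁻¹ := by field_simp
    rw [h2, hu]
    field_simp
  have hWeq : 2 * ((F (ζ θ') 0 : ℂ) - Complex.I * (F (ζ θ') 1 : ℂ))
      = 2 * ((F (ζ θ) 0 : ℂ) - Complex.I * (F (ζ θ) 1 : ℂ)) := by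
    have a1 := (hζg θ').1
    have a2 := (hζg θ).1
    have b1 := hWval θ'
    have b2 := hWval θ
    rw [hpow] at b1
    linear_combination a1 - a2 + b1 - b2
  have hre := congrArg Complex.re hWeq
  have him := congrArg Complex.im hWeq
  simp at hre him
  have hFeq : F (ζ θ') = F (ζ θ) := ext_E3 hre him hθ
  have hζeq : ζ θ' = ζ θ := hinj (hζg θ').2.1 (hζg θ).2.1 hFeq
  have hceq : c θ' = c θ := by rw [← hχζ θ', ← hχζ θ, hζeq]
  rw [hcθ] at hceq
  have := mul_left_cancel₀ (hc0 θ) (hceq.trans (mul_one _).symm)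
  exact hprim.ne_one (by omega) this

/-! ### Weierstrass data and deformation of a flat end -/

theorem HasLogarithmicGrowth.eventually_abs_le {F : ℂ → E3} (h : HasLogarithmicGrowth F 0) :
    ∃ R C : ℝ, ∀ᶠ z in 𝓝[≠] (0 : ℂ), R < rho (F z) → |F z 2| ≤ C := by
  obtain ⟨β, γ₁, γ₂, C, R, h⟩ := h
  -- For ρ > 1 one has |x₁|, |x₂| ≤ ρ ≤ ρ², so every term of the expansion is bounded by its
  -- coefficient.
  refine ⟨max R 1, |C| + |β| + |γ₁| + |γ₂|, ?_⟩
  filter_upwards [h] with z hz hr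
  have h1 := hz ((le_max_left _ _).trans_lt hr)
  have hρ : 1 < rho (F z) := (le_max_right _ _).trans_lt hr
  rw [zero_mul, zero_add] at h1
  set ρ := rho (F z) with hρd
  have hsq : ρ ^ 2 = F z 0 ^ 2 + F z 1 ^ 2 := by
    rw [hρd, rho, Real.sq_sqrt (by positivity)]
  have hρ2 : ρ ≤ ρ ^ 2 := by nlinarith
  have hρ0 : 0 < ρ ^ 2 := by positivity
  have ha : |F z 0| ≤ ρ ^ 2 :=
    (abs_le_of_sq_le_sq (by nlinarith [sq_nonneg (F z 1)]) (by linarith)).trans hρ2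
  have hb : |F z 1| ≤ ρ ^ 2 :=
    (abs_le_of_sq_le_sq (by nlinarith [sq_nonneg (F z 0)]) (by linarith)).trans hρ2
  have h2 : |(γ₁ * F z 0 + γ₂ * F z 1) / ρ ^ 2| ≤ |γ₁| + |γ₂| := by
    rw [abs_div, abs_of_pos hρ0, div_le_iff₀ hρ0]
    calc |γ₁ * F z 0 + γ₂ * F z 1| ≤ |γ₁ * F z 0| + |γ₂ * F z 1| := abs_add_le _ _
      _ = |γ₁| * |F z 0| + |γ₂| * |F z 1| := by rw [abs_mul, abs_mul]
      _ ≤ |γ₁| * ρ ^ 2 + |γ₂| * ρ ^ 2 := by gcongr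
      _ = _ := by ring
  have h3 : C / ρ ^ 2 ≤ |C| :=
    (div_le_div_of_nonneg_right (le_abs_self C) hρ0.le).trans
      (div_le_self (abs_nonneg _) (by linarith))
  have h4 := abs_le.1 (h1.trans h3)
  have h5 := abs_le.1 h2
  have h6 := abs_le.1 (le_refl |β|)
  exact abs_le.2 ⟨by linarith [h4.1, h5.1, h6.1], by linarith [h4.2, h5.2, h6.2]⟩

theorem isPlanar_of_height_eq {S : Set E3} {c : ℝ} (h : ∀ x ∈ S, x 2 = c) : IsPlanar S := by
  refine ⟨e3, c, fun h0 => ?_, fun x hx => ?_⟩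
  · have := congrArg (fun v : E3 => v 2) h0
    simp at this
  · rw [inner_E3]
    simpa using h x hx

theorem IsWeierstrassOn.height_const {F : ℂ → E3} {U : Set ℂ} (hF : IsWeierstrassOn F U)
    (hU : IsOpen U) (hc : IsPreconnected U) (hH : ∀ z ∈ U, wH F z = 0) {z w : ℂ} (hz : z ∈ U)
    (hw : w ∈ U) : F z 2 = F w 2 := by
  have hd : ∀ z ∈ U, HasFDerivAt (fun w => F w 2) (0 : ℂ →L[ℝ] ℝ) z := fun z hz =>
    (hasFDerivAt_height (hF.differentiableAt hU hz)).congr_fderiv (by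
      rw [hH z hz]; ext; simp)
  exact hU.is_const_of_fderiv_eq_zero (𝕜 := ℝ) (f := fun w => F w 2) hc
    (fun z hz => (hd z hz).differentiableAt.differentiableWithinAt)
    (fun z hz => (hd z hz).fderiv) hz hw

theorem IsWeierstrassOn.wH_eq_zero {F : ℂ → E3} {U : Set ℂ} (hF : IsWeierstrassOn F U)
    (hU : IsOpen U) (hc : IsPreconnected U) {z₀ : ℂ} (hz₀ : z₀ ∈ U)
    (h : ∀ᶠ z in 𝓝 z₀, wH F z = 0) : ∀ z ∈ U, wH F z = 0 :=
  (hF.holH.analyticOnNhd hU).eqOn_zero_of_preconnected_of_eventuallyEq_zero hc hz₀ h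

/-- By the identity theorem on the connected punctured disc H would vanish everywhere; the height
would then be constant and the image horizontal. -/
theorem not_eventually_wH_eq_zero {F : ℂ → E3} {ε : ℝ} (hε : 0 < ε)
    (hF : IsWeierstrassOn F (puncturedDisc ε)) (hnp : ¬ IsPlanar (F '' puncturedDisc ε)) :
    ¬ ∀ᶠ z in 𝓝[≠] (0 : ℂ), wH F z = 0 := by
  intro h
  obtain ⟨d, hd, hz⟩ := exists_puncturedDisc_of_eventually h
  set w : ℂ := ((min d ε / 2 : ℝ) : ℂ) with hw
  have hm : 0 < min d ε := lt_min hd hε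
  have hn : ‖w‖ = min d ε / 2 := by rw [hw, Complex.norm_of_nonneg (by positivity)]
  have hwε : w ∈ puncturedDisc ε :=
    ⟨by rw [hn]; positivity, by rw [hn]; linarith [min_le_right d ε]⟩
  have hwd : w ∈ puncturedDisc d :=
    ⟨by rw [hn]; positivity, by rw [hn]; linarith [min_le_left d ε]⟩
  have hH := hF.wH_eq_zero (isOpen_puncturedDisc ε) (isPreconnected_puncturedDisc ε) hwε
    (by filter_upwards [(isOpen_puncturedDisc d).mem_nhds hwd] with z hzd using hz z hzd)
  refine hnp (isPlanar_of_height_eq (c := F w 2) ?_)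
  rintro _ ⟨z, hzε, rfl⟩
  exact hF.height_const (isOpen_puncturedDisc ε) (isPreconnected_puncturedDisc ε) hH hzε hwε

/-- A conformal immersion whose Weierstrass form is bounded is not complete at the puncture. -/
theorem not_isCompleteAtPuncture {F : ℂ → E3} {ε : ℝ} (hε : 0 < ε)
    (hF : IsWeierstrassOn F (puncturedDisc ε)) {P Q H : ℂ → ℂ} (hP : ContinuousAt P 0)
    (hQ : ContinuousAt Q 0) (hH : ContinuousAt H 0)
    (h : ∀ᶠ z in 𝓝[≠] (0 : ℂ), wP F z = P z ∧ wQ F z = Q z ∧ wH F z = H z) :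
    ¬ IsCompleteAtPuncture F ε := by
  intro hcomp
  have hb : ∀ {G : ℂ → ℂ}, ContinuousAt G 0 → ∀ᶠ z in 𝓝[≠] (0 : ℂ), ‖G z‖ ≤ ‖G 0‖ + 1 := by
    intro G hG
    exact nhdsWithin_le_nhds
      ((hG.norm.eventually (gt_mem_nhds (lt_add_one ‖G 0‖))).mono fun _ h => h.le)
  obtain ⟨d, hd, hz⟩ := exists_puncturedDisc_of_eventually
    ((h.and (hb hP)).and ((hb hQ).and (hb hH)))
  set c := (‖P 0‖ + 1) + (‖Q 0‖ + 1) + (‖H 0‖ + 1) with hc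
  have hc0 : 0 ≤ c := by positivity
  set r := min d ε / 2 with hr
  have hm : 0 < min d ε := lt_min hd hε
  have hr0 : 0 < r := half_pos hm
  have hderiv : ∀ t : ℝ, HasDerivAt (fun t : ℝ => ((r * (1 - t) : ℝ) : ℂ)) ((-r : ℝ) : ℂ) t := by
    intro t
    have := (((hasDerivAt_id t).const_sub 1).const_mul r)
    simpa using this.ofReal_comp
  have hn : ∀ t ∈ Ioo (-1 : ℝ) 1, 0 < ‖((r * (1 - t) : ℝ) : ℂ)‖ ∧
      ‖((r * (1 - t) : ℝ) : ℂ)‖ < min d ε := by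
    intro t ht
    have : 0 < r * (1 - t) := mul_pos hr0 (by linarith [ht.2])
    rw [Complex.norm_of_nonneg this.le]
    exact ⟨this, by nlinarith [ht.1]⟩
  -- The test curve is a radial segment run at constant speed r; bounded Weierstrass forms give its
  -- image bounded velocity.
  refine hcomp.not_tendsto (γ := fun t : ℝ => ((r * (1 - t) : ℝ) : ℂ))
    (γ' := fun _ => ((-r : ℝ) : ℂ)) (δ := 1) (T := 1) (c := 2 * (c * r)) one_pos one_pos
    (fun t _ => hderiv t) continuousOn_const
    (fun t ht => ⟨(hn t ht).1, (hn t ht).2.trans_le (min_le_right _ _)⟩)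
    (fun z hz => hF.differentiableAt (isOpen_puncturedDisc ε) hz) ?_ ?_
  · intro t ht
    have hzd : ((r * (1 - t) : ℝ) : ℂ) ∈ puncturedDisc d :=
      ⟨(hn t ht).1, (hn t ht).2.trans_le (min_le_left _ _)⟩
    obtain ⟨⟨⟨e1, e2, e3⟩, b1⟩, b2, b3⟩ := hz _ hzd
    refine norm_le_of_coord_le (by positivity) fun j => ?_
    rw [fderiv_apply_re]
    refine (Complex.abs_re_le_norm _).trans ?_
    rw [norm_mul, Complex.norm_real, norm_neg, Real.norm_of_nonneg hr0.le]
    refine mul_le_mul_of_nonneg_right ?_ hr0.le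
    rw [complexVelocity_eq_formVec, e1, e2, e3]
    have h2 : ‖(2 : ℂ)‖ = 2 := by simp
    fin_cases j
    · simp only [formVec, Fin.zero_eta, Matrix.cons_val_zero, norm_div, h2]
      have := norm_sub_le (P ((r * (1 - t) : ℝ) : ℂ)) (Q ((r * (1 - t) : ℝ) : ℂ))
      linarith [norm_nonneg (H 0), norm_nonneg (P 0), norm_nonneg (Q 0)]
    · simp only [formVec, Fin.mk_one, Matrix.cons_val_one, Matrix.cons_val_zero, norm_div, h2,
        norm_mul, Complex.norm_I, one_mul]
      have := norm_add_le (P ((r * (1 - t) : ℝ) : ℂ)) (Q ((r * (1 - t) : ℝ) : ℂ))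
      linarith [norm_nonneg (H 0), norm_nonneg (P 0), norm_nonneg (Q 0)]
    · simp only [formVec, Fin.reduceFinMk, Matrix.cons_val]
      linarith [norm_nonneg (H 0), norm_nonneg (P 0), norm_nonneg (Q 0)]
  · have : ContinuousAt (fun t : ℝ => ((r * (1 - t) : ℝ) : ℂ)) 1 := (hderiv 1).continuousAt
    have h2 : Tendsto (fun t : ℝ => ((r * (1 - t) : ℝ) : ℂ)) (𝓝 1) (𝓝 0) := by
      simpa [ContinuousAt] using this
    exact h2.mono_left nhdsWithin_le_nhds

/-- The Weierstrass data at a complete embedded planar end with limit normal `-e3`: `dh` and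
the last form extend holomorphically, and the end winds like `z ^ (k - e - 1)`. -/
theorem exists_end_expansion {F : ℂ → E3} {ε : ℝ} (hε : 0 < ε)
    (hF : IsWeierstrassOn F (puncturedDisc ε)) (hcomp : IsCompleteAtPuncture F ε)
    (hlim : Tendsto (unitNormal F) (𝓝[≠] 0) (𝓝 (-e3))) (hgrowth : HasLogarithmicGrowth F 0)
    (hne : ¬ ∀ᶠ z in 𝓝[≠] (0 : ℂ), wH F z = 0) :
    ∃ (e ℓ : ℕ) (u h : ℂ → ℂ), AnalyticAt ℂ u 0 ∧ AnalyticAt ℂ h 0 ∧ u 0 ≠ 0 ∧ h 0 ≠ 0 ∧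
      ∀ᶠ z in 𝓝[≠] (0 : ℂ), wH F z = z ^ e * u z ∧
        wQ F z = z ^ (e + (e + ℓ + 1)) * (u z * h z) ∧
        wP F z = u z / h z * (z ^ (ℓ + 1))⁻¹ := by
  obtain ⟨hP, hg⟩ := tendsto_gauss hε hF hlim
  obtain ⟨d, hd, hPd⟩ := exists_puncturedDisc_of_eventually hP
  have hm : 0 < min d ε := lt_min hd hε
  have hF' := hF.mono (puncturedDisc_mono (min_le_right d ε))
  obtain ⟨R, C, hRC⟩ := hgrowth.eventually_abs_le
  obtain ⟨M, hM⟩ := exists_height_bound hm hF'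
    (fun z hz => hPd z (puncturedDisc_mono (min_le_left d ε) hz))
    (hcomp.mono (min_le_right d ε)) hg hRC
  obtain ⟨d', hd', hMd⟩ := exists_puncturedDisc_of_eventually hM
  have hm' : 0 < min d' ε := lt_min hd' hε
  obtain ⟨E, hE, hHE⟩ := exists_analytic_wH hm' (hF.mono (puncturedDisc_mono (min_le_right d' ε)))
    (fun z hz => hMd z (puncturedDisc_mono (min_le_left d' ε) hz))
  obtain ⟨e, u, hu, hu0, hEu⟩ := hE.exists_eventuallyEq_pow_smul_nonzero_iff.2 (fun h0 => hne (by
    filter_upwards [hHE, nhdsWithin_le_nhds h0] with z h1 h2 using h1.trans h2))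
  have hεn : ∀ᶠ z in 𝓝[≠] (0 : ℂ), z ∈ puncturedDisc ε := puncturedDisc_mem_nhdsNE hε
  have hgd : ∀ᶠ z in 𝓝[≠] (0 : ℂ), DifferentiableAt ℂ (fun z => wH F z / wP F z) z := by
    filter_upwards [hεn, hP] with z hz hPz
    have hz' := (isOpen_puncturedDisc ε).mem_nhds hz
    exact (hF.holH.differentiableAt hz').div (hF.holP.differentiableAt hz') hPz
  obtain ⟨k, h, hk, hh, hh0, hgk⟩ := exists_order_of_tendsto_zero hgd hg (fun h0 => hne (by
    filter_upwards [h0, hP] with z h1 h2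
    exact (div_eq_zero_iff.1 h1).resolve_right h2))
  have hhne : ∀ᶠ z in 𝓝[≠] (0 : ℂ), h z ≠ 0 :=
    nhdsWithin_le_nhds (hh.continuousAt.eventually_ne hh0)
  have key : ∀ᶠ z in 𝓝[≠] (0 : ℂ), z ≠ 0 ∧ h z ≠ 0 ∧ wH F z = z ^ e * u z ∧
      wQ F z = z ^ (e + k) * (u z * h z) ∧ wP F z * z ^ k = z ^ e * (u z / h z) := by
    filter_upwards [hεn, hP, hgk, hHE, nhdsWithin_le_nhds hEu, hhne, self_mem_nhdsWithin]
      with z hz hPz hgz hHz hEz hhz hz0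
    have h1 : wH F z = z ^ e * u z := by rw [hHz, hEz]; simp
    have h2 : wH F z = wP F z * (z ^ k * h z) := by rw [← hgz]; field_simp
    have h3 := (hF.conf z hz).null
    refine ⟨hz0, hhz, h1, ?_, ?_⟩
    · refine mul_left_cancel₀ hPz ?_
      rw [h3]
      calc wH F z ^ 2 = (z ^ e * u z) * (wP F z * (z ^ k * h z)) := by
            rw [← h1, ← h2, sq]
        _ = _ := by rw [pow_add]; ring
    · field_simp
      rw [← h1, h2]; ring
  -- The form P has order e - k at the puncture. If k ≤ e, all three forms extend continuously,
  -- contradicting completeness; so k = e + ℓ + 1 and P has a pole of order ℓ + 1.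
  rcases le_or_gt k e with hke | hke
  · exfalso
    refine not_isCompleteAtPuncture hε hF (P := fun z => z ^ (e - k) * (u z / h z))
      (Q := fun z => z ^ (e + k) * (u z * h z)) (H := fun z => z ^ e * u z)
      ?_ ?_ ?_ ?_ hcomp
    · exact (continuousAt_id.pow _).mul (hu.continuousAt.div hh.continuousAt hh0)
    · exact (continuousAt_id.pow _).mul (hu.continuousAt.mul hh.continuousAt)
    · exact (continuousAt_id.pow _).mul hu.continuousAt
    · filter_upwards [key] with z ⟨hz0, hhz, h1, h2, h3⟩
      refine ⟨mul_right_cancel₀ (pow_ne_zero k hz0) ?_, h2, h1⟩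
      rw [h3, mul_right_comm, ← pow_add, Nat.sub_add_cancel hke]
  · obtain ⟨ℓ, rfl⟩ := Nat.exists_eq_add_of_lt hke
    refine ⟨e, ℓ, u, h, hu, hh, hu0, hh0, ?_⟩
    filter_upwards [key] with z ⟨hz0, hhz, h1, h2, h3⟩
    refine ⟨h1, h2, mul_right_cancel₀ (pow_ne_zero (e + ℓ + 1) hz0) ?_⟩
    rw [h3]
    field_simp
    ring

/-- This is the case of limit normal (0, 0, -1). Once the winding number ℓ is shown to be 1, the
primitives have leading degrees -1, e + 1 and 2e + 3, which is the model with a = -1 and k = e + 2.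
-/
theorem flatEnd_deformation {F : ℂ → E3} {ε : ℝ} (hε : 0 < ε)
    (hF : IsWeierstrassOn F (puncturedDisc ε)) (hinj : InjOn F (puncturedDisc ε))
    (hcomp : IsCompleteAtPuncture F ε)
    (hlim : Tendsto (unitNormal F) (𝓝[≠] 0) (𝓝 (-e3))) (hgrowth : HasLogarithmicGrowth F 0)
    (hnp : ¬ IsPlanar (F '' puncturedDisc ε)) :
    (∀ t : ℝ, ∃ Y : ℂ → E3, IsDeformationOn t F (puncturedDisc ε) Y) ∧
      ∃ Λ > 0, ∀ μ : ℝ, Λ ≤ μ → ∀ Y : ℂ → E3, IsDeformationOn μ F (puncturedDisc ε) Y →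
        ¬ InjOn Y (puncturedDisc ε) := by
  have hne := not_eventually_wH_eq_zero hε hF hnp
  obtain ⟨e, ℓ, u, h, hu, hh, hu0, hh0, hexp⟩ := exists_end_expansion hε hF hcomp hlim hgrowth hne
  obtain ⟨f, hfd, hf0, hf⟩ := exists_primitive_of_removable hε hF.holH
    (((analyticAt_id (z := (0 : ℂ))).pow e).mul hu) (hexp.mono fun z hz => hz.1)
  obtain ⟨q, hqd, hq0, hq⟩ := exists_primitive_of_removable hε hF.holQ
    (((analyticAt_id (z := (0 : ℂ))).pow (e + (e + ℓ + 1))).mul (hu.mul hh))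
    (hexp.mono fun z hz => hz.2.1)
  have hball : Metric.ball (0 : ℂ) ε ∈ 𝓝 0 := Metric.ball_mem_nhds _ hε
  have hfa : AnalyticAt ℂ f 0 := hfd.analyticAt hball
  have hqa : AnalyticAt ℂ q 0 := hqd.analyticAt hball
  -- Although P has a pole, F itself supplies a single-valued primitive of it; hence every
  -- deformation is single-valued.
  set p : ℂ → ℂ := fun w => 2 * ((F w 0 : ℂ) - Complex.I * (F w 1 : ℂ)) + conj (q w) with hp
  have hprim : HasPrimitivesOn F p f q (puncturedDisc ε) :=
    ⟨fun z hz => hasDerivAt_primP (hF.differentiableAt (isOpen_puncturedDisc ε) hz) (hq z hz),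
      hf, hq⟩
  refine ⟨fun t => ⟨_, hprim.isDeformationOn hF (isOpen_puncturedDisc ε) t⟩, ?_⟩
  have hεn : ∀ᶠ z in 𝓝[≠] (0 : ℂ), z ∈ puncturedDisc ε := puncturedDisc_mem_nhdsNE hε
  obtain ⟨c, v, hv, hvd, hv0⟩ := exists_laurent_primitive ℓ (fun z => u z / h z) (hu.div hh hh0)
  have hres : ∀ᶠ z in 𝓝[≠] (0 : ℂ),
      HasDerivAt (fun w => p w - v w * (w ^ ℓ)⁻¹) (c * z⁻¹) z := by
    filter_upwards [hεn, hexp, hvd] with z hz hez hvz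
    have h1 := (hprim.derivP z hz).sub hvz
    rw [hez.2.2, sub_sub_cancel] at h1
    exact h1
  -- A zero residue excludes ℓ = 0: in that case c would be the nonzero leading coefficient
  -- u(0)/h(0) of P.
  have hc : c = 0 := residue_eq_zero hres
  have hU0 : u 0 / h 0 ≠ 0 := div_ne_zero hu0 hh0
  simp only [hc, ite_self, add_zero] at hv0
  have hℓ : 1 ≤ ℓ := by
    rcases Nat.eq_zero_or_pos ℓ with h0 | h0
    · rw [h0] at hv0
      simp at hv0
      exact absurd hv0 (by simpa using hU0)
    · exact h0
  have hv00 : v 0 ≠ 0 := fun h0 => hU0 (by rw [h0, mul_zero] at hv0; simpa using hv0.symm)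
  obtain ⟨K, hK⟩ : ∃ K, ∀ᶠ z in 𝓝[≠] (0 : ℂ), p z = v z * (z ^ ℓ)⁻¹ + K := by
    obtain ⟨d, hd, hz⟩ := exists_puncturedDisc_of_eventually hres
    have hd' : ∀ z ∈ puncturedDisc d, HasDerivAt (fun w => p w - v w * (w ^ ℓ)⁻¹) 0 z := by
      intro z hzd
      simpa [hc] using hz z hzd
    obtain ⟨K, hK⟩ := (isOpen_puncturedDisc d).exists_is_const_of_deriv_eq_zero
      (isPreconnected_puncturedDisc d)
      (fun z hz => (hd' z hz).differentiableAt.differentiableWithinAt)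
      (fun z hz => (hd' z hz).deriv)
    refine ⟨K, ?_⟩
    have hdn : ∀ᶠ z in 𝓝[≠] (0 : ℂ), z ∈ puncturedDisc d := puncturedDisc_mem_nhdsNE hd
    filter_upwards [hdn] with z hz
    rw [← hK z hz]
    ring
  have hℓ1 : ℓ = 1 := winding_eq_one
    (fun z hz => (hF.differentiableAt (isOpen_puncturedDisc ε) hz).continuousAt.continuousWithinAt)
    hε hinj hℓ hqa hv hv00 hK
  subst hℓ1
  have hfder : ∀ᶠ z in 𝓝[≠] (0 : ℂ), deriv f z = z ^ e * u z := by
    filter_upwards [hεn, hexp] with z hz hez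
    rw [(hf z hz).deriv, hez.1]
  have hqder : ∀ᶠ z in 𝓝[≠] (0 : ℂ), deriv q z = z ^ (e + (e + 1 + 1)) * (u z * h z) := by
    filter_upwards [hεn, hexp] with z hz hez
    rw [(hq z hz).deriv, hez.2.1]
  obtain ⟨B, hB, hfB, hB0⟩ := exists_factor_of_primitive hfa hu hf0 hfder
  obtain ⟨C, hC, hqC, hC0⟩ := exists_factor_of_primitive hqa (hu.mul hh) hq0 hqder
  have hune : ∀ᶠ z in 𝓝[≠] (0 : ℂ), u z ≠ 0 :=
    nhdsWithin_le_nhds (hu.continuousAt.eventually_ne hu0)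
  have hfB' : ∀ᶠ z in 𝓝[≠] (0 : ℂ), f z = z ^ (e + 1) * B z := nhdsWithin_le_nhds hfB
  have hqC' : ∀ᶠ z in 𝓝[≠] (0 : ℂ), q z = z ^ (e + (e + 1 + 1) + 1) * C z :=
    nhdsWithin_le_nhds hqC
  obtain ⟨d, hd, hgood⟩ := exists_puncturedDisc_of_eventually
    ((hεn.and (hexp.and hune)).and (hK.and (hfB'.and hqC')))
  have hsub : puncturedDisc d ⊆ puncturedDisc ε := fun z hz => (hgood z hz).1.1
  -- The constant K is dropped, which only translates the surface, so that p - K = v / z has the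
  -- required form z^a A. The pole of P makes k = e + 2 ≥ 2, as the model point needs.
  obtain ⟨Λ, hΛ, hmain⟩ := eventually_not_injOn (p := fun w => p w - K) (f := f) (q := q) hd
    (hF.mono hsub)
    (fun z hz => by
      rw [(hgood z hz).1.2.1.1]
      exact mul_ne_zero (pow_ne_zero _ (norm_pos_iff.1 hz.1)) (hgood z hz).1.2.2)
    ⟨fun z hz => (hprim.derivP z (hsub hz)).sub_const K, fun z hz => hf z (hsub hz),
      fun z hz => hq z (hsub hz)⟩
    (a := -1) (k := e + 1 + 1) (n := e + 1) (m := e + (e + 1 + 1) + 1) (A := v) (B := B) (C := C)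
    (P := u 0 / h 0) (g := h 0) (Or.inr ⟨rfl, by omega⟩) (by push_cast; ring) (by push_cast; ring)
    hv hB hC hU0 hh0 (by push_cast at hv0 ⊢; linear_combination -hv0)
    (by push_cast; rw [hB0]; field_simp)
    (by push_cast at hC0 ⊢; rw [hC0, Pi.mul_apply]; field_simp)
    (fun z hz => by
      rw [(hgood z hz).2.1, add_sub_cancel_right, pow_one, zpow_neg_one, mul_comm])
    (fun z hz => (hgood z hz).2.2.1) (fun z hz => (hgood z hz).2.2.2)
  refine ⟨Λ, hΛ, fun μ hμ Y hY hYinj => ?_⟩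
  obtain ⟨z, hz, z', hz', hne, heq⟩ := hmain μ hμ Y (hY.mono hsub)
  exact hne (hYinj (hsub hz) (hsub hz') heq)

/-! ### Vertical points in a normalized coordinate and the Enneper limit -/

theorem puncturedDisc_subset_ball (d : ℝ) : puncturedDisc d ⊆ Metric.ball 0 d :=
  fun _ hz => mem_ball_zero_iff.2 hz.2

theorem exists_primitive_on_ball {φ : ℂ → ℂ} {d : ℝ} (hφ : DifferentiableOn ℂ φ (Metric.ball 0 d)) :
    ∃ f : ℂ → ℂ, f 0 = 0 ∧ ∀ z ∈ Metric.ball (0 : ℂ) d, HasDerivAt f (φ z) z := by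
  obtain ⟨g, hg⟩ := hφ.isExactOn_ball
  exact ⟨fun z => g z - g 0, sub_self _, fun z hz => (hg z hz).sub_const _⟩

theorem rpow_one_add_inv (k : ℕ) {μ : ℝ} (hμ : 0 < μ) :
    μ ^ (1 + 1 / (k : ℝ)) = μ * (μ ^ (-(1 / (k : ℝ))))⁻¹ := by
  rw [Real.rpow_add hμ, Real.rpow_one, Real.rpow_neg hμ.le, inv_inv]

/-- A deformation across a vertical point is determined up to a translation. -/
theorem HasPrimitivesOn.eq_on_ball {F : ℂ → E3} {p f q : ℂ → ℂ} {d : ℝ}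
    (h : HasPrimitivesOn F p f q (Metric.ball 0 d)) (hF : IsWeierstrassOn F (Metric.ball 0 d))
    (hd : 0 < d) (hH : ∀ z ∈ puncturedDisc d, wH F z ≠ 0) {t : ℝ} {Y : ℂ → E3}
    (hY : IsDeformationOn t F (Metric.ball 0 d) Y) :
    ∃ c : E3, ∀ z ∈ Metric.ball (0 : ℂ) d, Y z = ofPrim (p z / t) (f z) (t * q z) + c := by
  have hsub := puncturedDisc_subset_ball d
  obtain ⟨c, hc⟩ := (h.mono hsub).exists_eq_add_const (hF.mono hsub) (isOpen_puncturedDisc d)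
    (isPreconnected_puncturedDisc d) hH (hY.mono hsub)
  refine ⟨c, fun z hz => ?_⟩
  -- At the centre, where H may vanish and the differential need not be prescribed, equality follows
  -- by continuity of both sides.
  rcases eq_or_ne z 0 with rfl | h0
  · have hb : Metric.ball (0 : ℂ) d ∈ 𝓝 0 := Metric.ball_mem_nhds _ hd
    have h1 : Tendsto Y (𝓝[≠] 0) (𝓝 (Y 0)) :=
      (hY.1.continuousOn.continuousAt hb).mono_left nhdsWithin_le_nhds
    have h2 : Tendsto (fun z => ofPrim (p z / t) (f z) (t * q z) + c) (𝓝[≠] 0)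
        (𝓝 (ofPrim (p 0 / t) (f 0) (t * q 0) + c)) :=
      (((h.contDiffOn_deformed Metric.isOpen_ball t).continuousOn.continuousAt hb).add
        continuousAt_const).mono_left nhdsWithin_le_nhds
    refine tendsto_nhds_unique h1 (h2.congr' ?_)
    filter_upwards [puncturedDisc_mem_nhdsNE hd] with w hw using (hc w hw).symm
  · exact hc z ⟨norm_pos_iff.2 h0, mem_ball_zero_iff.1 hz⟩

theorem continuousAt_ofPrim {α : Type*} [TopologicalSpace α] {p f q : α → ℂ} {x : α}
    (hp : ContinuousAt p x) (hf : ContinuousAt f x) (hq : ContinuousAt q x) :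
    ContinuousAt (fun y => ofPrim (p y) (f y) (q y)) x :=
  ContinuousAt.comp (g := ofPrimCLM) (f := fun y => (p y, f y, q y))
    ofPrimCLM.continuous.continuousAt (hp.prodMk (hf.prodMk hq))

/-- The deformation near a vertical point in a coordinate in which the Gauss map is `c z ^ k`. -/
theorem deformation_local_model {F : ℂ → E3} {d r : ℝ} {k : ℕ} {c : ℂ} (hd : 0 < d) (hk : 1 ≤ k)
    (hF : IsWeierstrassOn F (Metric.ball 0 d)) (hP : ∀ z ∈ Metric.ball (0 : ℂ) d, wP F z ≠ 0)
    (hH : ∀ z ∈ Metric.ball (0 : ℂ) d, wH F z = c * z ^ k * wP F z) (hc : ‖c‖ = 1)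
    (h0 : wP F 0 = r * conj c) {A : E3 ≃ₗᵢ[ℝ] E3}
    (hA : ∀ p f q : ℂ, A (ofPrim p f q) = ofPrim (conj c * p) f (c * q)) :
    (∀ t : ℝ, ∃ Y : ℂ → E3, IsDeformationOn t F (Metric.ball 0 d) Y) ∧
    (∃ Λ > 0, ∀ μ : ℝ, Λ ≤ μ → ∀ Y : ℂ → E3, IsDeformationOn μ F (Metric.ball 0 d) Y →
      ¬ InjOn Y (Metric.ball 0 d)) ∧
    ∀ Y : ℝ → ℂ → E3, (∀ t : ℝ, 0 < t → IsDeformationOn t F (Metric.ball 0 d) (Y t)) →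
      TendstoLocallyUniformly
        (fun (μ : ℝ) (ζ : ℂ) => (μ ^ (1 + 1 / (k : ℝ)) : ℝ) •
          (Y μ (((μ ^ (-(1 / (k : ℝ))) : ℝ) : ℂ) * ζ) - Y μ 0))
        (fun ζ => r • A (enneper k ζ)) atTop := by
  have hc0 : c ≠ 0 := norm_pos_iff.1 (by rw [hc]; exact one_pos)
  have hcc : c * conj c = 1 := by
    rw [Complex.mul_conj, Complex.normSq_eq_norm_sq, hc]; simp
  have hball : Metric.ball (0 : ℂ) d ∈ 𝓝 0 := Metric.ball_mem_nhds _ hd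
  have h0b : (0 : ℂ) ∈ Metric.ball (0 : ℂ) d := Metric.mem_ball_self hd
  have hQ : ∀ z ∈ Metric.ball (0 : ℂ) d, wQ F z = z ^ (2 * k) * (c ^ 2 * wP F z) := by
    intro z hz
    refine mul_left_cancel₀ (hP z hz) ?_
    rw [(hF.conf z hz).null, hH z hz]
    ring
  have hHne : ∀ z ∈ puncturedDisc d, wH F z ≠ 0 := fun z hz => by
    have hz' := puncturedDisc_subset_ball d hz
    rw [hH z hz']
    exact mul_ne_zero (mul_ne_zero hc0 (pow_ne_zero _ (norm_pos_iff.1 hz.1))) (hP z hz')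
  have hPa : AnalyticAt ℂ (wP F) 0 := hF.holP.analyticAt hball
  obtain ⟨p, hp0, hp⟩ := exists_primitive_on_ball hF.holP
  obtain ⟨f, hf0, hf⟩ := exists_primitive_on_ball hF.holH
  obtain ⟨q, hq0, hq⟩ := exists_primitive_on_ball hF.holQ
  have hprim : HasPrimitivesOn F p f q (Metric.ball 0 d) := ⟨hp, hf, hq⟩
  have han : ∀ {φ ψ : ℂ → ℂ}, (∀ z ∈ Metric.ball (0 : ℂ) d, HasDerivAt φ (ψ z) z) →
      AnalyticAt ℂ φ 0 := fun h => DifferentiableOn.analyticAt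
    (fun z hz => (h z hz).differentiableAt.differentiableWithinAt) hball
  have hbn : ∀ᶠ z in 𝓝[≠] (0 : ℂ), z ∈ Metric.ball (0 : ℂ) d := nhdsWithin_le_nhds hball
  obtain ⟨A', hA', hpA, hA0⟩ := exists_factor_of_primitive (n := 0) (han hp) hPa hp0
    (by filter_upwards [hbn] with z hz; rw [(hp z hz).deriv, pow_zero, one_mul])
  obtain ⟨B, hB, hfB, hB0⟩ := exists_factor_of_primitive (n := k) (u := fun z => c * wP F z)
    (han hf) (analyticAt_const.mul hPa) hf0
    (by filter_upwards [hbn] with z hz; rw [(hf z hz).deriv, hH z hz]; ring)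
  obtain ⟨C, hC, hqC, hC0⟩ := exists_factor_of_primitive (n := 2 * k)
    (u := fun z => c ^ 2 * wP F z) (han hq) (analyticAt_const.mul hPa) hq0
    (by filter_upwards [hbn] with z hz; rw [(hq z hz).deriv, hQ z hz])
  refine ⟨fun t => ⟨_, hprim.isDeformationOn hF Metric.isOpen_ball t⟩, ?_, ?_⟩
  · obtain ⟨δ, hδ, hgood⟩ := Metric.eventually_nhds_iff_ball.1
      ((hpA.and (hfB.and hqC)).and hball)
    have hsub : puncturedDisc δ ⊆ Metric.ball 0 d := fun z hz =>
      (hgood z (puncturedDisc_subset_ball δ hz)).2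
    obtain ⟨Λ, hΛ, hmain⟩ := eventually_not_injOn hδ (hF.mono hsub)
      (fun z hz => hHne z ⟨hz.1, mem_ball_zero_iff.1 (hsub hz)⟩) (hprim.mono hsub)
      (a := 1) (k := k) (n := k + 1) (m := 2 * k + 1) (A := A') (B := B) (C := C)
      (P := wP F 0) (g := c) (Or.inl ⟨rfl, hk⟩) (by push_cast; ring) (by push_cast; ring)
      hA' hB hC (hP 0 h0b) hc0 (by simpa using hA0) (by simpa using hB0) (by simpa using hC0)
      (fun z hz => by
        rw [(hgood z (puncturedDisc_subset_ball δ hz)).1.1]; simp)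
      (fun z hz => (hgood z (puncturedDisc_subset_ball δ hz)).1.2.1)
      (fun z hz => (hgood z (puncturedDisc_subset_ball δ hz)).1.2.2)
    refine ⟨Λ, hΛ, fun μ hμ Y hY hYinj => ?_⟩
    obtain ⟨z, hz, z', hz', hne, heq⟩ := hmain μ hμ Y (hY.mono hsub)
    exact hne (hYinj (hsub hz) (hsub hz') heq)
  · intro Y hY
    -- Φ(τ, ζ) is the rescaled deformation with τ = μ^(-1/k), extended to τ = 0 by the limit
    -- surface. Its continuity at (0, ζ) is what gives locally uniform convergence.
    set Φ : ℝ × ℂ → E3 := fun x => ofPrim (x.2 * A' (x.1 * x.2)) (x.2 ^ (k + 1) * B (x.1 * x.2))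
      (x.2 ^ (2 * k + 1) * C (x.1 * x.2)) with hΦ
    have hΦc : ∀ ζ : ℂ, ContinuousAt Φ (0, ζ) := by
      intro ζ
      have hm : ContinuousAt (fun x : ℝ × ℂ => (x.1 : ℂ) * x.2) (0, ζ) := by fun_prop
      have hcomp : ∀ {G : ℂ → ℂ}, AnalyticAt ℂ G 0 →
          ContinuousAt (fun x : ℝ × ℂ => G (x.1 * x.2)) (0, ζ) := fun {G} hG =>
        ContinuousAt.comp (g := G) (f := fun x : ℝ × ℂ => (x.1 : ℂ) * x.2)
          (by simpa using hG.continuousAt) hm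
      exact continuousAt_ofPrim (continuousAt_snd.mul (hcomp hA'))
        ((continuousAt_snd.pow _).mul (hcomp hB)) ((continuousAt_snd.pow _).mul (hcomp hC))
    have hΦ0 : ∀ ζ, r • A (enneper k ζ) = Φ (0, ζ) := by
      intro ζ
      rw [enneper_eq_ofPrim, hA, smul_ofPrim]
      simp only [hΦ, Complex.ofReal_zero, zero_mul]
      -- The normalization P(0) = r conj c makes the leading coefficients of P, H, Q equal to r
      -- times conj c, 1 and c: the Enneper data turned about the vertical axis.
      have hcP : c * wP F 0 = r := by rw [h0, mul_left_comm, hcc, mul_one]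
      have hA0' : A' 0 = r * conj c := by simpa [h0] using hA0
      have hk1 : (k : ℂ) + 1 ≠ 0 := Nat.cast_add_one_ne_zero k
      have hk2 : (2 * (k : ℂ) + 1) ≠ 0 := by
        have := Nat.cast_add_one_ne_zero (R := ℂ) (2 * k)
        push_cast at this
        exact this
      have hB0' : B 0 = r / (k + 1) := by
        rw [eq_div_iff hk1, mul_comm, hB0, hcP]
      have hC0' : C 0 = c * r / (2 * k + 1) := by
        push_cast at hC0
        rw [eq_div_iff hk2, mul_comm, hC0, ← hcP]; ring
      rw [hA0', hB0', hC0']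
      congr 1 <;> ring
    have hlim := tendsto_rpow_neg_inv hk
    rw [tendstoLocallyUniformly_iff_forall_tendsto]
    intro ζ₀
    have hpair : Tendsto (fun y : ℝ × ℂ => (y.1 ^ (-(1 / (k : ℝ))), y.2)) (atTop ×ˢ 𝓝 ζ₀)
        (𝓝 ((0 : ℝ), ζ₀)) := by
      rw [nhds_prod_eq]
      exact hlim.prodMap tendsto_id
    have hprod : Tendsto (fun y : ℝ × ℂ => ((y.1 ^ (-(1 / (k : ℝ))) : ℝ) : ℂ) * y.2)
        (atTop ×ˢ 𝓝 ζ₀) (𝓝 0) := by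
      have hm : ContinuousAt (fun x : ℝ × ℂ => (x.1 : ℂ) * x.2) (0, ζ₀) := by fun_prop
      have := Tendsto.comp hm hpair
      simpa [Function.comp_def] using this
    have h1 : Tendsto (fun y : ℝ × ℂ => Φ (y.1 ^ (-(1 / (k : ℝ))), y.2)) (atTop ×ˢ 𝓝 ζ₀)
        (𝓝 (Φ (0, ζ₀))) := (hΦc ζ₀).tendsto.comp hpair
    have h2 : Tendsto (fun y : ℝ × ℂ => Φ (0, y.2)) (atTop ×ˢ 𝓝 ζ₀) (𝓝 (Φ (0, ζ₀))) := by
      have h3 : ContinuousAt (fun ζ : ℂ => Φ (0, ζ)) ζ₀ :=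
        ContinuousAt.comp (g := Φ) (f := fun ζ : ℂ => ((0 : ℝ), ζ)) (hΦc ζ₀) (by fun_prop)
      exact h3.tendsto.comp tendsto_snd
    have h3 := (h2.prodMk_nhds h1).mono_right (nhds_le_uniformity _)
    refine h3.congr' ?_
    have hμpos : ∀ᶠ y : ℝ × ℂ in atTop ×ˢ 𝓝 ζ₀, 0 < y.1 :=
      tendsto_fst.eventually (eventually_gt_atTop 0)
    filter_upwards [hμpos, hprod.eventually (hpA.and (hfB.and hqC)), hprod.eventually hball]
      with ⟨μ, ζ⟩ hμ hz hzb
    simp only at hμ hz hzb ⊢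
    rw [hΦ0]
    congr 1
    obtain ⟨b, hb⟩ := hprim.eq_on_ball hF hd hHne (hY μ hμ)
    rw [hb _ hzb, hb 0 h0b, add_sub_add_right_eq_sub, ofPrim_sub, smul_ofPrim, hp0, hf0, hq0,
      hz.1, hz.2.1, hz.2.2, rpow_one_add_inv k hμ]
    have hτk := rpow_neg_inv_pow_mul hk hμ
    have hτ0 : (μ ^ (-(1 / (k : ℝ)))) ≠ 0 := (Real.rpow_pos_of_pos hμ _).ne'
    set τ := μ ^ (-(1 / (k : ℝ))) with hτ
    have hτk' : (τ : ℂ) ^ k * μ = 1 := by exact_mod_cast hτk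
    have hτ0' : (τ : ℂ) ≠ 0 := by exact_mod_cast hτ0
    have hμ0' : (μ : ℂ) ≠ 0 := by exact_mod_cast hμ.ne'
    simp only [hΦ]
    push_cast
    congr 1
    · field_simp
      ring
    · field_simp
      linear_combination (-(τ : ℂ) * ζ * ζ ^ k * B (τ * ζ)) * hτk'
    · field_simp
      linear_combination (-(τ : ℂ) * ζ * ζ ^ (2 * k) * C (τ * ζ)) * (τ ^ k * μ + 1) * hτk'

/-! ### Adapted coordinates and changes of chart on a Riemann surface -/

theorem mem_contDiffGroupoid_iff_differentiableOn {T : OpenPartialHomeomorph ℂ ℂ} :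
    T ∈ contDiffGroupoid ω 𝓘(ℂ) ↔
      DifferentiableOn ℂ T T.source ∧ DifferentiableOn ℂ T.symm T.target := by
  rw [contDiffGroupoid, mem_groupoid_of_pregroupoid]
  simp only [contDiffPregroupoid, modelWithCornersSelf_coe, modelWithCornersSelf_coe_symm,
    Function.comp_id, Function.id_comp, preimage_id, range_id, inter_univ]
  exact and_congr
    ⟨fun h => h.differentiableOn (by simp), fun h => h.contDiffOn T.open_source⟩
    ⟨fun h => h.differentiableOn (by simp), fun h => h.contDiffOn T.open_target⟩

theorem deriv_ne_zero_of_differentiableOn {T : OpenPartialHomeomorph ℂ ℂ}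
    (h1 : DifferentiableOn ℂ T T.source) (h2 : DifferentiableOn ℂ T.symm T.target) {z : ℂ}
    (hz : z ∈ T.source) : deriv T z ≠ 0 := by
  have d1 := (h1.differentiableAt (T.open_source.mem_nhds hz)).hasDerivAt
  have d2 := (h2.differentiableAt (T.open_target.mem_nhds (T.map_source hz))).hasDerivAt
  have d3 := d2.comp z d1
  have d4 : HasDerivAt (T.symm ∘ T) 1 z :=
    (hasDerivAt_id z).congr_of_eventuallyEq (T.eventually_left_inverse hz)
  intro h0
  rw [h0, mul_zero] at d3
  exact zero_ne_one (d3.unique d4)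

/-- A holomorphic coordinate in which a function with a zero of order `k` is a multiple of the
`k`-th power. -/
theorem exists_coordinate {k : ℕ} (hk : 1 ≤ k) {h : ℂ → ℂ} {w₀ a : ℂ} (hh : AnalyticAt ℂ h w₀)
    (hh0 : h w₀ ≠ 0) (ha : a ≠ 0) {N : Set ℂ} (hN : N ∈ 𝓝 w₀) :
    ∃ (ψ : OpenPartialHomeomorph ℂ ℂ) (d : ℝ), 0 < d ∧ w₀ ∈ ψ.source ∧ ψ.source ⊆ N ∧ ψ w₀ = 0 ∧
      ψ.target = Metric.ball 0 d ∧ DifferentiableOn ℂ ψ ψ.source ∧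
      DifferentiableOn ℂ ψ.symm ψ.target ∧ deriv ψ.symm 0 = a⁻¹ ∧
      ∀ w ∈ ψ.source, (w - w₀) ^ k * h w = h w₀ / a ^ k * ψ w ^ k := by
  have hkc : (k : ℂ) ≠ 0 := by exact_mod_cast (by omega : k ≠ 0)
  -- This is the branch near w₀ of the k-th root of h / h(w₀) with value 1. With it, a (w - w₀) R is
  -- a coordinate with derivative a at w₀ whose k-th power is the desired function up to a constant.
  set R : ℂ → ℂ := fun w => (h w / h w₀) ^ (1 / k : ℂ) with hR
  have hRa : AnalyticAt ℂ R w₀ := by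
    refine (hh.div_const).cpow analyticAt_const ?_
    rw [div_self hh0]; simp
  have hR0 : R w₀ = 1 := by simp [hR, div_self hh0]
  have hRk : ∀ w, R w ^ k = h w / h w₀ := fun w => by
    rw [hR]
    simp only
    rw [one_div, Complex.cpow_nat_inv_pow _ (by omega)]
  set τ : ℂ → ℂ := fun w => (w - w₀) * (a * R w) with hτ
  have hτa : AnalyticAt ℂ τ w₀ := (analyticAt_id.sub analyticAt_const).mul
    (analyticAt_const.mul hRa)
  have hτ0 : τ w₀ = 0 := by simp [hτ]
  have hτd : HasDerivAt τ a w₀ := by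
    have h1 : HasDerivAt τ _ w₀ := ((hasDerivAt_id w₀).sub_const w₀).mul
      ((hRa.differentiableAt.hasDerivAt).const_mul a)
    exact h1.congr_deriv (by simp [hR0])
  have hcd : ContDiffAt ℂ 1 τ w₀ := hτa.contDiffAt
  have hτf : HasFDerivAt τ (ContinuousLinearEquiv.unitsEquivAut ℂ (Units.mk0 a ha) : ℂ →L[ℂ] ℂ)
      w₀ := by
    refine hτd.hasFDerivAt.congr_fderiv ?_
    ext; simp
  set φ := hcd.toOpenPartialHomeomorph τ hτf (by simp) with hφ
  have hφcoe : (φ : ℂ → ℂ) = τ := rfl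
  have hws : w₀ ∈ φ.source := hcd.mem_toOpenPartialHomeomorph_source hτf (by simp)
  have h0t : (0 : ℂ) ∈ φ.target := by rw [← hτ0]; exact φ.map_source hws
  have hs0 : φ.symm 0 = w₀ := by
    have := φ.left_inv hws
    rwa [hφcoe, hτ0] at this
  have hder : ContinuousAt (deriv τ) w₀ := hτa.deriv.continuousAt
  have hgood : ∀ᶠ w in 𝓝 w₀, w ∈ N ∧ DifferentiableAt ℂ τ w ∧ deriv τ w ≠ 0 :=
    (show ∀ᶠ w in 𝓝 w₀, w ∈ N from hN).and ((hτa.eventually_analyticAt.mono fun w hw => hw.differentiableAt).and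
      (hder.eventually_ne (by rw [hτd.deriv]; exact ha)))
  have hsymm : Tendsto φ.symm (𝓝 0) (𝓝 w₀) := by
    have := φ.continuousAt_symm h0t
    rwa [ContinuousAt, hs0] at this
  obtain ⟨d, hd, hball⟩ := Metric.eventually_nhds_iff_ball.1
    ((hsymm.eventually hgood).and (φ.open_target.mem_nhds h0t))
  -- Restricting the inverse map, rather than the map, makes the image exactly a disc.
  set ψ := (φ.symm.restrOpen (Metric.ball 0 d) Metric.isOpen_ball).symm with hψ
  have hψt : ψ.target = Metric.ball 0 d := by
    have : ψ.target = φ.symm.source ∩ Metric.ball 0 d := φ.symm.restrOpen_source _ Metric.isOpen_ball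
    rw [this]
    exact inter_eq_right.2 fun z hz => (hball z hz).2
  have hψcoe : (ψ : ℂ → ℂ) = τ := rfl
  have hψs : (ψ.symm : ℂ → ℂ) = φ.symm := rfl
  have h0b : (0 : ℂ) ∈ ψ.target := by rw [hψt]; exact Metric.mem_ball_self hd
  have hsrc : ∀ w ∈ ψ.source, w ∈ N ∧ DifferentiableAt ℂ τ w ∧ deriv τ w ≠ 0 := fun w hw => by
    have h1 := ψ.map_source hw
    rw [hψt] at h1
    have h2 := (hball _ h1).1
    rwa [← hψs, ψ.left_inv hw] at h2
  have hsd : ∀ z ∈ ψ.target, HasDerivAt ψ.symm (deriv τ (ψ.symm z))⁻¹ z := fun z hz => by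
    have h1 := hsrc _ (ψ.map_target hz)
    exact ψ.hasDerivAt_symm hz h1.2.2 h1.2.1.hasDerivAt
  have hw₀ : w₀ ∈ ψ.source := by
    have := ψ.map_target h0b
    rwa [hψs, hs0] at this
  refine ⟨ψ, d, hd, hw₀, fun w hw => (hsrc w hw).1, hτ0, hψt,
    fun w hw => (hsrc w hw).2.1.differentiableWithinAt,
    fun z hz => (hsd z hz).differentiableAt.differentiableWithinAt, ?_, fun w _ => ?_⟩
  · rw [(hsd 0 h0b).deriv, hψs, hs0, hτd.deriv]
  · rw [hψcoe, hτ]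
    simp only
    rw [mul_pow, mul_pow, hRk]
    field_simp

theorem wH_eq_zero_of_height_eq {F : ℂ → E3} {U : Set ℂ} (hF : IsWeierstrassOn F U)
    (hU : IsOpen U) {z : ℂ} (hz : z ∈ U) (h : ∀ᶠ w in 𝓝 z, F w 2 = F z 2) : wH F z = 0 := by
  have h1 := hasFDerivAt_height (hF.differentiableAt hU hz)
  have h2 : HasFDerivAt (fun w => F w 2) (0 : ℂ →L[ℝ] ℝ) z :=
    (hasFDerivAt_const (F z 2) z).congr_of_eventuallyEq h
  have h3 := h1.unique h2
  have a1 := DFunLike.congr_fun h3 1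
  have a2 := DFunLike.congr_fun h3 Complex.I
  simp at a1 a2
  exact Complex.ext a1 a2

section Overlap

variable {M : Type*} [TopologicalSpace M]

theorem isOpen_overlap (e e' : OpenPartialHomeomorph M ℂ) :
    IsOpen (e.target ∩ e.symm ⁻¹' e'.source) :=
  e.isOpen_inter_preimage_symm e'.open_source

theorem mapsTo_overlap (e e' : OpenPartialHomeomorph M ℂ) :
    MapsTo (e' ∘ e.symm) (e.target ∩ e.symm ⁻¹' e'.source) e'.target :=
  fun _ hz => e'.map_source hz.2

theorem eqOn_overlap (X : M → E3) (e e' : OpenPartialHomeomorph M ℂ) :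
    EqOn (X ∘ e.symm) ((X ∘ e'.symm) ∘ (e' ∘ e.symm)) (e.target ∩ e.symm ⁻¹' e'.source) :=
  fun z hz => by simp [e'.left_inv hz.2]

theorem eventually_height_eq {X : M → E3} {e : OpenPartialHomeomorph M ℂ} {q : M} {U : Set ℂ}
    (hF : IsWeierstrassOn (X ∘ e.symm) U) (hU : IsOpen U) (hc : IsPreconnected U)
    (hH : ∀ z ∈ U, wH (X ∘ e.symm) z = 0) (hq : q ∈ e.source) (hqU : e q ∈ U) :
    ∀ᶠ q' in 𝓝 q, X q' 2 = X q 2 := by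
  filter_upwards [(e.continuousAt hq).eventually (hU.mem_nhds hqU), e.open_source.mem_nhds hq]
    with q' hq'U hq'
  have := hF.height_const hU hc hH hq'U hqU
  simpa [e.left_inv hq', e.left_inv hq] using this

end Overlap

section Surface

variable {M : Type*} [TopologicalSpace M] [ChartedSpace ℂ M]

/-- `X` is given by Weierstrass data in all charts. -/
def IsWeierstrass (X : M → E3) : Prop :=
  ∀ e ∈ atlas ℂ M, IsWeierstrassOn (X ∘ e.symm) e.target

theorem IsConformalMinimalImmersion.isWeierstrass {X : M → E3}
    (h : IsConformalMinimalImmersion X) : IsWeierstrass X :=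
  fun e he => (h e he).isWeierstrassOn e.open_target

/-- The height function of a non-planar surface is nowhere locally constant. -/
theorem IsWeierstrass.not_eventually_wH_eq_zero [ConnectedSpace M] {X : M → E3}
    (hX : IsWeierstrass X) (hnp : ¬ IsPlanar (range X)) {e : OpenPartialHomeomorph M ℂ}
    (he : e ∈ atlas ℂ M) {p : M} (hp : p ∈ e.source) :
    ¬ ∀ᶠ z in 𝓝 (e p), wH (X ∘ e.symm) z = 0 := by
  intro h0
  -- S consists of the points near which the height is constant. It is closed because H vanishes
  -- throughout a chart disc as soon as it vanishes near one of its points.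
  set S : Set M := {q | ∀ᶠ q' in 𝓝 q, X q' 2 = X q 2} with hS
  have hSo : IsOpen S := by
    refine isOpen_iff_mem_nhds.2 fun q hq => ?_
    have hq' : ∀ᶠ q' in 𝓝 q, X q' 2 = X q 2 := hq
    filter_upwards [hq', hq'.eventually_nhds] with q' h1 h2
    change ∀ᶠ q'' in 𝓝 q', X q'' 2 = X q' 2
    rw [h1]
    exact h2
  have hSc : IsClosed S := by
    refine isClosed_of_closure_subset fun q hq => ?_
    set e' := chartAt ℂ q with he'
    have hq' : q ∈ e'.source := mem_chart_source ℂ q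
    have hW := hX e' (chart_mem_atlas ℂ q)
    obtain ⟨r, hr, hB⟩ := Metric.isOpen_iff.1 e'.open_target _ (e'.map_source hq')
    have hWB := hW.mono hB
    have hqB : e' q ∈ Metric.ball (e' q) r := Metric.mem_ball_self hr
    have hn : e'.source ∩ e' ⁻¹' Metric.ball (e' q) r ∈ 𝓝 q :=
      inter_mem (e'.open_source.mem_nhds hq')
        ((e'.continuousAt hq').preimage_mem_nhds (Metric.isOpen_ball.mem_nhds hqB))
    obtain ⟨q₁, ⟨hs1, hb1⟩, hS1⟩ := mem_closure_iff_nhds.1 hq _ hn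
    have hS1' : ∀ᶠ q' in 𝓝 q₁, X q' 2 = X q₁ 2 := hS1
    have hcont : Tendsto e'.symm (𝓝 (e' q₁)) (𝓝 q₁) := by
      have := e'.continuousAt_symm (e'.map_source hs1)
      rwa [ContinuousAt, e'.left_inv hs1] at this
    have h1 : ∀ᶠ z in 𝓝 (e' q₁), (X ∘ e'.symm) z 2 = X q₁ 2 := hcont.eventually hS1'
    have h2 : ∀ᶠ z in 𝓝 (e' q₁), wH (X ∘ e'.symm) z = 0 := by
      filter_upwards [h1.eventually_nhds, h1, Metric.isOpen_ball.mem_nhds hb1] with z a1 a2 a3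
      refine wH_eq_zero_of_height_eq hWB Metric.isOpen_ball a3 ?_
      rw [a2]
      exact a1
    exact eventually_height_eq hWB Metric.isOpen_ball (convex_ball _ _).isPreconnected
      (hWB.wH_eq_zero Metric.isOpen_ball (convex_ball _ _).isPreconnected hb1 h2) hq' hqB
  have hpS : p ∈ S := by
    obtain ⟨r, hr, hB⟩ := Metric.eventually_nhds_iff_ball.1
      (h0.and (e.open_target.mem_nhds (e.map_source hp)))
    exact eventually_height_eq ((hX e he).mono fun z hz => (hB z hz).2) Metric.isOpen_ball
      (convex_ball _ _).isPreconnected (fun z hz => (hB z hz).1) hp (Metric.mem_ball_self hr)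
  have huniv : S = univ := IsClopen.eq_univ ⟨hSc, hSo⟩ ⟨p, hpS⟩
  have hlc : IsLocallyConstant fun q => X q 2 := by
    refine (IsLocallyConstant.iff_eventually_eq _).2 fun q => ?_
    have : q ∈ S := by rw [huniv]; exact mem_univ q
    exact this
  refine hnp (isPlanar_of_height_eq (c := X p 2) ?_)
  rintro _ ⟨q, rfl⟩
  exact hlc.apply_eq_of_preconnectedSpace q p

section Transition

variable {e e' : OpenPartialHomeomorph M ℂ}

theorem differentiableOn_transition [IsManifold 𝓘(ℂ) ω M]
    (he : e ∈ IsManifold.maximalAtlas 𝓘(ℂ) ω M) (he' : e' ∈ IsManifold.maximalAtlas 𝓘(ℂ) ω M) :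
    DifferentiableOn ℂ (e' ∘ e.symm) (e.target ∩ e.symm ⁻¹' e'.source) :=
  (mem_contDiffGroupoid_iff_differentiableOn.1
    (IsManifold.compatible_of_mem_maximalAtlas he he')).1

theorem deriv_transition_ne_zero [IsManifold 𝓘(ℂ) ω M]
    (he : e ∈ IsManifold.maximalAtlas 𝓘(ℂ) ω M) (he' : e' ∈ IsManifold.maximalAtlas 𝓘(ℂ) ω M) :
    ∀ z ∈ e.target ∩ e.symm ⁻¹' e'.source, deriv (e' ∘ e.symm) z ≠ 0 := fun z hz => by
  have h := mem_contDiffGroupoid_iff_differentiableOn.1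
    (IsManifold.compatible_of_mem_maximalAtlas he he')
  exact deriv_ne_zero_of_differentiableOn h.1 h.2 (z := z) hz

end Transition

variable [IsManifold 𝓘(ℂ) ω M] {X : M → E3} {e e' : OpenPartialHomeomorph M ℂ}

theorem IsWeierstrass.normalAt_eq (hX : IsWeierstrass X) (he : e ∈ atlas ℂ M) {q : M}
    (hq : q ∈ e.source) : normalAt X q = unitNormal (X ∘ e.symm) (e q) := by
  set e' := chartAt ℂ q with he'
  have hq' : q ∈ e'.source := mem_chart_source ℂ q
  have m := IsManifold.subset_maximalAtlas (I := 𝓘(ℂ)) (n := ω) he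
  have m' := IsManifold.chart_mem_maximalAtlas (I := 𝓘(ℂ)) (n := ω) q
  have hz : e' q ∈ e'.target ∩ e'.symm ⁻¹' e.source :=
    ⟨e'.map_source hq', by rw [mem_preimage, e'.left_inv hq']; exact hq⟩
  have hn := (isOpen_overlap e' e).mem_nhds hz
  have hτ := ((differentiableOn_transition m' m).differentiableAt hn).hasDerivAt
  have hval : (e ∘ e'.symm) (e' q) = e q := by simp [e'.left_inv hq']
  have hF : DifferentiableAt ℝ (X ∘ e.symm) ((e ∘ e'.symm) (e' q)) := by
    rw [hval]
    exact (hX e he).differentiableAt e.open_target (e.map_source hq)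
  have h1 := unitNormal_comp hτ (deriv_transition_ne_zero m' m _ hz) hF
  rw [hval] at h1
  rw [← h1]
  exact unitNormal_congr ((eqOn_overlap X e' e).eventuallyEq_of_mem hn)

/-- The surface conditions are stated for charts of the atlas, whereas the adapted coordinate lies
only in the maximal atlas. This lemma and the next two carry data and deformations across the
transition map. -/
theorem IsWeierstrass.isWeierstrassOn (hX : IsWeierstrass X) (he' : e' ∈ atlas ℂ M)
    (he : e ∈ IsManifold.maximalAtlas 𝓘(ℂ) ω M) (hs : e.source ⊆ e'.source) :
    IsWeierstrassOn (X ∘ e.symm) e.target := by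
  have m' := IsManifold.subset_maximalAtlas (I := 𝓘(ℂ)) (n := ω) he'
  have hV : e.target ∩ e.symm ⁻¹' e'.source = e.target :=
    inter_eq_left.2 fun z hz => hs (e.map_target hz)
  have h := ((hX e' he').comp e'.open_target (isOpen_overlap e e')
    (differentiableOn_transition he m') (deriv_transition_ne_zero he m')
    (mapsTo_overlap e e')).congr (isOpen_overlap e e') (eqOn_overlap X e e')
  rwa [hV] at h

theorem IsWeierstrass.isDeformation (hX : IsWeierstrassOn (X ∘ e.symm) e.target)
    (he : e ∈ IsManifold.maximalAtlas 𝓘(ℂ) ω M) {t : ℝ} {Y : ℂ → E3}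
    (hY : IsDeformationOn t (X ∘ e.symm) e.target Y) : IsDeformation t X e.source (Y ∘ e) :=
  fun e' he' => by
    have m' := IsManifold.subset_maximalAtlas (I := 𝓘(ℂ)) (n := ω) he'
    exact (hY.comp hX e.open_target (isOpen_overlap e' e) (differentiableOn_transition m' he)
      (deriv_transition_ne_zero m' he) (mapsTo_overlap e' e)).congr (isOpen_overlap e' e)
      (eqOn_overlap X e' e) fun _ _ => rfl

theorem IsWeierstrass.isDeformationOn (hX : IsWeierstrass X) (he' : e' ∈ atlas ℂ M)
    (he : e ∈ IsManifold.maximalAtlas 𝓘(ℂ) ω M) (hs : e.source ⊆ e'.source) {t : ℝ} {Y : M → E3}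
    (hY : IsDeformation t X e.source Y) :
    IsDeformationOn t (X ∘ e.symm) e.target (Y ∘ e.symm) := by
  have m' := IsManifold.subset_maximalAtlas (I := 𝓘(ℂ)) (n := ω) he'
  have hV : e.target ∩ e.symm ⁻¹' e'.source = e.target :=
    inter_eq_left.2 fun z hz => hs (e.map_target hz)
  have hm : MapsTo (e' ∘ e.symm) (e.target ∩ e.symm ⁻¹' e'.source)
      (e'.target ∩ e'.symm ⁻¹' e.source) := fun z hz =>
    ⟨e'.map_source hz.2, by
      simp only [mem_preimage, Function.comp_apply, e'.left_inv hz.2]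
      exact e.map_target hz.1⟩
  have h := ((hY e' he').comp ((hX e' he').mono inter_subset_left) (isOpen_overlap e' e)
    (isOpen_overlap e e') (differentiableOn_transition he m') (deriv_transition_ne_zero he m')
    hm).congr (isOpen_overlap e e') (eqOn_overlap X e e') (eqOn_overlap Y e e')
  rwa [hV] at h

end Surface

/-- The factor by which a coordinate has to be scaled in order to normalize the data. -/
theorem exists_scale {k : ℕ} (hk : 1 ≤ k) {P g : ℂ} (hP : P ≠ 0) (hg : g ≠ 0) :
    ∃ (a : ℂ) (r : ℝ), a ≠ 0 ∧ 0 < r ∧ ‖g / a ^ k‖ = 1 ∧ P / a = r * conj (g / a ^ k) := by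
  have hg' : 0 < ‖g‖ := norm_pos_iff.2 hg
  set ρ : ℝ := ‖g‖ ^ (1 / k : ℝ) with hρ
  have hρ0 : 0 < ρ := Real.rpow_pos_of_pos hg' _
  have hρk : ρ ^ k = ‖g‖ := by
    rw [hρ, one_div, Real.rpow_inv_natCast_pow hg'.le (by omega)]
  -- With |a|^k = |g| and a^(k+1) = P g / r, the constant c = g / a^k has modulus 1 and c P / a = r
  -- > 0. This value of r makes the two conditions on |a| compatible.
  set r : ℝ := ‖P * g‖ / ρ ^ (k + 1) with hr
  have hPg : 0 < ‖P * g‖ := norm_pos_iff.2 (mul_ne_zero hP hg)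
  have hr0 : 0 < r := div_pos hPg (pow_pos hρ0 _)
  have hrc : (r : ℂ) ≠ 0 := by exact_mod_cast hr0.ne'
  obtain ⟨a, ha⟩ := IsAlgClosed.exists_pow_nat_eq (P * g / r) (Nat.succ_pos k)
  have hna : ‖a‖ = ρ := by
    have h1 : ‖a‖ ^ (k + 1) = ρ ^ (k + 1) := by
      rw [← norm_pow, ha, norm_div, Complex.norm_of_nonneg hr0.le, hr]
      field_simp
    exact (pow_left_inj₀ (norm_nonneg a) hρ0.le (Nat.succ_ne_zero k)).1 h1
  have ha0 : a ≠ 0 := norm_pos_iff.1 (by rw [hna]; exact hρ0)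
  have hc : ‖g / a ^ k‖ = 1 := by
    rw [norm_div, norm_pow, hna, hρk, div_self hg'.ne']
  refine ⟨a, r, ha0, hr0, hc, ?_⟩
  set c := g / a ^ k with hcd
  have hcc : c * conj c = 1 := by
    rw [Complex.mul_conj, Complex.normSq_eq_norm_sq, hc]; simp
  have hc0 : c ≠ 0 := norm_pos_iff.1 (by rw [hc]; exact one_pos)
  refine mul_left_cancel₀ hc0 ?_
  rw [mul_left_comm, hcc, mul_one, hcd, div_mul_div_comm, ← pow_succ, ha]
  field_simp

section Surface

variable {M : Type*} [TopologicalSpace M] [ChartedSpace ℂ M] [IsManifold 𝓘(ℂ) ω M]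

theorem trans_mem_maximalAtlas {e : OpenPartialHomeomorph M ℂ}
    (he : e ∈ IsManifold.maximalAtlas 𝓘(ℂ) ω M) {ψ : OpenPartialHomeomorph ℂ ℂ}
    (hψ : ψ ∈ contDiffGroupoid ω 𝓘(ℂ)) : e.trans ψ ∈ IsManifold.maximalAtlas 𝓘(ℂ) ω M := by
  intro e' he'
  have m' := IsManifold.subset_maximalAtlas (I := 𝓘(ℂ)) (n := ω) he'
  constructor
  · rw [OpenPartialHomeomorph.trans_symm_eq_symm_trans_symm, OpenPartialHomeomorph.trans_assoc]
    exact (contDiffGroupoid ω 𝓘(ℂ)).trans ((contDiffGroupoid ω 𝓘(ℂ)).symm hψ)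
      (IsManifold.compatible_of_mem_maximalAtlas he m')
  · rw [← OpenPartialHomeomorph.trans_assoc]
    exact (contDiffGroupoid ω 𝓘(ℂ)).trans (IsManifold.compatible_of_mem_maximalAtlas m' he) hψ

/-- This is the case of normal (0, 0, -1). The numbers k, r and the rotation come from the leading
coefficients of P and H / P at p, so they are fixed before the neighbourhood V is chosen. -/
theorem surface_deformation [ConnectedSpace M] {X : M → E3} (hX : IsWeierstrass X)
    (hnp : ¬ IsPlanar (range X)) {p : M} (hN : normalAt X p = -e3) :
    ∃ (k : ℕ) (r : ℝ) (A : E3 ≃ₗᵢ[ℝ] E3), 1 ≤ k ∧ 0 < r ∧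
      LinearMap.det (A.toLinearEquiv : E3 →ₗ[ℝ] E3) = 1 ∧ A e3 = e3 ∧
      ∀ V ∈ 𝓝 p, ∃ e ∈ IsManifold.maximalAtlas 𝓘(ℂ) ω M,
        p ∈ e.source ∧ e.source ⊆ V ∧ e p = 0 ∧
        (∃ d > 0, e.target = Metric.ball (0 : ℂ) d) ∧
        (∃ c : ℂ, ‖c‖ = 1 ∧ ∀ q ∈ e.source, stereo (normalAt X q) = c * e q ^ k) ∧
        (∀ t : ℝ, ∃ Y : M → E3, IsDeformation t X e.source Y) ∧
        (∃ Λ > 0, ∀ μ : ℝ, Λ ≤ μ → ∀ Y : M → E3,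
          IsDeformation μ X e.source Y → ¬ InjOn Y e.source) ∧
        ∀ Y : ℝ → M → E3,
          (∀ t : ℝ, 0 < t → IsDeformation t X e.source (Y t)) →
          TendstoLocallyUniformly
            (fun (μ : ℝ) (ζ : ℂ) => (μ ^ (1 + 1 / (k : ℝ)) : ℝ) •
              (Y μ (e.symm (((μ ^ (-(1 / (k : ℝ))) : ℝ) : ℂ) * ζ)) - Y μ p))
            (fun ζ => r • A (enneper k ζ)) atTop := by
  set e₀ := chartAt ℂ p with he₀
  have ha₀ : e₀ ∈ atlas ℂ M := chart_mem_atlas ℂ p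
  have hm₀ := IsManifold.chart_mem_maximalAtlas (I := 𝓘(ℂ)) (n := ω) p
  have hp₀ : p ∈ e₀.source := mem_chart_source ℂ p
  set F₀ := X ∘ e₀.symm with hF₀
  set w₀ := e₀ p with hw₀
  have hF := hX e₀ ha₀
  have hw₀t : w₀ ∈ e₀.target := e₀.map_source hp₀
  have htn := e₀.open_target.mem_nhds hw₀t
  have hne := hX.not_eventually_wH_eq_zero hnp ha₀ hp₀
  have hN' : unitNormal F₀ w₀ = -e3 := by rw [← hX.normalAt_eq ha₀ hp₀, hN]
  have hH0 : wH F₀ w₀ = 0 := (isVertical_iff (hF.conf _ hw₀t)).1 (Or.inr hN')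
  have hP0 : wP F₀ w₀ ≠ 0 := wP_ne_zero (hF.conf _ hw₀t) (by
    rw [hN']
    simp
    norm_num)
  have hPa : AnalyticAt ℂ (wP F₀) w₀ := hF.holP.analyticAt htn
  have hHa : AnalyticAt ℂ (wH F₀) w₀ := hF.holH.analyticAt htn
  have hPne : ∀ᶠ w in 𝓝 w₀, wP F₀ w ≠ 0 := hPa.continuousAt.eventually_ne hP0
  obtain ⟨k, h, hh, hh0, hgk⟩ :=
    (hHa.div hPa hP0).exists_eventuallyEq_pow_smul_nonzero_iff.2 (fun h0 => hne (by
      filter_upwards [h0, hPne] with w h1 h2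
      exact (div_eq_zero_iff.1 h1).resolve_right h2))
  have hk : 1 ≤ k := by
    rcases Nat.eq_zero_or_pos k with rfl | hk
    · have := hgk.self_of_nhds
      simp [hH0] at this
      exact absurd this.symm hh0
    · exact hk
  obtain ⟨a, r, ha, hr, hc, hPr⟩ := exists_scale hk hP0 hh0
  set c := h w₀ / a ^ k with hcd
  obtain ⟨A, hdet, hAe, hA⟩ := exists_rotation (u := conj c) (by rw [RCLike.norm_conj, hc])
  rw [Complex.conj_conj] at hA
  refine ⟨k, r, A, hk, hr, hdet, hAe, fun V hV => ?_⟩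
  have hVn : ∀ᶠ w in 𝓝 w₀, e₀.symm w ∈ V := by
    have := e₀.continuousAt_symm hw₀t
    rw [ContinuousAt, hw₀, e₀.left_inv hp₀] at this
    exact this hV
  have htn' : ∀ᶠ w in 𝓝 w₀, w ∈ e₀.target := htn
  obtain ⟨ψ, d, hd, hwψ, hψN, hψ0, hψt, hψd, hψsd, hψa, hψk⟩ :=
    exists_coordinate hk hh hh0 ha ((htn'.and hVn).and (hPne.and hgk))
  have hψG : ψ ∈ contDiffGroupoid ω 𝓘(ℂ) :=
    mem_contDiffGroupoid_iff_differentiableOn.2 ⟨hψd, hψsd⟩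
  set e := e₀.trans ψ with he
  have hem : e ∈ IsManifold.maximalAtlas 𝓘(ℂ) ω M := trans_mem_maximalAtlas hm₀ hψG
  have hsrc : ∀ q ∈ e.source, q ∈ e₀.source ∧ e₀ q ∈ ψ.source := fun q hq => by
    rwa [he, OpenPartialHomeomorph.trans_source] at hq
  have hsub : e.source ⊆ e₀.source := fun q hq => (hsrc q hq).1
  have hpe : p ∈ e.source := by
    rw [he, OpenPartialHomeomorph.trans_source]
    exact ⟨hp₀, hwψ⟩
  have htar : e.target = Metric.ball 0 d := by
    rw [he, OpenPartialHomeomorph.trans_target, hψt]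
    refine inter_eq_left.2 fun z hz => (hψN (ψ.map_target (by rwa [hψt]))).1.1
  have hep : e p = 0 := hψ0
  have hes0 : e.symm 0 = p := by rw [← hep, e.left_inv hpe]
  have hψs0 : ψ.symm 0 = w₀ := by rw [← hψ0, ψ.left_inv hwψ]
  have hmodel : ∀ w ∈ ψ.source, wH F₀ w = c * ψ w ^ k * wP F₀ w := fun w hw => by
    have h1 := (hψN hw).2
    have h2 : wH F₀ w / wP F₀ w = (w - w₀) ^ k * h w := h1.2
    rw [hψk w hw] at h2
    rwa [div_eq_iff h1.1] at h2
  have hW : IsWeierstrassOn (X ∘ e.symm) (Metric.ball 0 d) := by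
    rw [← htar]; exact hX.isWeierstrassOn ha₀ hem hsub
  have hcomp : ∀ z ∈ Metric.ball (0 : ℂ) d, ψ.symm z ∈ ψ.source ∧
      wP (X ∘ e.symm) z = wP F₀ (ψ.symm z) * deriv ψ.symm z ∧
      wH (X ∘ e.symm) z = wH F₀ (ψ.symm z) * deriv ψ.symm z := fun z hz => by
    have hzt : z ∈ ψ.target := by rwa [hψt]
    have hs := ψ.map_target hzt
    have hτ := (hψsd.differentiableAt (ψ.open_target.mem_nhds hzt)).hasDerivAt
    have hFd := hF.differentiableAt e₀.open_target (hψN hs).1.1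
    exact ⟨hs, wP_comp hτ hFd, wH_comp hτ hFd⟩
  have hder : ∀ z ∈ Metric.ball (0 : ℂ) d, deriv ψ.symm z ≠ 0 := fun z hz =>
    deriv_ne_zero_of_differentiableOn (T := ψ.symm) hψsd hψd (by rwa [← hψt] at hz)
  obtain ⟨hex, ⟨Λ, hΛ, hninj⟩, hlim⟩ := deformation_local_model (F := X ∘ e.symm) (r := r) hd hk hW
    (fun z hz => by
      rw [(hcomp z hz).2.1]
      exact mul_ne_zero (hψN (hcomp z hz).1).2.1 (hder z hz))
    (fun z hz => by
      rw [(hcomp z hz).2.1, (hcomp z hz).2.2, hmodel _ (hcomp z hz).1,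
        ψ.right_inv (by rwa [hψt])]
      ring)
    hc (by
      rw [(hcomp 0 (Metric.mem_ball_self hd)).2.1, hψs0, hψa, ← hPr, div_eq_mul_inv]) hA
  have hdef : ∀ {t : ℝ} {Y : M → E3}, IsDeformation t X e.source Y →
      IsDeformationOn t (X ∘ e.symm) (Metric.ball 0 d) (Y ∘ e.symm) := fun hY => by
    rw [← htar]; exact hX.isDeformationOn ha₀ hem hsub hY
  refine ⟨e, hem, hpe, fun q hq => ?_, hep, ⟨d, hd, htar⟩, ⟨c, hc, fun q hq => ?_⟩, fun t => ?_,
    ⟨Λ, hΛ, fun μ hμ Y hY hinj => ?_⟩, fun Y hY => ?_⟩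
  · have := (hψN (hsrc q hq).2).1.2
    rwa [e₀.left_inv (hsub hq)] at this
  · have hs := hsrc q hq
    rw [hX.normalAt_eq ha₀ hs.1, stereo_unitNormal (hF.conf _ (e₀.map_source hs.1)),
      hmodel _ hs.2, mul_div_assoc, div_self (hψN hs.2).2.1, mul_one]
    rfl
  · obtain ⟨Y, hY⟩ := hex t
    rw [← htar] at hW hY
    exact ⟨Y ∘ e, IsWeierstrass.isDeformation hW hem hY⟩
  · refine hninj μ hμ _ (hdef hY) (hinj.comp ?_ ?_)
    · rw [← htar]; exact e.symm.injOn
    · intro z hz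
      rw [← htar] at hz
      exact e.map_target hz
  · have := hlim (fun t => Y t ∘ e.symm) (fun t ht => hdef (hY t ht))
    simpa only [Function.comp_apply, hes0] using this

end Surface

/-! ### The half-turn that exchanges zeros and poles of the Gauss map -/

/-- `A` is the half-turn about the first coordinate axis. -/
def IsHalfTurn (A : E3 ≃ₗᵢ[ℝ] E3) : Prop :=
  ∀ x, A x 0 = x 0 ∧ A x 1 = -x 1 ∧ A x 2 = -x 2

/-- For n off the axis this is |n₁ + i n₂|² = (1 - n₃)(1 + n₃). At both poles all values are 0 by
convention, so no exception is needed. -/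
theorem stereo_halfTurn {A : E3 ≃ₗᵢ[ℝ] E3} (hA : IsHalfTurn A) {n : E3}
    (hn : n 0 ^ 2 + n 1 ^ 2 + n 2 ^ 2 = 1) : stereo (A n) = (stereo n)⁻¹ := by
  obtain ⟨h0, h1, h2⟩ := hA n
  rw [stereo, stereo, h0, h1, h2, inv_div]
  push_cast
  by_cases hz : (n 0 : ℂ) + Complex.I * n 1 = 0
  · have a0 := congrArg Complex.re hz
    have a1 := congrArg Complex.im hz
    simp at a0 a1
    simp [a0, a1]
  · have hs : ((n 0 : ℂ)) ^ 2 + (n 1 : ℂ) ^ 2 + (n 2 : ℂ) ^ 2 = 1 := by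
      simpa using congrArg (fun x : ℝ => (x : ℂ)) hn
    have h3 : (1 : ℂ) + n 2 ≠ 0 := by
      intro h
      have h' : 1 + n 2 = 0 := by simpa using congrArg Complex.re h
      have e0 : n 0 = 0 := by nlinarith [sq_nonneg (n 0), sq_nonneg (n 1)]
      have e1 : n 1 = 0 := by nlinarith [sq_nonneg (n 0), sq_nonneg (n 1)]
      exact hz (by simp [e0, e1])
    rw [sub_neg_eq_add, div_eq_div_iff h3 hz]
    linear_combination hs - (n 1 : ℂ) ^ 2 * Complex.I_sq

section HalfTurn

variable {A : E3 ≃ₗᵢ[ℝ] E3} {F : ℂ → E3} {U : Set ℂ} {z : ℂ}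

theorem du_isometry : du (A ∘ F) z = A (du F z) := by
  rw [du, du, A.comp_fderiv]; rfl

theorem dv_isometry : dv (A ∘ F) z = A (dv F z) := by
  rw [dv, dv, A.comp_fderiv]; rfl

namespace IsHalfTurn

theorem involutive (hA : IsHalfTurn A) (x : E3) : A (A x) = x :=
  ext_E3 (by rw [(hA _).1, (hA _).1]) (by rw [(hA _).2.1, (hA _).2.1, neg_neg])
    (by rw [(hA _).2.2, (hA _).2.2, neg_neg])

theorem apply_e3 (hA : IsHalfTurn A) : A e3 = -e3 :=
  ext_E3 (by rw [(hA _).1]; simp) (by rw [(hA _).2.1]; simp) (by rw [(hA _).2.2]; simp)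

theorem cross (hA : IsHalfTurn A) (a b : E3) : LopezRos.cross (A a) (A b) = A (cross a b) := by
  obtain ⟨a0, a1, a2⟩ := hA a
  obtain ⟨b0, b1, b2⟩ := hA b
  obtain ⟨c0, c1, c2⟩ := hA (LopezRos.cross a b)
  refine ext_E3 ?_ ?_ ?_
  · rw [c0, cross_zero, cross_zero, a1, a2, b1, b2]; ring
  · rw [c1, cross_one, cross_one, a0, a2, b0, b2]; ring
  · rw [c2, cross_two, cross_two, a0, a1, b0, b1]; ring

theorem unitNormal (hA : IsHalfTurn A) :
    LopezRos.unitNormal (A ∘ F) z = A (LopezRos.unitNormal F z) := by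
  rw [LopezRos.unitNormal, LopezRos.unitNormal, du_isometry, dv_isometry, hA.cross, map_smul,
    A.norm_map]

theorem complexVelocity (hA : IsHalfTurn A) :
    LopezRos.complexVelocity (A ∘ F) z =
      ![LopezRos.complexVelocity F z 0, -LopezRos.complexVelocity F z 1,
        -LopezRos.complexVelocity F z 2] := by
  funext j
  simp only [LopezRos.complexVelocity, du_isometry, dv_isometry]
  fin_cases j
  · simp [(hA _).1]
  · simp [(hA _).2.1]; ring
  · simp [(hA _).2.2]; ring

/-- The half-turn sends (P, Q, H) to (-Q, -P, -H), hence g to 1/g. Replacing P, Q by P/t, t Q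
therefore becomes the deformation with parameter 1/t. -/
theorem wP (hA : IsHalfTurn A) : LopezRos.wP (A ∘ F) z = -wQ F z := by
  simp [LopezRos.wP, wQ, hA.complexVelocity]

theorem wQ (hA : IsHalfTurn A) : LopezRos.wQ (A ∘ F) z = -LopezRos.wP F z := by
  simp [LopezRos.wP, LopezRos.wQ, hA.complexVelocity]; ring

theorem wH (hA : IsHalfTurn A) : LopezRos.wH (A ∘ F) z = -LopezRos.wH F z := by
  simp [LopezRos.wH, hA.complexVelocity]

theorem isWeierstrassOn (hA : IsHalfTurn A) (h : IsWeierstrassOn F U) :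
    IsWeierstrassOn (A ∘ F) U := by
  refine ⟨A.contDiff.comp_contDiffOn h.smooth, fun j => ?_, fun z hz => ?_⟩
  · simp only [hA.complexVelocity]
    fin_cases j
    · exact h.hol 0
    · exact (h.hol 1).neg
    · exact (h.hol 2).neg
  · have hc := h.conf z hz
    refine ⟨?_, ?_, ?_⟩
    · rw [du_isometry, dv_isometry, A.norm_map, A.norm_map, hc.norm_eq]
    · rw [du_isometry, dv_isometry, A.inner_map_map, hc.orth]
    · rw [du_isometry]
      exact fun h0 => hc.ne (A.map_eq_zero_iff.1 h0)

theorem isDeformationOn (hA : IsHalfTurn A) (h : IsWeierstrassOn F U) {t : ℝ} {Y : ℂ → E3}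
    (hY : IsDeformationOn t F U Y) : IsDeformationOn t⁻¹ (A ∘ F) U (A ∘ Y) := by
  rw [h.isDeformationOn_iff] at hY
  rw [(hA.isWeierstrassOn h).isDeformationOn_iff]
  refine ⟨A.contDiff.comp_contDiffOn hY.1, fun z hz hHz => ?_⟩
  rw [hA.wH] at hHz
  rw [hA.wH, hA.wP, hA.wQ, hA.complexVelocity, hY.2 z hz (neg_ne_zero.1 hHz)]
  funext j
  fin_cases j
  · simp [formVec]; ring
  · simp [formVec]; ring
  · simp [formVec]

theorem not_isPlanar (hA : IsHalfTurn A) {S : Set E3} (h : ¬ IsPlanar S) :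
    ¬ IsPlanar (A '' S) := by
  rintro ⟨n, c, hn, hc⟩
  refine h ⟨A n, c, fun h0 => hn (A.map_eq_zero_iff.1 h0), fun x hx => ?_⟩
  rw [← hc _ (mem_image_of_mem A hx), ← A.inner_map_map (A n) x, hA.involutive]

theorem isCompleteAtPuncture {ε : ℝ} (h : IsCompleteAtPuncture F ε) :
    IsCompleteAtPuncture (A ∘ F) ε := fun γ h1 h2 h3 => by
  rw [← h γ h1 h2 h3]
  refine lintegral_congr fun t => ?_
  have : deriv ((A ∘ F) ∘ γ) t = A (deriv (F ∘ γ) t) := by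
    rw [← fderiv_apply_one_eq_deriv, ← fderiv_apply_one_eq_deriv, Function.comp_assoc, A.comp_fderiv]; rfl
  rw [this, ← ofReal_norm, ← ofReal_norm, A.norm_map]

theorem hasLogarithmicGrowth (hA : IsHalfTurn A) (h : HasLogarithmicGrowth F 0) :
    HasLogarithmicGrowth (A ∘ F) 0 := by
  obtain ⟨β, γ₁, γ₂, C, R, h⟩ := h
  refine ⟨-β, -γ₁, γ₂, C, R, ?_⟩
  filter_upwards [h] with z hz
  obtain ⟨a0, a1, a2⟩ := hA (F z)
  have hρ : rho ((A ∘ F) z) = rho (F z) := by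
    rw [rho, rho, Function.comp_apply, a0, a1, neg_sq]
  rw [hρ]
  intro hr
  refine le_trans (le_of_eq ?_) (hz hr)
  rw [Function.comp_apply, a0, a1, a2, ← abs_neg]
  congr 1
  ring

section Surface

variable {M : Type*} [TopologicalSpace M] [ChartedSpace ℂ M] {X : M → E3}

theorem isWeierstrass (hA : IsHalfTurn A) (h : IsWeierstrass X) : IsWeierstrass (A ∘ X) :=
  fun e he => hA.isWeierstrassOn (h e he)

theorem isDeformation (hA : IsHalfTurn A) (h : IsWeierstrass X) {t : ℝ} {V : Set M} {Y : M → E3}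
    (hY : IsDeformation t X V Y) : IsDeformation t⁻¹ (A ∘ X) V (A ∘ Y) :=
  fun e he => hA.isDeformationOn ((h e he).mono inter_subset_left) (hY e he)

theorem normalAt (hA : IsHalfTurn A) (p : M) :
    LopezRos.normalAt (A ∘ X) p = A (LopezRos.normalAt X p) :=
  hA.unitNormal (F := X ∘ (chartAt ℂ p).symm)

end Surface

end IsHalfTurn
end HalfTurn

end LopezRos

end

/-- `s = 1` is the case of a zero of the stereographic Gauss map `g` (normal `(0, 0, -1)`,
parameter `t = μ` large), and `s = -1` that of a pole (normal `(0, 0, 1)`, parameter `t = 1 / μ`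
small). -/
theorem proposition3p4 {M : Type*} [TopologicalSpace M] [T2Space M] [ConnectedSpace M]
    [ChartedSpace ℂ M] [IsManifold 𝓘(ℂ) ω M] :
    (∀ X : M → LopezRos.E3, LopezRos.IsConformalMinimalImmersion X →
      ¬ LopezRos.IsPlanar (range X) →
      ∀ (p : M) (s : ℤ), s = 1 ∨ s = -1 → LopezRos.normalAt X p = -(s : ℝ) • LopezRos.e3 →
      ∃ (k : ℕ) (r : ℝ) (A : LopezRos.E3 ≃ₗᵢ[ℝ] LopezRos.E3),
        1 ≤ k ∧ 0 < r ∧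
        LinearMap.det (A.toLinearEquiv : LopezRos.E3 →ₗ[ℝ] LopezRos.E3) = 1 ∧
        A LopezRos.e3 = (s : ℝ) • LopezRos.e3 ∧
        ∀ V ∈ 𝓝 p, ∃ e ∈ IsManifold.maximalAtlas 𝓘(ℂ) ω M,
          p ∈ e.source ∧ e.source ⊆ V ∧ e p = 0 ∧
          (∃ d > 0, e.target = Metric.ball (0 : ℂ) d) ∧
          (∃ c : ℂ, ‖c‖ = 1 ∧ ∀ q ∈ e.source, q ≠ p →
            LopezRos.stereo (LopezRos.normalAt X q) ^ s = c * e q ^ k) ∧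
          (∀ t : ℝ, 0 < t → ∃ Y : M → LopezRos.E3, LopezRos.IsDeformation t X e.source Y) ∧
          (∃ Λ > 0, ∀ μ : ℝ, Λ ≤ μ → ∀ Y : M → LopezRos.E3,
            LopezRos.IsDeformation (μ ^ s) X e.source Y → ¬ InjOn Y e.source) ∧
          ∀ Y : ℝ → M → LopezRos.E3,
            (∀ t : ℝ, 0 < t → LopezRos.IsDeformation t X e.source (Y t)) →
            TendstoLocallyUniformly
              (fun (μ : ℝ) (ζ : ℂ) => (μ ^ (1 + 1 / (k : ℝ)) : ℝ) •
                (Y (μ ^ s) (e.symm (((μ ^ (-(1 / (k : ℝ))) : ℝ) : ℂ) * ζ)) - Y (μ ^ s) p))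
              (fun ζ => r • A (LopezRos.enneper k ζ)) atTop) ∧
    (∀ (ε : ℝ) (F : ℂ → LopezRos.E3) (s : ℤ), 0 < ε → s = 1 ∨ s = -1 →
      LopezRos.IsFlatEnd F ε (-(s : ℝ) • LopezRos.e3) →
      ¬ LopezRos.IsPlanar (F '' LopezRos.puncturedDisc ε) →
      (∀ t : ℝ, 0 < t → ∃ Y : ℂ → LopezRos.E3,
        LopezRos.IsDeformationOn t F (LopezRos.puncturedDisc ε) Y) ∧
      ∃ Λ > 0, ∀ μ : ℝ, Λ ≤ μ → ∀ Y : ℂ → LopezRos.E3,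
        LopezRos.IsDeformationOn (μ ^ s) F (LopezRos.puncturedDisc ε) Y →
          ¬ InjOn Y (LopezRos.puncturedDisc ε)) := by
  refine ⟨fun X hX hnp p s hs hN => ?_, fun ε F s hε hs hF hnp => ?_⟩
  · have hW := hX.isWeierstrass
    rcases hs with rfl | rfl
    · obtain ⟨k, r, A, hk, hr, hdet, hAe, h⟩ := LopezRos.surface_deformation hW hnp (p := p)
        (by rw [hN]; simp)
      refine ⟨k, r, A, hk, hr, hdet, by rw [hAe]; simp, fun V hV => ?_⟩
      obtain ⟨e, hem, hpe, heV, hep, ht, ⟨c, hc, hg⟩, hex, hninj, hlim⟩ := h V hV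
      simp only [zpow_one]
      exact ⟨e, hem, hpe, heV, hep, ht, ⟨c, hc, fun q hq _ => hg q hq⟩, fun t _ => hex t, hninj,
        hlim⟩
    -- The half-turned surface has normal (0, 0, -1) at p, and its deformation with parameter μ is,
    -- up to translation, the half-turn of X with parameter 1/μ.
    · obtain ⟨T, hTdet, hT⟩ := LopezRos.exists_halfTurn
      replace hT : LopezRos.IsHalfTurn T := hT
      have hTT : T ∘ T ∘ X = X := funext fun q => hT.involutive (X q)
      obtain ⟨k, r, A, hk, hr, hdet, hAe, h⟩ := LopezRos.surface_deformation (X := T ∘ X) (p := p)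
        (hT.isWeierstrass hW) (by rw [range_comp]; exact hT.not_isPlanar hnp)
        (by rw [hT.normalAt, hN, ← hT.apply_e3]; simp)
      refine ⟨k, r, A.trans T, hk, hr, ?_, ?_, fun V hV => ?_⟩
      · have : ((A.trans T).toLinearEquiv : LopezRos.E3 →ₗ[ℝ] LopezRos.E3)
            = (T.toLinearEquiv : LopezRos.E3 →ₗ[ℝ] LopezRos.E3) ∘ₗ
              (A.toLinearEquiv : LopezRos.E3 →ₗ[ℝ] LopezRos.E3) := rfl
        rw [this, LinearMap.det_comp, hTdet, hdet, one_mul]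
      · rw [LinearIsometryEquiv.trans_apply, hAe, hT.apply_e3]; simp
      · obtain ⟨e, hem, hpe, heV, hep, ht, ⟨c, hc, hg⟩, hex, ⟨Λ, hΛ, hninj⟩, hlim⟩ := h V hV
        simp only [zpow_neg_one]
        refine ⟨e, hem, hpe, heV, hep, ht, ⟨c, hc, fun q hq _ => ?_⟩, fun t _ => ?_,
          ⟨Λ, hΛ, fun μ hμ Y hY hinj => ?_⟩, fun Y hY => ?_⟩
        · rw [← hg q hq, hT.normalAt]
          exact (LopezRos.stereo_halfTurn hT (LopezRos.norm_unitNormal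
            ((hW _ (chart_mem_atlas ℂ q)).conf _ (mem_chart_target ℂ q)))).symm
        · obtain ⟨Y, hY⟩ := hex t⁻¹
          have := hT.isDeformation (hT.isWeierstrass hW) hY
          rw [inv_inv, hTT] at this
          exact ⟨_, this⟩
        · have := hT.isDeformation hW hY
          rw [inv_inv] at this
          exact hninj μ hμ _ this (T.injective.comp_injOn hinj)
        -- The limit is first taken for the half-turned family; applying the involution T again
        -- returns to X and turns the limit A E_k into T A E_k.
        · have h1 := hlim (fun t => T ∘ Y t⁻¹) (fun t ht => by
            have := hT.isDeformation hW (hY t⁻¹ (inv_pos.2 ht))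
            rwa [inv_inv] at this)
          have h2 := T.isometry.uniformContinuous.comp_tendstoLocallyUniformly h1
          refine (h2.congr fun μ ζ => ?_).congr_right ?_
          · simp only [Function.comp_apply, map_smul, map_sub, hT.involutive]
          · intro ζ
            simp only [Function.comp_apply, map_smul, LinearIsometryEquiv.trans_apply]
  · have hW := hF.immersion.isWeierstrassOn (LopezRos.isOpen_puncturedDisc ε)
    have hlim := hF.limitNormal
    rcases hs with rfl | rfl
    · obtain ⟨hex, hninj⟩ := LopezRos.flatEnd_deformation hε hW hF.injective hF.complete
        (by simpa using hlim) hF.growth hnp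
      simp only [zpow_one]
      exact ⟨fun t _ => hex t, hninj⟩
    · obtain ⟨T, hTdet, hT⟩ := LopezRos.exists_halfTurn
      replace hT : LopezRos.IsHalfTurn T := hT
      have hTT : T ∘ T ∘ F = F := funext fun q => hT.involutive (F q)
      have hlim' : Tendsto (LopezRos.unitNormal (T ∘ F)) (𝓝[≠] 0) (𝓝 (-LopezRos.e3)) := by
        have h1 := (T.continuous.tendsto _).comp hlim
        have h2 : T (-((-1 : ℤ) : ℝ) • LopezRos.e3) = -LopezRos.e3 := by
          rw [← hT.apply_e3]; simp
        rw [h2] at h1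
        exact h1.congr fun z => hT.unitNormal.symm
      obtain ⟨hex, Λ, hΛ, hninj⟩ := LopezRos.flatEnd_deformation (F := T ∘ F) hε
        (hT.isWeierstrassOn hW) (T.injective.comp_injOn hF.injective)
        (LopezRos.IsHalfTurn.isCompleteAtPuncture hF.complete) hlim'
        (hT.hasLogarithmicGrowth hF.growth) (by rw [image_comp]; exact hT.not_isPlanar hnp)
      simp only [zpow_neg_one]
      refine ⟨fun t _ => ?_, Λ, hΛ, fun μ hμ Y hY hinj => ?_⟩
      · obtain ⟨Y, hY⟩ := hex t⁻¹
        have := hT.isDeformationOn (hT.isWeierstrassOn hW) hY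
        rw [inv_inv, hTT] at this
        exact ⟨_, this⟩
      · have := hT.isDeformationOn hW hY
        rw [inv_inv] at this
        exact hninj μ hμ _ this (T.injective.comp_injOn hinj)
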